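/- Fix real constants $B,C>0$ and let $B_c=1+\sqrt{1+1/C}$. For $n\ge 1$ and $0\le\delta\le 1$ let $\mathcal M_{n,\delta}(B,C)$ be the set of square matrices of size $\lfloor n^\delta\rfloor+n$ with entries in $\{0,1,2,\dots\}$ whose first $\lfloor n^\delta\rfloor$ rows and columns have sum $\lfloor BCn\rfloor$ and whose last $n$ rows and columns have sum $\lfloor Cn\rfloor$. Let $X=(X_{ij})$ be chosen uniformly at random from $\mathcal M_{n,\delta}(B,C)$. Write $a\wedge b=\min(a,b)$ and $a^+=\max(a,0)$. As $n\to\infty$, with implied constants that may depend on $B,C,\delta,\alpha,\varepsilon$ but not on $n$, the following hold. (i) For all $0\le\delta\le1$ and $\varepsilon>0$: $\bigl|\mathbb E[X_{n+1,n+1}]-C\bigr|=O(n^{\delta-1+\varepsilon})$. (ii) For all $\alpha,\varepsilon>0$: - if $B<B_c$ and $0<\delta<1$, then $\bigl|\mathbb E[X_{1,n+1}]-BC\bigr|=O\bigl(n^{\delta-1}+n^{-\delta/2+\varepsilon}\bigr)$; - if $B>B_c$ and $0<\delta<1$, then $\bigl|\mathbb E[X_{1,n+1}\wedge n^\alpha]-B_cC\bigr|=O\bigl(n^{\delta-1}+n^{\alpha-\delta/2+\varepsilon}\bigr)$;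 - if $B>B_c$ and $1/2<\delta<1$, then $\bigl|\mathbb E[X_{1,n+1}]-B_cC\bigr|=O\bigl(n^{\delta-1}+n^{1/2-\delta+\varepsilon}\bigr)$. (iii) For all $\alpha,\varepsilon>0$: - if $B<B_c$ and $0<\delta<1$, then $n^{\delta-1}\,\mathbb E[X_{11}]=O\bigl(n^{\delta-1}+n^{-\delta+\varepsilon}\bigr)$; - if $B<B_c$ and $1/2<\delta<1$, then $\Bigl|\mathbb E[X_{11}\wedge n^\alpha]-\frac{B^2(1+C)}{(B_c-B)(B+B_c-2)}\Bigr|=O\bigl(n^{\delta-1}+n^{\alpha+1/2-\delta+\varepsilon}\bigr)$; - if $B>B_c$ and $0<\delta<1$, then $\bigl|C(B-B_c)-n^{\delta-1}\,\mathbb E[X_{11}]-\mathbb E[(X_{1,n+1}-n^\alpha)^+]\bigr|=O\bigl(n^{\delta-1}+n^{\alpha-\delta/2+\varepsilon}\bigr)$; - if $B>B_c$ and $1/2<\delta<1$, then $\bigl|C(B-B_c)-n^{\delta-1}\,\mathbb E[X_{11}]\bigr|=O\bigl(n^{\delta-1}+n^{1/2-\delta+\varepsilon}\bigr)$. -/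

import Mathlib

open MeasureTheory ProbabilityTheory Filter Asymptotics Topology

noncomputable section

/-- The set of `p × q` contingency tables (matrices of natural numbers) with row sums `r` and
column sums `c`. -/
def contingencyTables {p q : ℕ} (r : Fin p → ℕ) (c : Fin q → ℕ) :
    Set (Matrix (Fin p) (Fin q) ℕ) :=
  {A | (∀ i, ∑ j, A i j = r i) ∧ (∀ j, ∑ i, A i j = c j)}

/-- The number `⌊n ^ δ⌋` of heavy rows, which is also the number of heavy columns. -/
def numHeavy (n : ℕ) (δ : ℝ) : ℕ := ⌊(n : ℝ) ^ δ⌋₊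

/-- The margin vector `(⌊B C n⌋, …, ⌊B C n⌋, ⌊C n⌋, …, ⌊C n⌋)`, with `⌊n ^ δ⌋` heavy entries
followed by `n` light ones. -/
def blockMargin (n : ℕ) (δ B C : ℝ) : Fin (numHeavy n δ + n) → ℕ :=
  fun i => if (i : ℕ) < numHeavy n δ then ⌊B * C * n⌋₊ else ⌊C * n⌋₊

/-- The type of the tables in `blockTables n δ B C`. -/
abbrev BlockTable (n : ℕ) (δ : ℝ) : Type :=
  Matrix (Fin (numHeavy n δ + n)) (Fin (numHeavy n δ + n)) ℕ

/-- The set `M_{n,δ}(B,C)`: both margins are `blockMargin n δ B C`. -/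
def blockTables (n : ℕ) (δ B C : ℝ) : Set (BlockTable n δ) :=
  contingencyTables (blockMargin n δ B C) (blockMargin n δ B C)

theorem blockTables_finite (n : ℕ) (δ B C : ℝ) : (blockTables n δ B C).Finite := by
  refine (Set.Finite.pi' (fun i => Set.Finite.pi' (fun _ =>
    Set.finite_Iic (blockMargin n δ B C i)))).subset ?_
  rintro A ⟨hA, -⟩ i j
  rw [Set.mem_Iic, ← hA i]
  exact Finset.single_le_sum (f := fun j => A i j) (fun _ _ => Nat.zero_le _) (Finset.mem_univ j)

theorem blockTables_nonempty (n : ℕ) (δ B C : ℝ) : (blockTables n δ B C).Nonempty :=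
  ⟨Matrix.diagonal (blockMargin n δ B C), by
    constructor <;> intro i <;> simp [Matrix.diagonal_apply]⟩

/-- Every set of tables is measurable. -/
instance blockTable_measurableSpace (n : ℕ) (δ : ℝ) : MeasurableSpace (BlockTable n δ) := ⊤

/-- The law of a uniformly random table `X` in `M_{n,δ}(B,C)`. -/
def uniformTable (n : ℕ) (δ B C : ℝ) : Measure (BlockTable n δ) :=
  uniformOn (blockTables n δ B C)

theorem uniformTable_isProbabilityMeasure (n : ℕ) (δ B C : ℝ) :
    IsProbabilityMeasure (uniformTable n δ B C) :=
  haveI : MeasurableSingletonClass (BlockTable n δ) := ⟨fun _ => trivial⟩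
  isProbabilityMeasure_uniformOn (blockTables_finite n δ B C) (blockTables_nonempty n δ B C)

/-- The entry in row `i` and column `j`, counted from `1` as in mathematical notation
(and `0` outside of the table). -/
def BlockTable.entry {n : ℕ} {δ : ℝ} (X : BlockTable n δ) (i j : ℕ) : ℝ :=
  if h : (1 ≤ i ∧ i ≤ numHeavy n δ + n) ∧ (1 ≤ j ∧ j ≤ numHeavy n δ + n) then
    (X ⟨i - 1, by omega⟩ ⟨j - 1, by omega⟩ : ℝ)
  else 0

/-- The critical value `B_c = 1 + √(1 + 1/C)`. -/
def criticalB (C : ℝ) : ℝ := 1 + √(1 + 1 / C)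

end

/-! Write k = ⌊n^δ⌋, p = ⌊BCn⌋, q = ⌊Cn⌋. The idea is to prescribe only the totals of the heavy and
of the light rows and columns. The four block totals then depend only on the sum a of the k × k
heavy block, and given a the four blocks are independent uniform compositions. This relaxed family
is not much larger than the original one: among all margins with given heavy and light totals the
block-constant margin admits the most tables, because moving a unit from a larger row to a smaller
one never decreases the count (`card_tables_le_card_tables_transfer`), and there are only n^{O(n)}
pairs of margins. So an event of relaxed probability exp(-c n^{1+ε}) stays negligible for the
uniform table (`tabAvg_le_of_strata`).

The number w(a) of relaxed tables is an explicit product, `stratumCard`, with w(a+1)/w(a) close to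
(1 + 1/z) (β/(β+1))² (1 + 1/C), where z = a/k² and β = (kp - a)/(kn) are the mean heavy and side
entries. The factor `heavyRatio`, which depends on β only, equals 1 exactly at β = B_c C. If B <
B_c, then β is about BC near the peak, the factor is some κ < 1, and w peaks where (1 + 1/z) κ = 1,
that is at z = κ/(1-κ) = `heavyMean`. If B > B_c, then w grows until β has dropped to B_c C, and the
surplus of the heavy rows has to sit in the heavy block.

At distance θ from the peak, in z or in β, the ratio differs from 1 by order θ. The window around
the peak is therefore left with relaxed probability about exp(-c θ² k²) if B < B_c, and exp(-c θ²
kn) if B > B_c. To beat n^{O(n)}, θ must be of order n^{1/2-δ+ε} or n^{-δ/2+ε} respectively; this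
and the relative errors of order k/n in the ratio produce the error terms (`subcritical_heavy`,
`supercritical_side`).

For the truncations, a uniform composition is a sequence of independent geometric variables
conditioned on its sum, so the total excess of a block over n^α has bounded exponential moments up
to factors n^{O(1)} (`sum_compositions_pow_le`). This excess is at most about n^{1+ε} on average,
and truncation hardly changes the means. Exchangeability inside the blocks and the row and column
sums then turn block sums into means of single entries. -/

/-! ### Symmetric unimodality and counting bounded vectors -/

/-- `F` is symmetric about `S / 2` and does not increase to the right of `S / 2`. -/
def SymmUnimodal (S : ℤ) (F : ℤ → ℤ) : Prop :=
  (∀ a, F (S - a) = F a) ∧ ∀ a, S < 2 * a → F a ≤ F (a - 1)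

theorem SymmUnimodal.antitone_right {S : ℤ} {F : ℤ → ℤ} (h : SymmUnimodal S F) {a : ℤ}
    (ha : S ≤ 2 * a) (m : ℕ) : F (a + m) ≤ F a := by
  induction m with
  | zero => simp
  | succ m ih =>
    have := h.2 (a + (m + 1 : ℕ)) (by push_cast; omega)
    have e : a + ((m + 1 : ℕ) : ℤ) - 1 = a + m := by push_cast; ring
    rw [e] at this
    exact this.trans ih

/-- The symmetry folds both points to the right of `S / 2`, where `F` is antitone. -/
theorem SymmUnimodal.le_of_abs_le {S : ℤ} {F : ℤ → ℤ} (h : SymmUnimodal S F) {a b : ℤ}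
    (hab : |2 * a - S| ≤ |2 * b - S|) : F b ≤ F a := by
  have key : ∀ a b : ℤ, S ≤ 2 * a → a ≤ b → F b ≤ F a := by
    intro a b ha hb
    have := h.antitone_right ha (b - a).toNat
    rwa [Int.toNat_of_nonneg (by omega), add_sub_cancel] at this
  have fold : ∀ a : ℤ, ∃ a', F a = F a' ∧ S ≤ 2 * a' ∧ |2 * a - S| = 2 * a' - S := by
    intro a
    rcases le_total S (2 * a) with h1 | h1
    · exact ⟨a, rfl, h1, abs_of_nonneg (by omega)⟩
    · exact ⟨S - a, (h.1 a).symm, by omega, by rw [abs_of_nonpos (by omega)]; ring⟩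
  obtain ⟨a', ea, ha, ha'⟩ := fold a
  obtain ⟨b', eb, hb, hb'⟩ := fold b
  rw [ea, eb]
  exact key _ _ ha (by omega)

/-- Symmetric unimodality is preserved by convolution with the indicator of `{0, …, s}`. -/
theorem SymmUnimodal.conv_range {S : ℤ} {F : ℤ → ℤ} (h : SymmUnimodal S F) (s : ℕ) :
    SymmUnimodal (S + s) (fun a => ∑ v ∈ Finset.range (s + 1), F (a - v)) := by
  constructor
  · intro a
    simp only
    rw [← Finset.sum_range_reflect]
    refine Finset.sum_congr rfl fun v hv => ?_
    have hv : v ≤ s := by simpa [Nat.lt_succ_iff] using hv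
    rw [← h.1 (a - v)]
    congr 1
    have : ((s + 1 - 1 - v : ℕ) : ℤ) = s - v := by omega
    rw [this]; ring
  · intro a ha
    have e1 := Finset.sum_range_succ (fun v : ℕ => F (a - v)) (s + 1)
    have e2 := Finset.sum_range_succ' (fun v : ℕ => F (a - v)) (s + 1)
    have e3 : ∑ v ∈ Finset.range (s + 1), F (a - 1 - v)
        = ∑ v ∈ Finset.range (s + 1), F (a - ((v + 1 : ℕ) : ℤ)) :=
      Finset.sum_congr rfl fun v _ => by congr 1; push_cast; ring
    -- The sums at `a` and `a - 1` differ only by `F a - F (a - s - 1)`. Since `S + s < 2 * a`, the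
    -- point `a - s - 1` is at least as close to `S / 2` as `a`.
    have h4 : F a ≤ F (a - ((s + 1 : ℕ) : ℤ)) := by
      apply h.le_of_abs_le
      rw [abs_le]
      have := le_abs_self (2 * a - S)
      push_cast
      constructor <;> omega
    simp only [Nat.cast_zero, sub_zero] at e2
    change _ ≤ ∑ v ∈ Finset.range (s + 1), F (a - 1 - v)
    rw [e3]
    linarith

/-- The coefficients of a polynomial, extended by zero to negative indices. -/
noncomputable def intCoeff (P : Polynomial ℤ) (a : ℤ) : ℤ := if 0 ≤ a then P.coeff a.toNat else 0

/-- On coefficients, multiplication by 1 + X + … + X^s is convolution with the indicator of {0, …,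
s}. Extending by zero to negative indices avoids boundary cases in `a - v`. -/
theorem intCoeff_mul_sum_X_pow (P : Polynomial ℤ) (s : ℕ) (a : ℤ) :
    intCoeff (P * ∑ v ∈ Finset.range (s + 1), Polynomial.X ^ v) a
      = ∑ v ∈ Finset.range (s + 1), intCoeff P (a - v) := by
  unfold intCoeff
  split_ifs with ha
  · rw [Finset.mul_sum, Polynomial.finsetSum_coeff]
    refine Finset.sum_congr rfl fun v _ => ?_
    rw [Polynomial.coeff_mul_X_pow']
    by_cases hv : v ≤ a.toNat
    · rw [if_pos hv, if_pos (by omega)]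
      congr 1
      omega
    · rw [if_neg hv, if_neg (by omega)]
  · symm
    exact Finset.sum_eq_zero fun v _ => if_neg (by omega)

/-- Each factor is one convolution as in `SymmUnimodal.conv_range`, starting from the polynomial 1,
which is symmetric about 0. -/
theorem symmUnimodal_prod {J : Type*} [DecidableEq J] (K : Finset J) (s : J → ℕ) :
    SymmUnimodal (∑ j ∈ K, (s j : ℤ))
      (intCoeff (∏ j ∈ K, ∑ v ∈ Finset.range (s j + 1), Polynomial.X ^ v)) := by
  induction K using Finset.induction_on with
  | empty =>
    have : ∀ a : ℤ, intCoeff 1 a = if a = 0 then 1 else 0 := by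
      intro a
      unfold intCoeff
      rw [Polynomial.coeff_one]
      split_ifs <;> first | rfl | omega
    constructor
    · intro a
      simp [this]
    · intro a ha
      simp only [Finset.prod_empty, this]
      simp only [Finset.sum_empty] at ha
      rw [if_neg (by omega)]
      split_ifs <;> simp
  | insert j K hj ih =>
    have := ih.conv_range (s j)
    rw [Finset.prod_insert hj, Finset.sum_insert hj, add_comm, mul_comm]
    convert this using 1
    funext a
    exact intCoeff_mul_sum_X_pow _ _ _

section
variable {J : Type*} [Fintype J] [DecidableEq J]

/-- The vectors `u ≤ s` with sum `a`. -/
def boundedVectors (s : J → ℕ) (a : ℕ) : Finset (J → ℕ) :=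
  (Fintype.piFinset fun j => Finset.range (s j + 1)).filter fun u => ∑ j, u j = a

theorem mem_boundedVectors {s : J → ℕ} {a : ℕ} {u : J → ℕ} :
    u ∈ boundedVectors s a ↔ u ≤ s ∧ ∑ j, u j = a := by
  simp [boundedVectors, Pi.le_def]

/-- Expanding the product gives one monomial X^(∑ u) for each vector u ≤ s. -/
theorem card_boundedVectors (s : J → ℕ) (a : ℕ) :
    ((boundedVectors s a).card : ℤ)
      = intCoeff (∏ j, ∑ v ∈ Finset.range (s j + 1), Polynomial.X ^ v) a := by
  rw [Finset.prod_univ_sum, intCoeff, if_pos (by omega), Polynomial.finsetSum_coeff,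
    boundedVectors, Finset.card_filter]
  push_cast
  refine Finset.sum_congr rfl fun u _ => ?_
  rw [Finset.prod_pow_eq_pow_sum, Polynomial.coeff_X_pow]
  simp [eq_comm]

/-- The counts are the unimodal coefficients above, and the hypothesis places `a + 1` to the right
of their centre. -/
theorem card_boundedVectors_le (s : J → ℕ) (a : ℕ) (ha : ∑ j, s j < 2 * (a + 1)) :
    (boundedVectors s (a + 1)).card ≤ (boundedVectors s a).card := by
  have := (symmUnimodal_prod Finset.univ s).2 ((a + 1 : ℕ) : ℤ) (by exact_mod_cast ha)
  have e : ((a + 1 : ℕ) : ℤ) - 1 = (a : ℤ) := by push_cast; ring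
  rw [e, ← card_boundedVectors, ← card_boundedVectors] at this
  exact_mod_cast this

end

/-! ### Equalizing margins does not decrease the number of tables -/

section
variable {I J : Type*} [Fintype I] [Fintype J] [DecidableEq I] [DecidableEq J]

/-- The tables with row sums `r` and column sums `c`. -/
def tables (r : I → ℕ) (c : J → ℕ) : Finset (I → J → ℕ) :=
  (Fintype.piFinset fun i => Fintype.piFinset fun _ => Finset.range (r i + 1)).filter
    fun A => (∀ i, ∑ j, A i j = r i) ∧ ∀ j, ∑ i, A i j = c j

theorem mem_tables {r : I → ℕ} {c : J → ℕ} {A : I → J → ℕ} :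
    A ∈ tables r c ↔ (∀ i, ∑ j, A i j = r i) ∧ ∀ j, ∑ i, A i j = c j := by
  simp only [tables, Finset.mem_filter, Fintype.mem_piFinset, Finset.mem_range,
    and_iff_right_iff_imp]
  rintro ⟨h, -⟩ i j
  rw [Nat.lt_succ_iff, ← h i]
  exact Finset.single_le_sum (f := fun j => A i j) (fun _ _ => Nat.zero_le _) (Finset.mem_univ j)

/-- The margins after moving one unit from row `i` to row `j`. -/
def transfer (r : I → ℕ) (i j : I) : I → ℕ :=
  fun l => if l = i then r i - 1 else if l = j then r j + 1 else r l

/-- Row `j` is replaced by the sum of rows `i` and `j`, and row `i` by zero. -/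
def mergeRows (i j : I) (A : I → J → ℕ) : I → J → ℕ :=
  fun l => if l = i then 0 else if l = j then A i + A j else A l

/-- Fix the sum `s` of rows `i` and `j` and all other rows. A table is then determined by its row
`i`, any vector below `s` with the prescribed sum. Lowering this sum from `r i` to `r i - 1` moves
it towards the middle `(r i + r j) / 2`, where there are more such vectors. -/
theorem card_tables_le_card_tables_transfer (r : I → ℕ) (c : J → ℕ) {i j : I} (hij : i ≠ j)
    (h : r j < r i) : (tables r c).card ≤ (tables (transfer r i j) c).card := by
  have fib : ∀ B : I → J → ℕ, ((tables r c).filter fun A => mergeRows i j A = B).card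
      ≤ ((tables (transfer r i j) c).filter fun A => mergeRows i j A = B).card := by
    intro B
    rcases Finset.eq_empty_or_nonempty ((tables r c).filter fun A => mergeRows i j A = B) with
      he | ⟨A₀, hA₀⟩
    · rw [he]; simp
    rw [Finset.mem_filter, mem_tables] at hA₀
    obtain ⟨⟨hr, hc⟩, rfl⟩ := hA₀
    set s : J → ℕ := A₀ i + A₀ j with hs
    have hsum : ∑ l, s l = r i + r j := by
      simp only [hs, Pi.add_apply, Finset.sum_add_distrib, hr]
    obtain ⟨m, hm⟩ : ∃ m, r i = m + 1 := ⟨r i - 1, by omega⟩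
    have h1 : ((tables r c).filter fun A => mergeRows i j A = mergeRows i j A₀).card
        ≤ (boundedVectors s (m + 1)).card := by
      refine Finset.card_le_card_of_injOn (fun A => A i) ?_ ?_
      · intro A hA
        simp only [Finset.coe_filter, Set.mem_ofPred_eq, mem_tables] at hA
        have hj := congrFun hA.2 j
        simp only [mergeRows, if_neg hij.symm, if_true] at hj
        rw [Finset.mem_coe, mem_boundedVectors]
        refine ⟨?_, by rw [hA.1.1 i, hm]⟩
        rw [hs, ← hj]
        intro l
        simp
      · intro A hA A' hA' hAA
        simp only [Finset.coe_filter, Set.mem_ofPred_eq] at hA hA'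
        have hm := hA.2.trans hA'.2.symm
        simp only at hAA
        funext l
        by_cases hli : l = i
        · rw [hli, hAA]
        have hl := congrFun hm l
        simp only [mergeRows, if_neg hli] at hl
        by_cases hlj : l = j
        · rw [if_pos hlj, if_pos hlj, hAA] at hl
          rw [hlj]
          exact add_left_cancel hl
        · rwa [if_neg hlj, if_neg hlj] at hl
    have h2 : (boundedVectors s m).card ≤
        ((tables (transfer r i j) c).filter fun A => mergeRows i j A = mergeRows i j A₀).card := by
      refine Finset.card_le_card_of_injOn
        (fun u l => if l = i then u else if l = j then s - u else A₀ l) ?_ ?_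
      · intro u hu
        rw [Finset.mem_coe, mem_boundedVectors] at hu
        obtain ⟨hus, hu⟩ := hu
        have hadd : u + (s - u) = s := add_tsub_cancel_of_le hus
        simp only [Finset.coe_filter, Set.mem_ofPred_eq, mem_tables]
        refine ⟨⟨?_, ?_⟩, ?_⟩
        · intro l
          by_cases hli : l = i
          · simp only [hli, if_true, transfer, hu]; omega
          by_cases hlj : l = j
          · simp only [hlj, if_neg hij.symm, if_true, transfer]
            have : ∑ l, u l + ∑ l, (s - u) l = ∑ l, s l := by
              rw [← Finset.sum_add_distrib]
              exact Finset.sum_congr rfl fun l _ => congrFun hadd l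
            omega
          · simp only [if_neg hli, if_neg hlj, transfer, hr]
        · intro l
          rw [← hc l]
          have split : ∀ f : I → ℕ, ∑ x, f x = f i + (f j + ∑ x ∈ (Finset.univ.erase i).erase j, f x) := by
            intro f
            rw [← Finset.add_sum_erase _ _ (Finset.mem_univ i),
              ← Finset.add_sum_erase (Finset.univ.erase i) f (a := j) (by simp [hij.symm])]
          rw [split, split (fun x => A₀ x l)]
          simp only [if_true, if_neg hij.symm]
          have e : ∑ x ∈ (Finset.univ.erase i).erase j,
              (if x = i then u else if x = j then s - u else A₀ x) l
              = ∑ x ∈ (Finset.univ.erase i).erase j, A₀ x l := by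
            refine Finset.sum_congr rfl fun x hx => ?_
            simp only [Finset.mem_erase, Finset.mem_univ, and_true] at hx
            rw [if_neg hx.2, if_neg hx.1]
          have := congrFun hadd l
          simp only [Pi.add_apply, hs] at this
          simp only [hs] at e ⊢
          omega
        · funext l
          by_cases hli : l = i
          · simp [mergeRows, hli]
          by_cases hlj : l = j
          · simp only [mergeRows, hlj, if_neg hij.symm, if_true, hadd]
            exact hs
          · simp [mergeRows, hli, hlj]
      · intro u _ u' _ huu
        have := congrFun huu i
        simpa using this
    -- The side condition is `r i + r j < 2 * r i`, which is `r j < r i`.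
    refine h1.trans (le_trans (card_boundedVectors_le s m ?_) h2)
    omega
  rw [Finset.card_eq_sum_card_fiberwise (f := mergeRows i j)
      (t := (tables r c ∪ tables (transfer r i j) c).image (mergeRows i j))
      (fun A hA => by
        simp only [Finset.coe_image, Finset.coe_union]
        exact Set.mem_image_of_mem _ (Or.inl hA)),
    Finset.card_eq_sum_card_fiberwise (s := tables (transfer r i j) c) (f := mergeRows i j)
      (t := (tables r c ∪ tables (transfer r i j) c).image (mergeRows i j))
      (fun A hA => by
        simp only [Finset.coe_image, Finset.coe_union]
        exact Set.mem_image_of_mem _ (Or.inr hA))]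
  exact Finset.sum_le_sum fun B _ => fib B

/-- Among all row margins with given block totals, the number of tables is largest for the margin
which is constant on blocks. -/
theorem card_tables_le_of_blockwise {κ : Type*} [DecidableEq κ] (b : I → κ) (v : κ → ℕ)
    (r : I → ℕ) (c : J → ℕ)
    (h : ∀ x, ∑ i with b i = x, r i = ∑ i with b i = x, v (b i)) :
    (tables r c).card ≤ (tables (fun i => v (b i)) c).card := by
  -- The truncated subtraction makes the measure the total excess of `r` over its target; each
  -- transfer lowers it.
  induction hN : ∑ i, (r i - v (b i)) using Nat.strong_induction_on generalizing r with
  | _ N ih =>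
  by_cases hle : ∀ i, r i ≤ v (b i)
  · have : r = fun i => v (b i) := by
      funext i
      have := (Finset.sum_eq_sum_iff_of_le (s := Finset.univ.filter fun l => b l = b i)
        (f := r) (g := fun l => v (b l)) (fun l _ => hle l)).1 (h (b i))
      exact this i (by simp)
    rw [this]
  push Not at hle
  obtain ⟨i, hi⟩ := hle
  -- As the block totals agree, a row above the target forces one below it in the same block.
  obtain ⟨j, hbj, hj⟩ : ∃ j, b j = b i ∧ r j < v (b j) := by
    by_contra! hcon
    have : ∑ l with b l = b i, v (b l) < ∑ l with b l = b i, r l := by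
      refine Finset.sum_lt_sum (fun l hl => hcon l (by simpa using hl)) ⟨i, by simp, hi⟩
    rw [h] at this
    exact lt_irrefl _ this
  have hij : i ≠ j := by rintro rfl; omega
  rw [hbj] at hj
  have step := card_tables_le_card_tables_transfer r c hij (by omega)
  refine step.trans (ih _ ?_ (transfer r i j) ?_ rfl)
  · rw [← hN]
    refine Finset.sum_lt_sum ?_ ⟨i, Finset.mem_univ _, ?_⟩
    · intro l _
      unfold transfer
      split_ifs with h1 h2
      · subst h1; omega
      · subst h2; rw [hbj]; omega
      · exact le_rfl
    · simp only [transfer, if_true]; omega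
  · intro x
    rw [← h x]
    by_cases hx : b i = x
    · have split : ∀ f : I → ℕ, ∑ l with b l = x, f l
          = f i + (f j + ∑ l ∈ ((Finset.univ.filter fun l => b l = x).erase i).erase j, f l) := by
        intro f
        rw [← Finset.add_sum_erase _ f (a := i) (by simp [hx]),
          ← Finset.add_sum_erase _ f (a := j) (by simp [hij.symm, hbj, hx])]
      rw [split, split r]
      have e : ∑ l ∈ ((Finset.univ.filter fun l => b l = x).erase i).erase j, transfer r i j l
          = ∑ l ∈ ((Finset.univ.filter fun l => b l = x).erase i).erase j, r l := by
        refine Finset.sum_congr rfl fun l hl => ?_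
        simp only [Finset.mem_erase] at hl
        simp [transfer, hl.1, hl.2.1]
      rw [e]
      simp only [transfer, if_true, if_neg hij.symm]
      omega
    · refine Finset.sum_congr rfl fun l hl => ?_
      simp only [Finset.mem_filter, Finset.mem_univ, true_and] at hl
      have h1 : l ≠ i := by rintro rfl; exact hx hl
      have h2 : l ≠ j := by rintro rfl; exact hx (hbj ▸ hl)
      simp [transfer, h1, h2]

theorem card_tables_comm (r : I → ℕ) (c : J → ℕ) : (tables r c).card = (tables c r).card := by
  refine Finset.card_bij' (fun A _ j i => A i j) (fun A _ i j => A j i) ?_ ?_ ?_ ?_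
  · intro A hA
    rw [mem_tables] at hA ⊢
    exact ⟨hA.2, hA.1⟩
  · intro A hA
    rw [mem_tables] at hA ⊢
    exact ⟨hA.2, hA.1⟩
  · intros; rfl
  · intros; rfl

end

/-! ### Tables with prescribed block totals only -/

/-- The vectors of natural numbers with sum `s`. -/
def compositions (σ : Type*) [Fintype σ] [DecidableEq σ] (s : ℕ) : Finset (σ → ℕ) :=
  Finset.piAntidiag Finset.univ s

theorem mem_compositions {σ : Type*} [Fintype σ] [DecidableEq σ] {s : ℕ} {y : σ → ℕ} :
    y ∈ compositions σ s ↔ ∑ i, y i = s := by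
  simp [compositions]

theorem card_compositions (σ : Type*) [Fintype σ] [DecidableEq σ] (s : ℕ) :
    (compositions σ s).card = (Fintype.card σ).multichoose s := by
  rw [← Finset.card_univ, ← Finset.card_finsuppAntidiag_nat_eq_multichoose, compositions,
    Finset.finsuppAntidiag, Finset.card_map, Finset.card_attach]

section
variable {U V : Type*}

/-- Quadruples of blocks. -/
abbrev Blocks (U V : Type*) : Type _ :=
  (U × U → ℕ) × (U × V → ℕ) × (V × U → ℕ) × (V × V → ℕ)

/-- The table with given blocks. -/
def glue (x : Blocks U V) : U ⊕ V → U ⊕ V → ℕ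
  | .inl u, .inl u' => x.1 (u, u')
  | .inl u, .inr v => x.2.1 (u, v)
  | .inr v, .inl u => x.2.2.1 (v, u)
  | .inr v, .inr v' => x.2.2.2 (v, v')

/-- The blocks of a table. -/
def unglue (A : U ⊕ V → U ⊕ V → ℕ) : Blocks U V :=
  (fun x => A (.inl x.1) (.inl x.2), fun x => A (.inl x.1) (.inr x.2),
    fun x => A (.inr x.1) (.inl x.2), fun x => A (.inr x.1) (.inr x.2))

theorem glue_unglue (A : U ⊕ V → U ⊕ V → ℕ) : glue (unglue A) = A := by
  funext i j
  rcases i with i | i <;> rcases j with j | j <;> rfl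

theorem unglue_glue (x : Blocks U V) : unglue (glue x) = x := rfl

theorem glue_injective : Function.Injective (glue : Blocks U V → U ⊕ V → U ⊕ V → ℕ) :=
  Function.LeftInverse.injective unglue_glue

theorem unglue_injective : Function.Injective (unglue (U := U) (V := V)) :=
  Function.LeftInverse.injective glue_unglue

end

section
variable {U V : Type*} [Fintype U] [Fintype V] [DecidableEq U] [DecidableEq V]

/-- The margin equal to `p` on `U` and to `q` on `V`. -/
def blockVec (U V : Type*) (p q : ℕ) : U ⊕ V → ℕ := fun i => if i.isLeft then p else q

/-- The tables with margins `p` on `U` and `q` on `V`. -/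
def blockTabs (U V : Type*) [Fintype U] [Fintype V] [DecidableEq U] [DecidableEq V] (p q : ℕ) :
    Finset (U ⊕ V → U ⊕ V → ℕ) :=
  tables (blockVec U V p q) (blockVec U V p q)

theorem blockTabs_nonempty (p q : ℕ) : (blockTabs U V p q).Nonempty := by
  refine ⟨Matrix.diagonal (blockVec U V p q), mem_tables.2 ⟨fun i => ?_, fun i => ?_⟩⟩ <;>
  simp [Matrix.diagonal_apply]

/-- Any margin with the same block totals admits at most as many tables. -/
theorem card_tables_le_card_blockTabs (p q : ℕ) (r c : U ⊕ V → ℕ)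
    (hr : ∑ u, r (.inl u) = Fintype.card U * p) (hr' : ∑ v, r (.inr v) = Fintype.card V * q)
    (hc : ∑ u, c (.inl u) = Fintype.card U * p) (hc' : ∑ v, c (.inr v) = Fintype.card V * q) :
    (tables r c).card ≤ (blockTabs U V p q).card := by
  have key : ∀ r : U ⊕ V → ℕ, ∑ u, r (.inl u) = Fintype.card U * p →
      ∑ v, r (.inr v) = Fintype.card V * q → ∀ x : Bool,
      ∑ i with (Sum.isLeft i : Bool) = x, r i
        = ∑ i : U ⊕ V with (Sum.isLeft i : Bool) = x, if (Sum.isLeft i : Bool) then p else q := by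
    intro r h h' x
    rw [Finset.sum_filter, Finset.sum_filter, Fintype.sum_sum_type, Fintype.sum_sum_type]
    cases x <;> simp [h, h']
  have h1 := card_tables_le_of_blockwise (fun i : U ⊕ V => (Sum.isLeft i : Bool))
    (fun x => if x then p else q) r c (key r hr hr')
  have h2 := card_tables_le_of_blockwise (fun i : U ⊕ V => (Sum.isLeft i : Bool))
    (fun x => if x then p else q) c (blockVec U V p q) (key c hc hc')
  -- The row margins have been equalized; transposing lets the same argument equalize the column
  -- margins.
  refine h1.trans ?_
  rw [card_tables_comm]
  exact h2

/-- The sum of the `U × U` block. -/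
def heavySum (A : U ⊕ V → U ⊕ V → ℕ) : ℕ := ∑ x : U × U, (unglue A).1 x

/-- The quadruples of blocks with row and column block totals `card U * p`, `card V * q`, and whose
first block has sum `a`. -/
def stratum (U V : Type*) [Fintype U] [Fintype V] [DecidableEq U] [DecidableEq V] (p q a : ℕ) :
    Finset (Blocks U V) :=
  compositions (U × U) a ×ˢ compositions (U × V) (Fintype.card U * p - a) ×ˢ
    compositions (V × U) (Fintype.card U * p - a) ×ˢ
    compositions (V × V) (Fintype.card V * q - (Fintype.card U * p - a))

/-- The heavy row, heavy column and light row totals determine the other three block sums from that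
of the heavy block. -/
theorem unglue_mem_stratum {p q : ℕ} {A : U ⊕ V → U ⊕ V → ℕ} (hA : A ∈ blockTabs U V p q) :
    unglue A ∈ stratum U V p q (heavySum A) ∧ heavySum A ≤ Fintype.card U * p := by
  rw [blockTabs, mem_tables] at hA
  obtain ⟨hr, hc⟩ := hA
  have r1 : ∑ u, ∑ j, A (.inl u) j = Fintype.card U * p := by simp [hr, blockVec]
  have r2 : ∑ v, ∑ j, A (.inr v) j = Fintype.card V * q := by simp [hr, blockVec]
  have c1 : ∑ u, ∑ i, A i (.inl u) = Fintype.card U * p := by simp [hc, blockVec]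
  simp only [Fintype.sum_sum_type, Finset.sum_add_distrib] at r1 r2 c1
  rw [Finset.sum_comm (f := fun u v => A (.inr v) (.inl u))] at c1
  have e := Finset.sum_comm (s := Finset.univ) (t := Finset.univ)
    (f := fun u u' => A (Sum.inl u : U ⊕ V) (Sum.inl u'))
  simp only [stratum, Finset.mem_product, mem_compositions, heavySum, unglue,
    Fintype.sum_prod_type]
  refine ⟨⟨trivial, ?_, ?_, ?_⟩, ?_⟩ <;> omega

/-- Passing from exact margins to block totals only adds nonnegative terms. -/
theorem sum_blockTabs_le (p q : ℕ) (f : (U ⊕ V → U ⊕ V → ℕ) → ℝ) (hf : ∀ A, 0 ≤ f A) :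
    ∑ A ∈ blockTabs U V p q, f A
      ≤ ∑ a ∈ Finset.range (Fintype.card U * p + 1), ∑ x ∈ stratum U V p q a, f (glue x) := by
  rw [← Finset.sum_fiberwise_of_maps_to (g := heavySum)
    (t := Finset.range (Fintype.card U * p + 1))
    (fun A hA => Finset.mem_range.2 (Nat.lt_succ_of_le (unglue_mem_stratum hA).2))]
  classical
  refine Finset.sum_le_sum fun a _ => ?_
  calc ∑ A ∈ blockTabs U V p q with heavySum A = a, f A
      = ∑ A ∈ blockTabs U V p q with heavySum A = a, f (glue (unglue A)) := by
        simp only [glue_unglue]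
    _ = ∑ x ∈ ((blockTabs U V p q).filter fun A => heavySum A = a).image unglue, f (glue x) :=
        (Finset.sum_image (f := fun x => f (glue x)) unglue_injective.injOn).symm
    _ ≤ _ := by
        refine Finset.sum_le_sum_of_subset_of_nonneg ?_ fun x _ _ => hf _
        intro x hx
        obtain ⟨A, hA, rfl⟩ := Finset.mem_image.1 hx
        rw [Finset.mem_filter] at hA
        rw [← hA.2]
        exact (unglue_mem_stratum hA.1).1

/-- The number of quadruples in `stratum`, in terms of the sizes of the blocks. -/
def stratumCard (k n p q a : ℕ) : ℕ :=
  (k * k).multichoose a * (k * n).multichoose (k * p - a) ^ 2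
    * (n * n).multichoose (n * q - (k * p - a))

theorem card_stratum (p q a : ℕ) :
    (stratum U V p q a).card = stratumCard (Fintype.card U) (Fintype.card V) p q a := by
  simp only [stratum, Finset.card_product, card_compositions, Fintype.card_prod, stratumCard,
    mul_comm (Fintype.card V) (Fintype.card U)]
  ring

/-- The strata together exceed the tables with block-constant margins by at most the number of
possible margins. -/
theorem sum_card_stratum_le (p q : ℕ)
    (hpq : Fintype.card U * p ≤ Fintype.card V * q) :
    ∑ a ∈ Finset.range (Fintype.card U * p + 1), (stratum U V p q a).card
      ≤ (Fintype.card U * p + Fintype.card V * q + 1) ^ (2 * (Fintype.card U + Fintype.card V))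
        * (blockTabs U V p q).card := by
  set R := Fintype.card U * p + Fintype.card V * q with hR
  set box : Finset (U ⊕ V → ℕ) := (Fintype.piFinset fun _ => Finset.range (R + 1)).filter fun r =>
    ∑ u, r (.inl u) = Fintype.card U * p ∧ ∑ v, r (.inr v) = Fintype.card V * q with hbox
  have hboxcard : box.card ≤ (R + 1) ^ (Fintype.card U + Fintype.card V) := by
    refine (Finset.card_filter_le _ _).trans ?_
    simp [Fintype.card_piFinset]
  have hmem : ∀ r : U ⊕ V → ℕ, ∑ u, r (.inl u) = Fintype.card U * p →
      ∑ v, r (.inr v) = Fintype.card V * q → r ∈ box := by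
    intro r h1 h2
    refine Finset.mem_filter.2 ⟨?_, h1, h2⟩
    rw [Fintype.mem_piFinset]
    intro i
    have : r i ≤ ∑ i, r i := Finset.single_le_sum (fun _ _ => Nat.zero_le _) (Finset.mem_univ i)
    rw [Fintype.sum_sum_type, h1, h2] at this
    exact Finset.mem_range.2 (Nat.lt_succ_of_le this)
  rw [← Finset.card_sigma]
  -- Each quadruple of blocks is a table for its own margins, and these margins lie in `box`.
  have h1 : ((Finset.range (Fintype.card U * p + 1)).sigma
      fun a => stratum U V p q a).card
      ≤ ((box ×ˢ box).biUnion fun rc => tables rc.1 rc.2).card := by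
    refine Finset.card_le_card_of_injOn (fun x => glue x.2) ?_ ?_
    · rintro ⟨a, x⟩ hx
      simp only [Finset.coe_sigma, Set.mem_sigma_iff, Finset.mem_coe, Finset.mem_range, stratum,
        Finset.mem_product, mem_compositions, Fintype.sum_prod_type] at hx
      rw [Finset.mem_coe, Finset.mem_biUnion]
      refine ⟨(fun i => ∑ j, glue x i j, fun j => ∑ i, glue x i j), ?_,
        mem_tables.2 ⟨fun _ => rfl, fun _ => rfl⟩⟩
      obtain ⟨h0, h1, h2, h3, h4⟩ := hx
      rw [Finset.mem_product]
      constructor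
      · apply hmem
        · simp only [Fintype.sum_sum_type, glue, Finset.sum_add_distrib, h1, h2]; omega
        · simp only [Fintype.sum_sum_type, glue, Finset.sum_add_distrib, h3, h4]; omega
      · rw [Finset.sum_comm] at h1 h2 h3 h4
        apply hmem
        · simp only [Fintype.sum_sum_type, glue, Finset.sum_add_distrib, h1, h3]; omega
        · simp only [Fintype.sum_sum_type, glue, Finset.sum_add_distrib, h2, h4]; omega
    · rintro ⟨a, x⟩ hx ⟨a', x'⟩ hx' hxx
      have hxx : x = x' := glue_injective hxx
      subst hxx
      simp only [Finset.coe_sigma, Set.mem_sigma_iff, Finset.mem_coe, stratum,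
        Finset.mem_product, mem_compositions] at hx hx'
      rw [← hx.2.1, ← hx'.2.1]
  refine h1.trans (Finset.card_biUnion_le.trans ?_)
  calc ∑ rc ∈ box ×ˢ box, (tables rc.1 rc.2).card
      ≤ ∑ _rc ∈ box ×ˢ box, (blockTabs U V p q).card := by
        refine Finset.sum_le_sum fun rc hrc => ?_
        simp only [Finset.mem_product, hbox, Finset.mem_filter] at hrc
        exact card_tables_le_card_blockTabs p q _ _ hrc.1.2.1 hrc.1.2.2 hrc.2.2.1 hrc.2.2.2
    _ = (box.card * box.card) * (blockTabs U V p q).card := by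
        rw [Finset.sum_const, Finset.card_product, smul_eq_mul]
    _ ≤ _ := by
        refine Nat.mul_le_mul_right _ ((Nat.mul_le_mul hboxcard hboxcard).trans (le_of_eq ?_))
        rw [← pow_add]; congr 1; ring

end

/-! ### Counting compositions and exponential moments of their excess -/

theorem succ_mul_multichoose_succ (m s : ℕ) :
    (s + 1) * m.multichoose (s + 1) = (m + s) * m.multichoose s := by
  rcases m with _ | m
  · rcases s with _ | s <;> simp [Nat.multichoose_zero_succ]
  · rw [Nat.multichoose_eq, Nat.multichoose_eq]
    have := Nat.add_one_mul_choose_eq (m + s) s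
    have e1 : m + 1 + (s + 1) - 1 = m + s + 1 := by omega
    have e2 : m + 1 + s - 1 = m + s := by omega
    rw [e1, e2]
    linarith

/-- The Poisson weight s^j / j! is largest at j = s. -/
theorem factorial_mul_pow_le (s j : ℕ) : s.factorial * s ^ j ≤ j.factorial * s ^ s := by
  rcases le_total s j with h | h
  · calc s.factorial * s ^ j = s.factorial * s ^ (j - s) * s ^ s := by
          rw [mul_assoc, ← pow_add, Nat.sub_add_cancel h]
      _ ≤ _ := Nat.mul_le_mul_right _ (Nat.factorial_mul_pow_sub_le_factorial h)
  · have h1 := Nat.factorial_mul_descFactorial (Nat.sub_le s j)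
    rw [Nat.sub_sub_self h] at h1
    calc s.factorial * s ^ j = j.factorial * (s.descFactorial (s - j) * s ^ j) := by
          rw [← h1, mul_assoc]
      _ ≤ j.factorial * (s ^ (s - j) * s ^ j) :=
          Nat.mul_le_mul_left _ (Nat.mul_le_mul_right _ (Nat.descFactorial_le_pow _ _))
      _ = _ := by rw [← pow_add, Nat.sub_add_cancel h]

/-- The largest term in the binomial expansion of `(s + m) ^ (s + m)` has index `s`. -/
theorem pow_le_choose_mul_pow (s m : ℕ) :
    (s + m) ^ (s + m) ≤ (s + m + 1) * ((s + m).choose s * s ^ s * m ^ m) := by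
  rw [add_pow]
  refine (Finset.sum_le_card_nsmul _ _ ((s + m).choose s * s ^ s * m ^ m) ?_).trans
    (by rw [Finset.card_range, smul_eq_mul])
  intro j hj
  have hj : j ≤ s + m := by simpa [Nat.lt_succ_iff] using hj
  rw [Nat.cast_id]
  have h1 := factorial_mul_pow_le s j
  have h2 := factorial_mul_pow_le m (s + m - j)
  have c1 := Nat.choose_mul_factorial_mul_factorial hj
  have c2 := Nat.choose_mul_factorial_mul_factorial (Nat.le_add_right s m)
  rw [Nat.add_sub_cancel_left] at c2
  have hpos : 0 < j.factorial * (s + m - j).factorial * (s.factorial * m.factorial) := by positivity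
  refine Nat.le_of_mul_le_mul_left ?_ hpos
  calc _ = ((s + m).choose j * j.factorial * (s + m - j).factorial)
        * ((s.factorial * s ^ j) * (m.factorial * m ^ (s + m - j))) := by ring
    _ ≤ (s + m).factorial * ((j.factorial * s ^ s) * ((s + m - j).factorial * m ^ m)) := by
        rw [c1]; gcongr
    _ = _ := by rw [← c2]; ring

/-- With q = s/(s+m), the quantity q^s (1-q)^m `m.multichoose s` is the probability that `m`
independent geometric variables of ratio q sum to their mean `s`. It is polynomially large since it
is `m / (s + m)` times the largest term of a binomial distribution. -/
theorem one_le_multichoose_mul (m s : ℕ) (hm : 0 < m) :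
    (1 : ℝ) ≤ (s + m + 1) ^ 2 * (m.multichoose s : ℝ)
      * ((s / (s + m) : ℝ) ^ s * (m / (s + m) : ℝ) ^ m) := by
  have h1 : ((s : ℝ) + m) ^ (s + m) ≤ (s + m + 1) * ((s + m).choose s * s ^ s * m ^ m) := by
    exact_mod_cast pow_le_choose_mul_pow s m
  have h2 : ((s + m).choose s : ℝ) * m = m.multichoose s * (s + m) := by
    have := Nat.choose_mul_succ_eq (s + m - 1) s
    have e : s + m - 1 + 1 = s + m := by omega
    rw [e, Nat.add_sub_cancel_left] at this
    rw [Nat.multichoose_eq, add_comm m s]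
    exact_mod_cast this.symm
  have hm' : (1 : ℝ) ≤ m := by exact_mod_cast hm
  have hs : (0 : ℝ) ≤ s := Nat.cast_nonneg _
  have hpos : (0 : ℝ) < (s + m) ^ (s + m) := by positivity
  have h3 : ((s + m).choose s : ℝ) ≤ m.multichoose s * (s + m + 1) := by
    have : ((s + m).choose s : ℝ) * 1 ≤ (s + m).choose s * m := by gcongr
    rw [h2, mul_one] at this
    exact this.trans (mul_le_mul_of_nonneg_left (by linarith) (Nat.cast_nonneg _))
  rw [div_pow, div_pow, div_mul_div_comm, ← pow_add, mul_div_assoc', le_div_iff₀ hpos, one_mul]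
  calc ((s : ℝ) + m) ^ (s + m) ≤ (s + m + 1) * ((s + m).choose s * s ^ s * m ^ m) := h1
    _ ≤ (s + m + 1) * (m.multichoose s * (s + m + 1) * s ^ s * m ^ m) := by gcongr
    _ = _ := by ring

/-- Up to `M` the summand is q^v; from `M` on it is q^M (q x)^(v-M). Both parts are geometric
series. -/
theorem sum_range_pow_mul_pow_le {q x : ℝ} (hq : 0 ≤ q) (hx : 1 ≤ x) (hqx : q * x < 1)
    (M s : ℕ) :
    ∑ v ∈ Finset.range (s + 1), q ^ v * x ^ (v - M) ≤ (1 - q)⁻¹ + q ^ M * (1 - q * x)⁻¹ := by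
  have hqx0 : 0 ≤ q * x := by positivity
  have hq1 : q < 1 := by nlinarith
  have geo : ∀ r : ℝ, 0 ≤ r → r < 1 → ∀ S : Finset ℕ, ∑ v ∈ S, r ^ v ≤ (1 - r)⁻¹ := by
    intro r h0 h1 S
    rw [← tsum_geometric_of_lt_one h0 h1]
    exact (summable_geometric_of_lt_one h0 h1).sum_le_tsum _ (fun _ _ => by positivity)
  calc ∑ v ∈ Finset.range (s + 1), q ^ v * x ^ (v - M)
      ≤ ∑ v ∈ Finset.range (s + 1), (q ^ v + if M ≤ v then q ^ M * (q * x) ^ (v - M) else 0) := by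
        refine Finset.sum_le_sum fun v _ => ?_
        split_ifs with h
        · have : q ^ v * x ^ (v - M) = q ^ M * (q * x) ^ (v - M) := by
            rw [mul_pow, ← mul_assoc, ← pow_add, Nat.add_sub_cancel' h]
          rw [this]
          have : 0 ≤ q ^ v := by positivity
          linarith
        · rw [Nat.sub_eq_zero_of_le (by omega)]; simp
    _ = ∑ v ∈ Finset.range (s + 1), q ^ v
        + q ^ M * ∑ v ∈ (Finset.range (s + 1)).filter fun v => M ≤ v, (q * x) ^ (v - M) := by
        rw [Finset.sum_add_distrib, ← Finset.sum_filter, Finset.mul_sum]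
    _ ≤ _ := by
        gcongr
        · exact geo q hq hq1 _
        · rw [← Finset.sum_image (f := fun v => (q * x) ^ v) (g := fun v => v - M)]
          · exact geo _ hqx0 hqx _
          · intro v hv w hw h
            simp only [Finset.coe_filter, Set.mem_ofPred_eq] at hv hw
            simp only at h
            omega

/-- Exponential moments of the excess over `M` of a uniformly random composition. -/
theorem sum_compositions_pow_le {σ : Type*} [Fintype σ] [DecidableEq σ] {K : ℝ} (hK : 0 < K)
    (s M : ℕ) (hσ : 0 < Fintype.card σ) (hs : (s : ℝ) ≤ K * Fintype.card σ) :
    ∑ y ∈ compositions σ s, (1 + 1 / (2 * K)) ^ (∑ i, (y i - M))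
      ≤ (s + Fintype.card σ + 1) ^ 2
        * Real.exp (Fintype.card σ * (2 * (1 + K) * (K / (1 + K)) ^ M))
        * ((Fintype.card σ).multichoose s : ℝ) := by
  set m := Fintype.card σ with hm
  set x : ℝ := 1 + 1 / (2 * K) with hx
  set q : ℝ := s / (s + m) with hq
  set q₀ : ℝ := K / (1 + K) with hq0
  have hm' : (0 : ℝ) < m := by exact_mod_cast hσ
  have hs0 : (0 : ℝ) ≤ s := Nat.cast_nonneg _
  have hqn : 0 ≤ q := by positivity
  have hx1 : 1 ≤ x := by rw [hx]; have : 0 < 1 / (2 * K) := by positivity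
                         linarith
  have hqq : q ≤ q₀ := by
    rw [hq, hq0, div_le_div_iff₀ (by positivity) (by positivity)]
    nlinarith
  have h1q : (m : ℝ) / (s + m) = 1 - q := by rw [hq]; field_simp; ring
  -- `x` is the midpoint of 1 and 1/q₀ = 1 + 1/K, so the tilted geometric series converges with a
  -- margin depending on `K` only.
  have hq0x : 1 - q₀ * x = (2 * (1 + K))⁻¹ := by
    rw [hq0, hx]; field_simp; ring
  have hqx : 1 - q * x ≥ (2 * (1 + K))⁻¹ := by
    rw [← hq0x]; nlinarith
  have hposK : 0 < (2 * (1 + K))⁻¹ := by positivity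
  have hqx1 : q * x < 1 := by linarith
  have h1q0 : 0 < 1 - q := by rw [← h1q]; positivity
  have hbase : (1 - q) * ∑ v ∈ Finset.range (s + 1), q ^ v * x ^ (v - M)
      ≤ 1 + 2 * (1 + K) * q₀ ^ M := by
    calc (1 - q) * ∑ v ∈ Finset.range (s + 1), q ^ v * x ^ (v - M)
        ≤ (1 - q) * ((1 - q)⁻¹ + q ^ M * (1 - q * x)⁻¹) := by
          gcongr
          exact sum_range_pow_mul_pow_le hqn hx1 hqx1 M s
      _ = 1 + (1 - q) * (q ^ M * (1 - q * x)⁻¹) := by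
          rw [mul_add, mul_inv_cancel₀ h1q0.ne']
      _ ≤ 1 + 1 * (q₀ ^ M * ((2 * (1 + K))⁻¹)⁻¹) := by
          gcongr
          linarith
      _ = _ := by rw [inv_inv]; ring
  -- Every composition of `s` has the same geometric weight q^s. Dropping the condition on the sum
  -- turns the moment into a product over the coordinates.
  have hsum : q ^ s * ∑ y ∈ compositions σ s, x ^ (∑ i, (y i - M))
      ≤ (∑ v ∈ Finset.range (s + 1), q ^ v * x ^ (v - M)) ^ m := by
    have e : (∑ v ∈ Finset.range (s + 1), q ^ v * x ^ (v - M)) ^ m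
        = ∏ _i : σ, ∑ v ∈ Finset.range (s + 1), q ^ v * x ^ (v - M) := by
      rw [Finset.prod_const, Finset.card_univ]
    rw [e, Finset.prod_univ_sum, Finset.mul_sum]
    calc ∑ y ∈ compositions σ s, q ^ s * x ^ (∑ i, (y i - M))
        = ∑ y ∈ compositions σ s, ∏ i, q ^ y i * x ^ (y i - M) := by
          refine Finset.sum_congr rfl fun y hy => ?_
          rw [mem_compositions] at hy
          rw [Finset.prod_mul_distrib, Finset.prod_pow_eq_pow_sum, Finset.prod_pow_eq_pow_sum, hy]
      _ ≤ _ := by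
          refine Finset.sum_le_sum_of_subset_of_nonneg ?_ fun y _ _ => ?_
          · intro y hy
            rw [mem_compositions] at hy
            rw [Fintype.mem_piFinset]
            intro i
            rw [Finset.mem_range, Nat.lt_succ_iff, ← hy]
            exact Finset.single_le_sum (fun _ _ => Nat.zero_le _) (Finset.mem_univ i)
          · exact Finset.prod_nonneg fun i _ => by positivity
  -- Conditioning on the sum `s` costs only the polynomial factor (s+m+1)².
  have hone := one_le_multichoose_mul m s hσ
  rw [h1q, ← hq] at hone
  have hG : 0 ≤ ∑ y ∈ compositions σ s, x ^ (∑ i, (y i - M)) :=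
    Finset.sum_nonneg fun _ _ => by positivity
  calc ∑ y ∈ compositions σ s, x ^ (∑ i, (y i - M))
      = 1 * ∑ y ∈ compositions σ s, x ^ (∑ i, (y i - M)) := (one_mul _).symm
    _ ≤ ((s + m + 1) ^ 2 * (m.multichoose s : ℝ) * (q ^ s * (1 - q) ^ m))
        * ∑ y ∈ compositions σ s, x ^ (∑ i, (y i - M)) := by gcongr
    _ = (s + m + 1) ^ 2 * (m.multichoose s : ℝ)
        * ((1 - q) ^ m * (q ^ s * ∑ y ∈ compositions σ s, x ^ (∑ i, (y i - M)))) := by ring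
    _ ≤ (s + m + 1) ^ 2 * (m.multichoose s : ℝ)
        * ((1 - q) ^ m * (∑ v ∈ Finset.range (s + 1), q ^ v * x ^ (v - M)) ^ m) := by gcongr
    _ = (s + m + 1) ^ 2 * (m.multichoose s : ℝ)
        * ((1 - q) * ∑ v ∈ Finset.range (s + 1), q ^ v * x ^ (v - M)) ^ m := by rw [mul_pow]
    _ ≤ (s + m + 1) ^ 2 * (m.multichoose s : ℝ) * (Real.exp (2 * (1 + K) * q₀ ^ M)) ^ m := by
        have : 0 ≤ ∑ v ∈ Finset.range (s + 1), q ^ v * x ^ (v - M) :=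
          Finset.sum_nonneg fun _ _ => by positivity
        gcongr
        refine hbase.trans ?_
        rw [add_comm]
        exact Real.add_one_le_exp _
    _ = _ := by rw [← Real.exp_nat_mul]; ring

/-! ### Tails of the distribution of the heavy block sum -/

/-- A sequence which decays geometrically beyond `x` has small mass beyond `x + t`. -/
theorem sum_tail_le_of_decay {w : ℕ → ℝ} (hw : ∀ a, 0 ≤ w a) {η x t : ℝ} {R : ℕ} (hη : 0 ≤ η)
    (hη1 : η ≤ 1) (ht : 0 ≤ t) (hx : 0 ≤ x)
    (h : ∀ a < R, x ≤ a → w (a + 1) ≤ (1 - η) * w a) :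
    ∑ a ∈ Finset.range (R + 1) with x + t ≤ (a : ℕ), w a
      ≤ (R + 1) * Real.exp (1 - η * t) * ∑ a ∈ Finset.range (R + 1), w a := by
  have step : ∀ m : ℕ, ⌈x⌉₊ + m ≤ R → w (⌈x⌉₊ + m) ≤ Real.exp (-(η * m)) * w ⌈x⌉₊ := by
    intro m
    induction m with
    | zero => intro _; simp
    | succ m ih =>
      intro hm
      have h1 := h (⌈x⌉₊ + m) (by omega) (by
        push_cast; have := Nat.le_ceil x; have : (0 : ℝ) ≤ m := Nat.cast_nonneg _; linarith)
      have h2 : 1 - η ≤ Real.exp (-η) := Real.one_sub_le_exp_neg η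
      calc w (⌈x⌉₊ + (m + 1)) ≤ (1 - η) * w (⌈x⌉₊ + m) := h1
        _ ≤ Real.exp (-η) * (Real.exp (-(η * m)) * w ⌈x⌉₊) := by
          gcongr
          · exact hw _
          · exact ih (by omega)
        _ = _ := by rw [← mul_assoc, ← Real.exp_add]; congr 2; push_cast; ring
  have each : ∀ a ∈ (Finset.range (R + 1)).filter (fun a : ℕ => x + t ≤ a),
      w a ≤ Real.exp (1 - η * t) * ∑ a ∈ Finset.range (R + 1), w a := by
    intro a ha
    rw [Finset.mem_filter, Finset.mem_range] at ha
    have hle : ⌈x⌉₊ ≤ a := Nat.ceil_le.2 (by linarith)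
    have h1 := step (a - ⌈x⌉₊) (by omega)
    rw [Nat.add_sub_cancel' hle, Nat.cast_sub hle] at h1
    refine h1.trans ?_
    have hc := Nat.ceil_lt_add_one hx
    -- The 1 in the exponent pays for rounding `x` up, since `η ≤ 1`.
    refine mul_le_mul (Real.exp_le_exp.2 (by nlinarith)) ?_ (hw _) (Real.exp_pos _).le
    exact Finset.single_le_sum (f := w) (fun _ _ => hw _) (Finset.mem_range.2 (by omega))
  refine (Finset.sum_le_card_nsmul _ _ _ each).trans ?_
  rw [nsmul_eq_mul, mul_assoc]
  have : 0 ≤ ∑ a ∈ Finset.range (R + 1), w a := Finset.sum_nonneg fun _ _ => hw _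
  gcongr
  have := Finset.card_filter_le (Finset.range (R + 1)) (fun a : ℕ => x + t ≤ a)
  rw [Finset.card_range] at this
  exact_mod_cast this

/-- A sequence which grows geometrically up to `x` has small mass below `x - t`. -/
theorem sum_tail_le_of_growth {w : ℕ → ℝ} (hw : ∀ a, 0 ≤ w a) {η x t : ℝ} {R : ℕ} (hη : 0 ≤ η)
    (hη1 : η ≤ 1) (hx : 0 ≤ x) (hxR : x ≤ R) (ht : 0 ≤ t)
    (h : ∀ a < R, (a : ℝ) + 1 ≤ x → w a ≤ (1 - η) * w (a + 1)) :
    ∑ a ∈ Finset.range (R + 1) with (a : ℕ) ≤ x - t, w a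
      ≤ (R + 1) * Real.exp (1 - η * t) * ∑ a ∈ Finset.range (R + 1), w a := by
  have hfR : ⌊x⌋₊ ≤ R := by
    have := Nat.floor_le hx
    exact_mod_cast this.trans hxR
  have step : ∀ m : ℕ, m ≤ ⌊x⌋₊ → w (⌊x⌋₊ - m) ≤ Real.exp (-(η * m)) * w ⌊x⌋₊ := by
    intro m
    induction m with
    | zero => intro _; simp
    | succ m ih =>
      intro hm
      have e : ⌊x⌋₊ - (m + 1) + 1 = ⌊x⌋₊ - m := by omega
      have h1 := h (⌊x⌋₊ - (m + 1)) (by omega) (by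
        have : ((⌊x⌋₊ - (m + 1) + 1 : ℕ) : ℝ) ≤ ⌊x⌋₊ := by exact_mod_cast (by omega)
        push_cast at this
        exact this.trans (Nat.floor_le hx))
      rw [e] at h1
      have h2 : 1 - η ≤ Real.exp (-η) := Real.one_sub_le_exp_neg η
      calc w (⌊x⌋₊ - (m + 1)) ≤ (1 - η) * w (⌊x⌋₊ - m) := h1
        _ ≤ Real.exp (-η) * (Real.exp (-(η * m)) * w ⌊x⌋₊) := by
          gcongr
          · exact hw _
          · exact ih (by omega)
        _ = _ := by rw [← mul_assoc, ← Real.exp_add]; congr 2; push_cast; ring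
  have each : ∀ a ∈ (Finset.range (R + 1)).filter (fun a : ℕ => (a : ℝ) ≤ x - t),
      w a ≤ Real.exp (1 - η * t) * ∑ a ∈ Finset.range (R + 1), w a := by
    intro a ha
    rw [Finset.mem_filter, Finset.mem_range] at ha
    have hle : a ≤ ⌊x⌋₊ := Nat.le_floor (by linarith)
    have h1 := step (⌊x⌋₊ - a) (by omega)
    rw [Nat.sub_sub_self hle, Nat.cast_sub hle] at h1
    refine h1.trans ?_
    have hc := Nat.lt_floor_add_one x
    refine mul_le_mul (Real.exp_le_exp.2 (by nlinarith)) ?_ (hw _) (Real.exp_pos _).le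
    exact Finset.single_le_sum (f := w) (fun _ _ => hw _) (Finset.mem_range.2 (by omega))
  refine (Finset.sum_le_card_nsmul _ _ _ each).trans ?_
  rw [nsmul_eq_mul, mul_assoc]
  have : 0 ≤ ∑ a ∈ Finset.range (R + 1), w a := Finset.sum_nonneg fun _ _ => hw _
  gcongr
  have := Finset.card_filter_le (Finset.range (R + 1)) (fun a : ℕ => (a : ℝ) ≤ x - t)
  rw [Finset.card_range] at this
  exact_mod_cast this

/-- The ratio of consecutive values of `stratumCard`. -/
theorem stratumCard_succ {k n p q a : ℕ} (hk : 0 < k) (hn : 0 < n) (ha : a < k * p)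
    (hpq : k * p ≤ n * q) :
    (stratumCard k n p q (a + 1) : ℝ) = ((a + k * k) / (a + 1))
      * ((k * p - a) / (k * p - a + k * n - 1)) ^ 2
      * ((n * q - (k * p - a) + n * n) / (n * q - (k * p - a) + 1)) * stratumCard k n p q a := by
  -- The variables `b` and `d` remove all truncated subtractions from `stratumCard` at `a` and at `a
  -- + 1`.
  obtain ⟨b, hb⟩ : ∃ b, k * p = a + 1 + b := ⟨k * p - (a + 1), by omega⟩
  obtain ⟨d, hd⟩ : ∃ d, n * q = b + 1 + d := ⟨n * q - (b + 1), by omega⟩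
  have e1 : k * p - a = b + 1 := by omega
  have e2 : k * p - (a + 1) = b := by omega
  have e3 : n * q - (b + 1) = d := by omega
  have e4 : n * q - b = d + 1 := by omega
  have hbR : (k * p : ℝ) = a + 1 + b := by exact_mod_cast hb
  have hdR : (n * q : ℝ) = b + 1 + d := by exact_mod_cast hd
  unfold stratumCard
  rw [e1, e2, e3, e4, hbR, hdR]
  have m1 : ((a : ℝ) + 1) * (k * k).multichoose (a + 1) = (k * k + a) * (k * k).multichoose a := by
    exact_mod_cast succ_mul_multichoose_succ (k * k) a
  have m2 : ((b : ℝ) + 1) * (k * n).multichoose (b + 1) = (k * n + b) * (k * n).multichoose b := by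
    exact_mod_cast succ_mul_multichoose_succ (k * n) b
  have m3 : ((d : ℝ) + 1) * (n * n).multichoose (d + 1) = (n * n + d) * (n * n).multichoose d := by
    exact_mod_cast succ_mul_multichoose_succ (n * n) d
  have hk' : (0 : ℝ) < k := by exact_mod_cast hk
  have hn' : (0 : ℝ) < n := by exact_mod_cast hn
  have ha0 : (0 : ℝ) ≤ a := Nat.cast_nonneg _
  have hb0 : (0 : ℝ) ≤ b := Nat.cast_nonneg _
  have hd0 : (0 : ℝ) ≤ d := Nat.cast_nonneg _
  have f1 : ((k * k).multichoose (a + 1) : ℝ) = (a + k * k) / (a + 1) * (k * k).multichoose a := by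
    rw [div_mul_eq_mul_div, eq_div_iff (by positivity)]; linarith
  have f2 : ((k * n).multichoose b : ℝ) = (b + 1) / (b + k * n) * (k * n).multichoose (b + 1) := by
    rw [div_mul_eq_mul_div, eq_div_iff (by positivity)]; linarith
  have f3 : ((n * n).multichoose (d + 1) : ℝ) = (d + n * n) / (d + 1) * (n * n).multichoose d := by
    rw [div_mul_eq_mul_div, eq_div_iff (by positivity)]; linarith
  push_cast
  rw [f1, f2, f3]
  have g1 : (a : ℝ) + 1 + b - a = b + 1 := by ring
  have g2 : (b : ℝ) + 1 + k * n - 1 = b + k * n := by ring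
  have g3 : (b : ℝ) + 1 + d - (b + 1) = d := by ring
  rw [g1, g2, g3]
  ring

/-! ### Averages over tables and their comparison with strata -/

section
variable {U V : Type*} [Fintype U] [Fintype V] [DecidableEq U] [DecidableEq V]

/-- The average of `f` over the tables with margins `p` on `U` and `q` on `V`. -/
noncomputable def tabAvg (p q : ℕ) (f : (U ⊕ V → U ⊕ V → ℕ) → ℝ) : ℝ :=
  (∑ A ∈ blockTabs U V p q, f A) / (blockTabs U V p q).card

theorem card_blockTabs_pos (p q : ℕ) : (0 : ℝ) < (blockTabs U V p q).card := by
  exact_mod_cast (blockTabs_nonempty p q).card_pos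

theorem tabAvg_mono {p q : ℕ} {f g : (U ⊕ V → U ⊕ V → ℕ) → ℝ}
    (h : ∀ A ∈ blockTabs U V p q, f A ≤ g A) : tabAvg p q f ≤ tabAvg p q g :=
  div_le_div_of_nonneg_right (Finset.sum_le_sum h) (Nat.cast_nonneg _)

theorem tabAvg_congr {p q : ℕ} {f g : (U ⊕ V → U ⊕ V → ℕ) → ℝ}
    (h : ∀ A ∈ blockTabs U V p q, f A = g A) : tabAvg p q f = tabAvg p q g := by
  rw [tabAvg, tabAvg, Finset.sum_congr rfl h]

theorem tabAvg_add (p q : ℕ) (f g : (U ⊕ V → U ⊕ V → ℕ) → ℝ) :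
    tabAvg p q (fun A => f A + g A) = tabAvg p q f + tabAvg p q g := by
  simp only [tabAvg, Finset.sum_add_distrib, add_div]

theorem tabAvg_sub (p q : ℕ) (f g : (U ⊕ V → U ⊕ V → ℕ) → ℝ) :
    tabAvg p q (fun A => f A - g A) = tabAvg p q f - tabAvg p q g := by
  simp only [tabAvg, Finset.sum_sub_distrib, sub_div]

theorem tabAvg_const_mul (p q : ℕ) (c : ℝ) (f : (U ⊕ V → U ⊕ V → ℕ) → ℝ) :
    tabAvg p q (fun A => c * f A) = c * tabAvg p q f := by
  simp only [tabAvg, ← Finset.mul_sum, mul_div_assoc]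

theorem tabAvg_const (p q : ℕ) (c : ℝ) :
    tabAvg p q (fun _ : U ⊕ V → U ⊕ V → ℕ => c) = c := by
  have := card_blockTabs_pos (U := U) (V := V) p q
  rw [tabAvg, Finset.sum_const, nsmul_eq_mul]
  field_simp

theorem tabAvg_finset_sum {ι : Type*} (S : Finset ι) (p q : ℕ)
    (f : ι → (U ⊕ V → U ⊕ V → ℕ) → ℝ) :
    tabAvg p q (fun A => ∑ i ∈ S, f i A) = ∑ i ∈ S, tabAvg p q (f i) := by
  simp only [tabAvg]
  rw [Finset.sum_comm, Finset.sum_div]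

/-- An upper bound for the number of pairs of margins with prescribed block totals. -/
def marginCount (k n p q : ℕ) : ℝ := ((k * p + n * q + 1 : ℕ) : ℝ) ^ (2 * (k + n))

theorem marginCount_nonneg (k n p q : ℕ) : 0 ≤ marginCount k n p q := by
  unfold marginCount; positivity

/-- Averages over tables are controlled by averages over the tables with given block totals. -/
theorem tabAvg_le_of_strata {p q : ℕ} (hpq : Fintype.card U * p ≤ Fintype.card V * q)
    {f : (U ⊕ V → U ⊕ V → ℕ) → ℝ} (hf : ∀ A, 0 ≤ f A) {c : ℝ} (hc : 0 ≤ c)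
    (h : ∑ a ∈ Finset.range (Fintype.card U * p + 1), ∑ x ∈ stratum U V p q a, f (glue x)
      ≤ c * ∑ a ∈ Finset.range (Fintype.card U * p + 1),
          (stratumCard (Fintype.card U) (Fintype.card V) p q a : ℝ)) :
    tabAvg p q f ≤ marginCount (Fintype.card U) (Fintype.card V) p q * c := by
  have h1 := (sum_blockTabs_le p q f hf).trans h
  have h2 : ∑ a ∈ Finset.range (Fintype.card U * p + 1),
      (stratumCard (Fintype.card U) (Fintype.card V) p q a : ℝ)
      ≤ marginCount (Fintype.card U) (Fintype.card V) p q * (blockTabs U V p q).card := by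
    have := sum_card_stratum_le (U := U) (V := V) p q hpq
    simp only [card_stratum] at this
    unfold marginCount
    exact_mod_cast this
  rw [tabAvg, div_le_iff₀ (card_blockTabs_pos p q)]
  calc _ ≤ _ := h1
    _ ≤ c * (marginCount (Fintype.card U) (Fintype.card V) p q * (blockTabs U V p q).card) := by
      gcongr
    _ = _ := by ring

theorem heavySum_glue {p q a : ℕ} {x : Blocks U V} (hx : x ∈ stratum U V p q a) :
    heavySum (glue x) = a := by
  simp only [stratum, Finset.mem_product, mem_compositions] at hx
  exact hx.1

/-- The frequency of an event concerning only the sum of the first block. -/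
theorem tabAvg_heavySum_indicator_le {p q : ℕ}
    (hpq : Fintype.card U * p ≤ Fintype.card V * q) (P : ℕ → Prop) [DecidablePred P] {c : ℝ}
    (hc : 0 ≤ c)
    (h : ∑ a ∈ Finset.range (Fintype.card U * p + 1) with P a,
        (stratumCard (Fintype.card U) (Fintype.card V) p q a : ℝ)
      ≤ c * ∑ a ∈ Finset.range (Fintype.card U * p + 1),
          (stratumCard (Fintype.card U) (Fintype.card V) p q a : ℝ)) :
    tabAvg p q (fun A : U ⊕ V → U ⊕ V → ℕ => if P (heavySum A) then (1 : ℝ) else 0)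
      ≤ marginCount (Fintype.card U) (Fintype.card V) p q * c := by
  refine tabAvg_le_of_strata hpq (fun A => by split_ifs <;> simp) hc (le_trans (le_of_eq ?_) h)
  rw [Finset.sum_filter]
  refine Finset.sum_congr rfl fun a _ => ?_
  rw [Finset.sum_congr rfl fun x hx => by rw [heavySum_glue hx], Finset.sum_const, card_stratum]
  split_ifs <;> simp

theorem heavySum_le {p q : ℕ} {A : U ⊕ V → U ⊕ V → ℕ} (hA : A ∈ blockTabs U V p q) :
    (heavySum A : ℝ) ≤ Fintype.card U * p := by
  exact_mod_cast (unglue_mem_stratum hA).2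

/-- The frequency with which the first block sum is at least `x + t`. -/
theorem tabAvg_heavySum_upper_tail {p q : ℕ} (hpq : Fintype.card U * p ≤ Fintype.card V * q)
    {η x t : ℝ} (hη : 0 ≤ η) (hη1 : η ≤ 1) (ht : 0 ≤ t) (hx : 0 ≤ x)
    (h : ∀ a < Fintype.card U * p, x ≤ a →
      (stratumCard (Fintype.card U) (Fintype.card V) p q (a + 1) : ℝ)
        ≤ (1 - η) * stratumCard (Fintype.card U) (Fintype.card V) p q a) :
    tabAvg p q (fun A : U ⊕ V → U ⊕ V → ℕ => if x + t ≤ heavySum A then (1 : ℝ) else 0)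
      ≤ marginCount (Fintype.card U) (Fintype.card V) p q
        * ((Fintype.card U * p + 1) * Real.exp (1 - η * t)) := by
  refine tabAvg_heavySum_indicator_le hpq (fun a : ℕ => x + t ≤ a) (by positivity) ?_
  have := sum_tail_le_of_decay
    (w := fun a => (stratumCard (Fintype.card U) (Fintype.card V) p q a : ℝ))
    (fun _ => Nat.cast_nonneg _) hη hη1 ht hx h
  exact_mod_cast this

/-- The block sum never exceeds `card U * p`, so beyond `x + t` this crude bound is paid only with
the tail probability. -/
theorem tabAvg_heavySum_le {p q : ℕ} (hpq : Fintype.card U * p ≤ Fintype.card V * q)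
    {η x t : ℝ} (hη : 0 ≤ η) (hη1 : η ≤ 1) (ht : 0 ≤ t) (hx : 0 ≤ x)
    (h : ∀ a < Fintype.card U * p, x ≤ a →
      (stratumCard (Fintype.card U) (Fintype.card V) p q (a + 1) : ℝ)
        ≤ (1 - η) * stratumCard (Fintype.card U) (Fintype.card V) p q a) :
    tabAvg p q (fun A : U ⊕ V → U ⊕ V → ℕ => (heavySum A : ℝ))
      ≤ x + t + Fintype.card U * p * (marginCount (Fintype.card U) (Fintype.card V) p q
        * ((Fintype.card U * p + 1) * Real.exp (1 - η * t))) := by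
  have h1 := tabAvg_heavySum_upper_tail hpq hη hη1 ht hx h
  calc tabAvg p q (fun A : U ⊕ V → U ⊕ V → ℕ => (heavySum A : ℝ))
      ≤ tabAvg p q (fun A : U ⊕ V → U ⊕ V → ℕ => (x + t) + (Fintype.card U * p : ℝ)
          * (if x + t ≤ heavySum A then (1 : ℝ) else 0)) := by
        refine tabAvg_mono fun A hA => ?_
        split_ifs with hc
        · have := heavySum_le hA; linarith
        · linarith
    _ ≤ _ := by
        rw [tabAvg_add, tabAvg_const, tabAvg_const_mul]
        gcongr

/-- Below `x - t` the block sum is bounded by 0, and the deficit, at most `x ≤ card U * p`, is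
weighted with the tail probability. -/
theorem le_tabAvg_heavySum {p q : ℕ} (hpq : Fintype.card U * p ≤ Fintype.card V * q)
    {η x t : ℝ} (hη : 0 ≤ η) (hη1 : η ≤ 1) (ht : 0 ≤ t) (hx : 0 ≤ x)
    (hxp : x ≤ Fintype.card U * p)
    (h : ∀ a < Fintype.card U * p, (a : ℝ) + 1 ≤ x →
      (stratumCard (Fintype.card U) (Fintype.card V) p q a : ℝ)
        ≤ (1 - η) * stratumCard (Fintype.card U) (Fintype.card V) p q (a + 1)) :
    x - t - Fintype.card U * p * (marginCount (Fintype.card U) (Fintype.card V) p q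
        * ((Fintype.card U * p + 1) * Real.exp (1 - η * t)))
      ≤ tabAvg p q (fun A : U ⊕ V → U ⊕ V → ℕ => (heavySum A : ℝ)) := by
  have h1 : tabAvg p q (fun A : U ⊕ V → U ⊕ V → ℕ => if heavySum A ≤ x - t then (1 : ℝ) else 0)
      ≤ marginCount (Fintype.card U) (Fintype.card V) p q
        * ((Fintype.card U * p + 1) * Real.exp (1 - η * t)) := by
    refine tabAvg_heavySum_indicator_le hpq (fun a : ℕ => (a : ℝ) ≤ x - t) (by positivity) ?_
    have := sum_tail_le_of_growth
      (w := fun a => (stratumCard (Fintype.card U) (Fintype.card V) p q a : ℝ))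
      (fun _ => Nat.cast_nonneg _) hη hη1 hx (R := Fintype.card U * p) (by exact_mod_cast hxp) ht h
    exact_mod_cast this
  calc _ ≤ (x - t) - (Fintype.card U * p : ℝ)
          * tabAvg p q (fun A : U ⊕ V → U ⊕ V → ℕ => if heavySum A ≤ x - t then (1 : ℝ) else 0) := by
        gcongr
    _ = tabAvg p q (fun A : U ⊕ V → U ⊕ V → ℕ => (x - t) - (Fintype.card U * p : ℝ)
          * (if heavySum A ≤ x - t then (1 : ℝ) else 0)) := by
        rw [tabAvg_sub, tabAvg_const, tabAvg_const_mul]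
    _ ≤ _ := by
        refine tabAvg_mono fun A hA => ?_
        have : (0 : ℝ) ≤ heavySum A := Nat.cast_nonneg _
        split_ifs with hc <;> linarith

/-- The total excess over `M` of the entries in the `U × V` block. -/
def sideExcess (M : ℕ) (A : U ⊕ V → U ⊕ V → ℕ) : ℕ := ∑ x : U × V, ((unglue A).2.1 x - M)

/-- The total excess over `M` of the entries in the `U × U` block. -/
def heavyExcess (M : ℕ) (A : U ⊕ V → U ⊕ V → ℕ) : ℕ := ∑ x : U × U, ((unglue A).1 x - M)

theorem heavySum_add_sideSum {p q : ℕ} {A : U ⊕ V → U ⊕ V → ℕ} (hA : A ∈ blockTabs U V p q) :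
    heavySum A + ∑ x : U × V, (unglue A).2.1 x = Fintype.card U * p := by
  obtain ⟨h1, h2⟩ := unglue_mem_stratum hA
  simp only [stratum, Finset.mem_product, mem_compositions] at h1
  omega

theorem sideExcess_le {p q M : ℕ} {A : U ⊕ V → U ⊕ V → ℕ} (hA : A ∈ blockTabs U V p q) :
    (sideExcess M A : ℝ) ≤ Fintype.card U * p := by
  have h1 := heavySum_add_sideSum hA
  have h2 : sideExcess M A ≤ ∑ x : U × V, (unglue A).2.1 x :=
    Finset.sum_le_sum fun _ _ => Nat.sub_le _ _
  exact_mod_cast (by omega : sideExcess M A ≤ Fintype.card U * p)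

theorem heavyExcess_le {p q M : ℕ} {A : U ⊕ V → U ⊕ V → ℕ} (hA : A ∈ blockTabs U V p q) :
    (heavyExcess M A : ℝ) ≤ Fintype.card U * p := by
  have h1 := heavySum_add_sideSum hA
  have h2 : heavyExcess M A ≤ heavySum A := Finset.sum_le_sum fun _ _ => Nat.sub_le _ _
  exact_mod_cast (by omega : heavyExcess M A ≤ Fintype.card U * p)

/-- The exponential moment bound for the excess in a block of `m` entries with sum `s`. -/
noncomputable def excessBound (K : ℝ) (M m s : ℕ) : ℝ :=
  ((s : ℝ) + m + 1) ^ 2 * Real.exp (m * (2 * (1 + K) * (K / (1 + K)) ^ M))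

theorem excessBound_mono {K : ℝ} {M m s s' : ℕ} (h : s ≤ s') :
    excessBound K M m s ≤ excessBound K M m s' := by
  unfold excessBound
  gcongr

theorem excessBound_nonneg (K : ℝ) (M m s : ℕ) : 0 ≤ excessBound K M m s := by
  unfold excessBound; positivity

/-- Within a stratum the side block is an independent uniform composition of `card U * p - a`. Its
mean entry is at most p / `card V` ≤ `K` whatever `a` is, so no truncation in `a` is needed. -/
theorem tabAvg_pow_sideExcess_le {p q : ℕ} (hpq : Fintype.card U * p ≤ Fintype.card V * q)
    (hU : 0 < Fintype.card U) (hV : 0 < Fintype.card V) {K : ℝ} (hK : 0 < K)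
    (hp : (p : ℝ) ≤ K * Fintype.card V) (M : ℕ) :
    tabAvg p q (fun A : U ⊕ V → U ⊕ V → ℕ => (1 + 1 / (2 * K)) ^ sideExcess M A)
      ≤ marginCount (Fintype.card U) (Fintype.card V) p q
        * excessBound K M (Fintype.card U * Fintype.card V) (Fintype.card U * p) := by
  refine tabAvg_le_of_strata hpq (fun A => by positivity) (excessBound_nonneg _ _ _ _) ?_
  rw [Finset.mul_sum]
  refine Finset.sum_le_sum fun a _ => ?_
  have hU' : (0 : ℝ) ≤ Fintype.card U := Nat.cast_nonneg _
  have key := sum_compositions_pow_le (σ := U × V) hK (Fintype.card U * p - a) M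
    (by rw [Fintype.card_prod]; positivity) (by
      rw [Fintype.card_prod]
      have : ((Fintype.card U * p - a : ℕ) : ℝ) ≤ Fintype.card U * p := by
        exact_mod_cast Nat.sub_le _ _
      push_cast
      nlinarith)
  calc ∑ x ∈ stratum U V p q a, (1 + 1 / (2 * K)) ^ sideExcess M (glue x)
      = (compositions (U × U) a).card * ((∑ y ∈ compositions (U × V) (Fintype.card U * p - a),
          (1 + 1 / (2 * K)) ^ (∑ i, (y i - M)))
          * ((compositions (V × U) (Fintype.card U * p - a)).card
          * (compositions (V × V) (Fintype.card V * q - (Fintype.card U * p - a))).card)) := by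
        simp only [stratum, Finset.sum_product, sideExcess, unglue_glue, Finset.sum_const,
          nsmul_eq_mul]
        rw [Finset.sum_mul]
        congr 1
        refine Finset.sum_congr rfl fun y _ => ?_
        simp only [Finset.card_product, Nat.cast_mul]
        ring
    _ ≤ (compositions (U × U) a).card
          * ((excessBound K M (Fintype.card U * Fintype.card V) (Fintype.card U * p)
            * (Fintype.card (U × V)).multichoose (Fintype.card U * p - a))
          * ((compositions (V × U) (Fintype.card U * p - a)).card
          * (compositions (V × V) (Fintype.card V * q - (Fintype.card U * p - a))).card)) := by
        gcongr
        refine key.trans ?_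
        have h2 := excessBound_mono (K := K) (M := M) (m := Fintype.card U * Fintype.card V)
          (Nat.sub_le (Fintype.card U * p) a)
        unfold excessBound at h2 ⊢
        rw [Fintype.card_prod]
        gcongr ?_ * _
    _ = _ := by
        simp only [card_compositions, Fintype.card_prod, stratumCard,
          mul_comm (Fintype.card V) (Fintype.card U)]
        push_cast
        ring

/-- The mean heavy entry is not bounded a priori, so the moment is restricted to block sums below
`z`, where that mean is less than `K`. -/
theorem tabAvg_pow_heavyExcess_le {p q : ℕ} (hpq : Fintype.card U * p ≤ Fintype.card V * q)
    (hU : 0 < Fintype.card U) {K z : ℝ} (hK : 0 < K)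
    (hz : z ≤ K * (Fintype.card U * Fintype.card U)) (M : ℕ) :
    tabAvg p q (fun A : U ⊕ V → U ⊕ V → ℕ =>
        if (heavySum A : ℝ) < z then (1 + 1 / (2 * K)) ^ heavyExcess M A else 0)
      ≤ marginCount (Fintype.card U) (Fintype.card V) p q
        * excessBound K M (Fintype.card U * Fintype.card U) (Fintype.card U * p) := by
  refine tabAvg_le_of_strata hpq (fun A => by split_ifs <;> positivity)
    (excessBound_nonneg _ _ _ _) ?_
  rw [Finset.mul_sum]
  refine Finset.sum_le_sum fun a ha => ?_
  have ha : a ≤ Fintype.card U * p := Nat.lt_succ_iff.1 (Finset.mem_range.1 ha)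
  rw [Finset.sum_congr rfl fun x hx => by rw [heavySum_glue hx]]
  split_ifs with haz
  swap
  · rw [Finset.sum_const_zero]
    exact mul_nonneg (excessBound_nonneg _ _ _ _) (Nat.cast_nonneg _)
  have key := sum_compositions_pow_le (σ := U × U) hK a M
    (by rw [Fintype.card_prod]; positivity) (by
      rw [Fintype.card_prod]; push_cast; linarith)
  calc ∑ x ∈ stratum U V p q a, (1 + 1 / (2 * K)) ^ heavyExcess M (glue x)
      = (∑ y ∈ compositions (U × U) a, (1 + 1 / (2 * K)) ^ (∑ i, (y i - M)))
          * ((compositions (U × V) (Fintype.card U * p - a)).card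
          * ((compositions (V × U) (Fintype.card U * p - a)).card
          * (compositions (V × V) (Fintype.card V * q - (Fintype.card U * p - a))).card)) := by
        simp only [stratum, Finset.sum_product, heavyExcess, unglue_glue, Finset.sum_const,
          nsmul_eq_mul]
        rw [Finset.sum_mul]
        refine Finset.sum_congr rfl fun y _ => ?_
        simp only [Finset.card_product, Nat.cast_mul]
        ring
    _ ≤ (excessBound K M (Fintype.card U * Fintype.card U) (Fintype.card U * p)
            * (Fintype.card (U × U)).multichoose a)
          * ((compositions (U × V) (Fintype.card U * p - a)).card
          * ((compositions (V × U) (Fintype.card U * p - a)).card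
          * (compositions (V × V) (Fintype.card V * q - (Fintype.card U * p - a))).card)) := by
        gcongr
        refine key.trans ?_
        have h2 := excessBound_mono (K := K) (M := M) (m := Fintype.card U * Fintype.card U) ha
        unfold excessBound at h2 ⊢
        rw [Fintype.card_prod]
        gcongr ?_ * _
    _ = _ := by
        simp only [card_compositions, Fintype.card_prod, stratumCard,
          mul_comm (Fintype.card V) (Fintype.card U)]
        push_cast
        ring

theorem one_le_pow_mul_rpow_neg {x t : ℝ} (hx : 1 ≤ x) {S : ℕ} (h : t ≤ S) :
    1 ≤ x ^ S * x ^ (-t) := by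
  rw [← Real.rpow_natCast, ← Real.rpow_add (by linarith)]
  exact Real.one_le_rpow hx (by linarith)

/-- Markov's inequality for the exponential moment: beyond `t`, the crude bound `card U * p` is
multiplied by x^(excess - t) ≥ 1. -/
theorem tabAvg_sideExcess_le {p q : ℕ} (hpq : Fintype.card U * p ≤ Fintype.card V * q)
    (hU : 0 < Fintype.card U) (hV : 0 < Fintype.card V) {K : ℝ} (hK : 0 < K)
    (hp : (p : ℝ) ≤ K * Fintype.card V) (M : ℕ) {t : ℝ} (ht : 0 ≤ t) :
    tabAvg p q (fun A : U ⊕ V → U ⊕ V → ℕ => (sideExcess M A : ℝ))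
      ≤ t + Fintype.card U * p * (marginCount (Fintype.card U) (Fintype.card V) p q
        * (excessBound K M (Fintype.card U * Fintype.card V) (Fintype.card U * p)
          * (1 + 1 / (2 * K)) ^ (-t))) := by
  have h1 := tabAvg_pow_sideExcess_le (U := U) (V := V) hpq hU hV hK hp M
  have hx : 1 ≤ 1 + 1 / (2 * K) := by
    have : 0 < 1 / (2 * K) := by positivity
    linarith
  set x := 1 + 1 / (2 * K)
  calc tabAvg p q (fun A : U ⊕ V → U ⊕ V → ℕ => (sideExcess M A : ℝ))
      ≤ tabAvg p q (fun A : U ⊕ V → U ⊕ V → ℕ => t + (Fintype.card U * p * x ^ (-t))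
          * x ^ sideExcess M A) := by
        refine tabAvg_mono fun A hA => ?_
        rcases le_total (sideExcess M A : ℝ) t with h | h
        · have : 0 ≤ (Fintype.card U * p * x ^ (-t)) * x ^ sideExcess M A := by positivity
          linarith
        · have h2 := one_le_pow_mul_rpow_neg hx h
          have h3 := sideExcess_le (M := M) hA
          have : (Fintype.card U * p : ℝ) * 1
              ≤ Fintype.card U * p * (x ^ sideExcess M A * x ^ (-t)) := by gcongr
          linarith
    _ ≤ t + (Fintype.card U * p * x ^ (-t))
          * (marginCount (Fintype.card U) (Fintype.card V) p q
          * excessBound K M (Fintype.card U * Fintype.card V) (Fintype.card U * p)) := by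
        rw [tabAvg_add, tabAvg_const, tabAvg_const_mul]
        gcongr
    _ = _ := by ring

/-- The same argument, with the event of a block sum at least `z` split off and bounded crudely. -/
theorem tabAvg_heavyExcess_le {p q : ℕ} (hpq : Fintype.card U * p ≤ Fintype.card V * q)
    (hU : 0 < Fintype.card U) {K z : ℝ} (hK : 0 < K)
    (hz : z ≤ K * (Fintype.card U * Fintype.card U)) (M : ℕ) {t : ℝ} (ht : 0 ≤ t) :
    tabAvg p q (fun A : U ⊕ V → U ⊕ V → ℕ => (heavyExcess M A : ℝ))
      ≤ t + Fintype.card U * p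
          * tabAvg p q (fun A : U ⊕ V → U ⊕ V → ℕ => if z ≤ heavySum A then (1 : ℝ) else 0)
        + Fintype.card U * p * (marginCount (Fintype.card U) (Fintype.card V) p q
        * (excessBound K M (Fintype.card U * Fintype.card U) (Fintype.card U * p)
          * (1 + 1 / (2 * K)) ^ (-t))) := by
  have h1 := tabAvg_pow_heavyExcess_le (U := U) (V := V) hpq hU hK hz M
  have hx : 1 ≤ 1 + 1 / (2 * K) := by
    have : 0 < 1 / (2 * K) := by positivity
    linarith
  set x := 1 + 1 / (2 * K)
  calc tabAvg p q (fun A : U ⊕ V → U ⊕ V → ℕ => (heavyExcess M A : ℝ))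
      ≤ tabAvg p q (fun A : U ⊕ V → U ⊕ V → ℕ => (t + Fintype.card U * p
          * (if z ≤ heavySum A then (1 : ℝ) else 0)) + (Fintype.card U * p * x ^ (-t))
          * (if (heavySum A : ℝ) < z then x ^ heavyExcess M A else 0)) := by
        refine tabAvg_mono fun A hA => ?_
        have h3 := heavyExcess_le (M := M) hA
        rcases le_or_gt z (heavySum A : ℝ) with hz | hz
        · rw [if_pos hz, if_neg hz.not_gt]
          linarith
        rw [if_neg hz.not_ge, if_pos hz]
        rcases le_total (heavyExcess M A : ℝ) t with h | h
        · have : 0 ≤ (Fintype.card U * p * x ^ (-t)) * x ^ heavyExcess M A := by positivity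
          linarith
        · have h2 := one_le_pow_mul_rpow_neg hx h
          have : (Fintype.card U * p : ℝ) * 1
              ≤ Fintype.card U * p * (x ^ heavyExcess M A * x ^ (-t)) := by gcongr
          linarith
    _ ≤ t + Fintype.card U * p
          * tabAvg p q (fun A : U ⊕ V → U ⊕ V → ℕ => if z ≤ heavySum A then (1 : ℝ) else 0)
        + (Fintype.card U * p * x ^ (-t))
          * (marginCount (Fintype.card U) (Fintype.card V) p q
          * excessBound K M (Fintype.card U * Fintype.card U) (Fintype.card U * p)) := by
        rw [tabAvg_add, tabAvg_add, tabAvg_const, tabAvg_const_mul, tabAvg_const_mul]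
        gcongr
    _ = _ := by ring

/-! ### Exchangeability -/

/-- Permuting the rows and the columns inside the blocks preserves averages. -/
theorem tabAvg_comp_perm (p q : ℕ) (f : (U ⊕ V → U ⊕ V → ℕ) → ℝ) (σ τ : Equiv.Perm (U ⊕ V))
    (hσ : ∀ i, (σ i).isLeft = i.isLeft) (hτ : ∀ i, (τ i).isLeft = i.isLeft) :
    tabAvg p q (fun A => f fun i j => A (σ i) (τ j)) = tabAvg p q f := by
  unfold tabAvg
  congr 1
  refine Finset.sum_bij' (fun A _ i j => A (σ i) (τ j)) (fun A _ i j => A (σ.symm i) (τ.symm j))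
    ?_ ?_ ?_ ?_ ?_
  · intro A hA
    rw [blockTabs, mem_tables] at hA ⊢
    constructor
    · intro i
      rw [Equiv.sum_comp τ (fun j => A (σ i) j), hA.1]
      simp [blockVec, hσ]
    · intro j
      rw [Equiv.sum_comp σ (fun i => A i (τ j)), hA.2]
      simp [blockVec, hτ]
  · intro A hA
    have hσ' : ∀ i, (σ.symm i).isLeft = i.isLeft := fun i => by
      rw [← hσ, Equiv.apply_symm_apply]
    have hτ' : ∀ i, (τ.symm i).isLeft = i.isLeft := fun i => by
      rw [← hτ, Equiv.apply_symm_apply]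
    rw [blockTabs, mem_tables] at hA ⊢
    constructor
    · intro i
      rw [Equiv.sum_comp τ.symm (fun j => A (σ.symm i) j), hA.1]
      simp [blockVec, hσ']
    · intro j
      rw [Equiv.sum_comp σ.symm (fun i => A i (τ.symm j)), hA.2]
      simp [blockVec, hτ']
  · intros; simp
  · intros; simp
  · intros; rfl

/-- The average of a function of one entry depends only on the block of that entry. -/
theorem tabAvg_entry_eq (p q : ℕ) (φ : ℕ → ℝ) {i i' j j' : U ⊕ V} (hi : i.isLeft = i'.isLeft)
    (hj : j.isLeft = j'.isLeft) :
    tabAvg p q (fun A : U ⊕ V → U ⊕ V → ℕ => φ (A i j)) = tabAvg p q (fun A => φ (A i' j')) := by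
  have hswap : ∀ i i' : U ⊕ V, i.isLeft = i'.isLeft →
      ∀ l, (Equiv.swap i i' l).isLeft = l.isLeft := by
    intro i i' h l
    rw [Equiv.swap_apply_def]
    split_ifs with h1 h2
    · rw [h1, h]
    · rw [h2, h]
    · rfl
  have := tabAvg_comp_perm p q (fun A : U ⊕ V → U ⊕ V → ℕ => φ (A i' j')) (Equiv.swap i i')
    (Equiv.swap j j') (hswap i i' hi) (hswap j j' hj)
  simpa using this

/-- Exchangeability is what allows statements about one entry to be read off from estimates for
block sums. -/
theorem tabAvg_sum_heavy (p q : ℕ) (φ : ℕ → ℝ) (u u' : U) :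
    tabAvg p q (fun A : U ⊕ V → U ⊕ V → ℕ => ∑ x : U × U, φ ((unglue A).1 x))
      = Fintype.card U * Fintype.card U
        * tabAvg p q (fun A : U ⊕ V → U ⊕ V → ℕ => φ (A (.inl u) (.inl u'))) := by
  rw [tabAvg_finset_sum, Finset.sum_congr rfl fun x _ => tabAvg_entry_eq p q φ
    (i := .inl x.1) (i' := .inl u) (j := .inl x.2) (j' := .inl u') rfl rfl,
    Finset.sum_const, Finset.card_univ, Fintype.card_prod, nsmul_eq_mul]
  push_cast
  ring

theorem tabAvg_sum_side (p q : ℕ) (φ : ℕ → ℝ) (u : U) (v : V) :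
    tabAvg p q (fun A : U ⊕ V → U ⊕ V → ℕ => ∑ x : U × V, φ ((unglue A).2.1 x))
      = Fintype.card U * Fintype.card V
        * tabAvg p q (fun A : U ⊕ V → U ⊕ V → ℕ => φ (A (.inl u) (.inr v))) := by
  rw [tabAvg_finset_sum, Finset.sum_congr rfl fun x _ => tabAvg_entry_eq p q φ
    (i := .inl x.1) (i' := .inl u) (j := .inr x.2) (j' := .inr v) rfl rfl,
    Finset.sum_const, Finset.card_univ, Fintype.card_prod, nsmul_eq_mul]
  push_cast
  ring

/-- The mean of a row in the first block. -/
theorem tabAvg_heavy_row (p q : ℕ) (u u' : U) (v : V) :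
    Fintype.card U * tabAvg p q (fun A : U ⊕ V → U ⊕ V → ℕ => (A (.inl u) (.inl u') : ℝ))
      + Fintype.card V * tabAvg p q (fun A : U ⊕ V → U ⊕ V → ℕ => (A (.inl u) (.inr v) : ℝ))
      = p := by
  have h : tabAvg p q (fun A : U ⊕ V → U ⊕ V → ℕ =>
      ∑ x, (A (.inl u) (.inl x) : ℝ) + ∑ y, (A (.inl u) (.inr y) : ℝ)) = p := by
    rw [← tabAvg_const (U := U) (V := V) p q p]
    refine tabAvg_congr fun A hA => ?_
    have := (mem_tables.1 hA).1 (.inl u)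
    rw [Fintype.sum_sum_type] at this
    exact_mod_cast this
  rw [tabAvg_add, tabAvg_finset_sum, tabAvg_finset_sum,
    Finset.sum_congr rfl fun x _ => tabAvg_entry_eq p q (fun m => (m : ℝ))
      (i := .inl u) (i' := .inl u) (j := .inl x) (j' := .inl u') rfl rfl,
    Finset.sum_congr rfl fun x _ => tabAvg_entry_eq p q (fun m => (m : ℝ))
      (i := .inl u) (i' := .inl u) (j := .inr x) (j' := .inr v) rfl rfl] at h
  simpa using h

/-- The mean of a column in the second block. -/
theorem tabAvg_light_column (p q : ℕ) (u : U) (v v' : V) :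
    Fintype.card U * tabAvg p q (fun A : U ⊕ V → U ⊕ V → ℕ => (A (.inl u) (.inr v) : ℝ))
      + Fintype.card V * tabAvg p q (fun A : U ⊕ V → U ⊕ V → ℕ => (A (.inr v') (.inr v) : ℝ))
      = q := by
  have h : tabAvg p q (fun A : U ⊕ V → U ⊕ V → ℕ =>
      ∑ x, (A (.inl x) (.inr v) : ℝ) + ∑ y, (A (.inr y) (.inr v) : ℝ)) = q := by
    rw [← tabAvg_const (U := U) (V := V) p q q]
    refine tabAvg_congr fun A hA => ?_
    have := (mem_tables.1 hA).2 (.inr v)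
    rw [Fintype.sum_sum_type] at this
    exact_mod_cast this
  rw [tabAvg_add, tabAvg_finset_sum, tabAvg_finset_sum,
    Finset.sum_congr rfl fun x _ => tabAvg_entry_eq p q (fun m => (m : ℝ))
      (i := .inl x) (i' := .inl u) (j := .inr v) (j' := .inr v) rfl rfl,
    Finset.sum_congr rfl fun x _ => tabAvg_entry_eq p q (fun m => (m : ℝ))
      (i := .inr x) (i' := .inr v') (j := .inr v) (j' := .inr v) rfl rfl] at h
  simpa using h

end

/-! ### Ratios of consecutive stratum sizes -/

/-- The margins `p`, `q` are, up to rounding, `B C n` and `C n`. -/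
structure LinearMargins (B C : ℝ) (k n p q : ℕ) : Prop where
  k_pos : 0 < k
  n_pos : 0 < n
  p_le : (p : ℝ) ≤ B * C * n
  le_p : B * C * n - 1 ≤ p
  q_le : (q : ℝ) ≤ C * n
  le_q : C * n - 1 ≤ q

/-- The limiting ratio of consecutive stratum sizes is `(1 + 1 / z) * heavyRatio C β`, where `z`
and `β` are the mean entries in the heavy and in the side blocks. -/
noncomputable def heavyRatio (C β : ℝ) : ℝ := (β / (β + 1)) ^ 2 * (1 + 1 / C)

theorem heavyRatio_nonneg {C : ℝ} (hC : 0 < C) (β : ℝ) : 0 ≤ heavyRatio C β := by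
  unfold heavyRatio; positivity

/-- The three factors of `stratumCard_succ` are bounded separately: the heavy block gives 1 + k²/a,
the two side blocks give (β/(β+1))², the light block gives 1 + 1/C. The denominators collect the
errors. -/
theorem stratumCard_succ_le {k n p q a : ℕ} {C β y : ℝ} (hk : 0 < k) (hn : 0 < n)
    (ha : a < k * p) (ha0 : 0 < a) (hpq : k * p ≤ n * q) (hC : 0 < C) (hβ : 0 < β)
    (hb : (k * p - a : ℝ) ≤ β * (k * n)) (hy0 : 0 ≤ y) (hy : y < C)
    (hd : (n : ℝ) * n * (C - y) ≤ n * q - k * p) (hkn : (k / n : ℝ) < 1) :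
    (stratumCard k n p q (a + 1) : ℝ)
      ≤ (1 + k * k / a) * heavyRatio C β / ((1 - k / n) ^ 2 * (1 - y / C))
        * stratumCard k n p q a := by
  rw [stratumCard_succ hk hn ha hpq]
  have hk' : (1 : ℝ) ≤ k := by exact_mod_cast hk
  have hn' : (1 : ℝ) ≤ n := by exact_mod_cast hn
  have ha' : (0 : ℝ) < a := by exact_mod_cast ha0
  have hkn1 : (1 : ℝ) ≤ k * n := by nlinarith
  have hb1 : (1 : ℝ) ≤ k * p - a := by
    have : (a : ℝ) + 1 ≤ k * p := by exact_mod_cast ha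
    linarith
  set b : ℝ := k * p - a with hbdef
  have hd' : (n : ℝ) * n * (C - y) ≤ n * q - b := by linarith
  set d : ℝ := n * q - b with hddef
  have hCy : 0 < C - y := by linarith
  have hd0 : 0 < d := lt_of_lt_of_le (by positivity) hd'
  have hξ : 0 < 1 - (k : ℝ) / n := by linarith
  have f1 : ((a : ℝ) + k * k) / (a + 1) ≤ 1 + k * k / a := by
    have : (1 : ℝ) + k * k / a = (a + k * k) / a := by field_simp
    rw [this]
    gcongr
    linarith
  -- The factor 1 - k/n compensates the -1 in the denominator because (k/n)(kn) = k² ≥ 1.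
  have f2 : b / (b + k * n - 1) ≤ β / (β + 1) / (1 - k / n) := by
    have e : (k : ℝ) / n * (k * n) = k * k := by field_simp
    have hkk : (1 : ℝ) ≤ k * k := by nlinarith
    rw [div_div, div_le_div_iff₀ (by linarith) (by positivity)]
    have h1 : b * (β + 1) * (k * n) * (1 - k / n) ≤ β * (b + k * n - 1) * (k * n) := by
      have h2 : b * (k * n - 1) ≤ β * (k * n) * (k * n - 1) := by
        apply mul_le_mul_of_nonneg_right hb; linarith
      have h3 : b * (β + 1) * (k * n) * (1 - k / n) = b * (β + 1) * (k * n)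
          - b * (β + 1) * (k / n * (k * n)) := by ring
      rw [h3, e]
      have h4 : b * (β + 1) * 1 ≤ b * (β + 1) * (k * k) := by
        apply mul_le_mul_of_nonneg_left hkk; positivity
      nlinarith
    have hpos : (0 : ℝ) < k * n := by linarith
    nlinarith
  have f3 : (d + n * n) / (d + 1) ≤ (1 + 1 / C) / (1 - y / C) := by
    have hy' : 0 < 1 - y / C := by
      rw [sub_pos, div_lt_one hC]; exact hy
    have e : (1 + 1 / C) / (1 - y / C) = (C + 1) / (C - y) := by
      field_simp
    rw [e, div_le_div_iff₀ (by positivity) hCy]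
    have h1 : (d + n * n) * (C - y) ≤ d * (C - y) + d := by linarith
    have h2 : 0 ≤ d * y := by positivity
    linarith
  have hw : (0 : ℝ) ≤ stratumCard k n p q a := Nat.cast_nonneg _
  have p2 : 0 ≤ b / (b + k * n - 1) := div_nonneg (by linarith) (by linarith)
  have p3 : 0 ≤ (d + n * n) / (d + 1) := by positivity
  calc (a + k * k) / (a + 1) * (b / (b + k * n - 1)) ^ 2 * ((d + n * n) / (d + 1))
        * (stratumCard k n p q a : ℝ)
      ≤ (1 + k * k / a) * (β / (β + 1) / (1 - k / n)) ^ 2 * ((1 + 1 / C) / (1 - y / C))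
        * stratumCard k n p q a := by gcongr
    _ = _ := by
      unfold heavyRatio
      field_simp

/-- The heavy factor has two lower bounds. The bound 1 suffices in the supercritical case; the other
one keeps the precise 1 + 1/z needed to locate the subcritical peak. -/
theorem le_stratumCard_succ {k n p q a : ℕ} {C β : ℝ} (hk : 0 < k) (hn : 0 < n)
    (ha : a < k * p) (hpq : k * p ≤ n * q) (hC : 0 < C) (hβ : 0 ≤ β)
    (hb : β * (k * n) ≤ (k * p - a : ℝ)) (hq : (q : ℝ) ≤ C * n) :
    max (1 : ℝ) ((1 + k * k / (a + 1)) * (1 - 1 / (k * k))) * heavyRatio C β * (1 - 1 / (n * n))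
        * stratumCard k n p q a ≤ (stratumCard k n p q (a + 1) : ℝ) := by
  rw [stratumCard_succ hk hn ha hpq]
  have hk' : (1 : ℝ) ≤ k := by exact_mod_cast hk
  have hn' : (1 : ℝ) ≤ n := by exact_mod_cast hn
  have ha' : (0 : ℝ) ≤ a := Nat.cast_nonneg _
  have hkn1 : (1 : ℝ) ≤ k * n := by nlinarith
  have hkk : (1 : ℝ) ≤ k * k := by nlinarith
  have hnn : (1 : ℝ) ≤ n * n := by nlinarith
  have hb1 : (1 : ℝ) ≤ k * p - a := by
    have : (a : ℝ) + 1 ≤ k * p := by exact_mod_cast ha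
    linarith
  set b : ℝ := k * p - a with hbdef
  have hd0 : 0 ≤ (n : ℝ) * q - b := by
    have : (k : ℝ) * p ≤ n * q := by exact_mod_cast hpq
    linarith
  have hd1 : (n : ℝ) * q - b + 1 ≤ C * (n * n) := by nlinarith
  set d : ℝ := n * q - b with hddef
  have f1 : max (1 : ℝ) ((1 + k * k / (a + 1)) * (1 - 1 / (k * k))) ≤ ((a : ℝ) + k * k) / (a + 1) := by
    apply max_le
    · rw [le_div_iff₀ (by positivity)]; linarith
    · have e : ((1 : ℝ) + k * k / (a + 1)) * (1 - 1 / (k * k))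
          = ((a + 1 + k * k) * (k * k - 1) / (k * k)) / (a + 1) := by field_simp
      rw [e]
      gcongr
      rw [div_le_iff₀ (by positivity)]
      nlinarith
  have f2 : β / (β + 1) ≤ b / (b + k * n - 1) := by
    rw [div_le_div_iff₀ (by positivity) (by linarith)]
    nlinarith
  have f3 : (1 + 1 / C) * (1 - 1 / (n * n)) ≤ (d + n * n) / (d + 1) := by
    have e : (d + n * n) / (d + 1) = 1 + (n * n - 1) / (d + 1) := by field_simp; ring
    have e2 : (1 + 1 / C) * (1 - 1 / ((n : ℝ) * n))
        = 1 - 1 / (n * n) + (n * n - 1) / (C * (n * n)) := by field_simp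
    rw [e, e2]
    have h1 : ((n : ℝ) * n - 1) / (C * (n * n)) ≤ (n * n - 1) / (d + 1) := by
      apply div_le_div_of_nonneg_left (by linarith) (by positivity) hd1
    have h2 : 0 ≤ 1 / ((n : ℝ) * n) := by positivity
    linarith
  have hw : (0 : ℝ) ≤ stratumCard k n p q a := Nat.cast_nonneg _
  have p3 : 0 ≤ (1 + 1 / C) * (1 - 1 / ((n : ℝ) * n)) := by
    have : 1 / ((n : ℝ) * n) ≤ 1 := by
      rw [div_le_one (by positivity)]; exact hnn
    exact mul_nonneg (by positivity) (by linarith)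
  calc max (1 : ℝ) ((1 + k * k / (a + 1)) * (1 - 1 / (k * k))) * heavyRatio C β * (1 - 1 / (n * n))
        * (stratumCard k n p q a : ℝ)
      = max (1 : ℝ) ((1 + k * k / (a + 1)) * (1 - 1 / (k * k))) * (β / (β + 1)) ^ 2
        * ((1 + 1 / C) * (1 - 1 / (n * n))) * stratumCard k n p q a := by
        unfold heavyRatio; ring
    _ ≤ _ := by gcongr

section
variable {B C : ℝ} {k n p q : ℕ}

theorem LinearMargins.one_div_le (h : LinearMargins B C k n p q) : 1 / (n : ℝ) ≤ k / n := by
  have : (1 : ℝ) ≤ k := by exact_mod_cast h.k_pos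
  gcongr

/-- The rounding error `n` in `n * q` is absorbed by k n, which is the 1 in `1 + B * C`. -/
theorem LinearMargins.mul_sub_le (h : LinearMargins B C k n p q) :
    (n : ℝ) * n * (C - (1 + B * C) * (k / n)) ≤ n * q - k * p := by
  have hk : (1 : ℝ) ≤ k := by exact_mod_cast h.k_pos
  have hn : (0 : ℝ) < n := by exact_mod_cast h.n_pos
  have e : (n : ℝ) * n * (C - (1 + B * C) * (k / n)) = n * n * C - (1 + B * C) * k * n := by
    field_simp
  rw [e]
  have h1 := h.p_le
  have h2 := h.le_q
  nlinarith

theorem LinearMargins.mul_le_mul (h : LinearMargins B C k n p q)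
    (hξ : (1 + B * C) * (k / n : ℝ) ≤ C) : k * p ≤ n * q := by
  have h1 := h.mul_sub_le
  have : 0 ≤ (n : ℝ) * n * (C - (1 + B * C) * (k / n)) := by
    apply mul_nonneg (by positivity); linarith
  have : (k : ℝ) * p ≤ n * q := by linarith
  exact_mod_cast this

/-- An upper bound for the ratio of consecutive stratum sizes. -/
theorem LinearMargins.stratumCard_succ_le (h : LinearMargins B C k n p q) (hB : 0 < B) (hC : 0 < C)
    {a : ℕ} {β s : ℝ} (hs1 : s ≤ 1 / 2) (hs : (2 + (1 + B * C) / C) * (k / n) ≤ s)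
    (ha : a < k * p) (ha0 : 0 < a) (hβ : 0 < β) (hb : (k * p - a : ℝ) ≤ β * (k * n)) :
    (stratumCard k n p q (a + 1) : ℝ)
      ≤ (1 + k * k / a) * heavyRatio C β / (1 - s) * stratumCard k n p q a := by
  have hk : (1 : ℝ) ≤ k := by exact_mod_cast h.k_pos
  have hn : (0 : ℝ) < n := by exact_mod_cast h.n_pos
  set ξ : ℝ := k / n with hξ
  have hξ0 : 0 < ξ := by positivity
  have hy : (1 + B * C) * ξ / C = (1 + B * C) / C * ξ := by ring
  have hyp : 0 < (1 + B * C) / C * ξ := by positivity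
  have hyC : (1 + B * C) * ξ < C := by
    have : (1 + B * C) / C * ξ < 1 := by nlinarith
    rwa [← hy, div_lt_one hC] at this
  have hpq := h.mul_le_mul hyC.le
  refine (_root_.stratumCard_succ_le h.k_pos h.n_pos ha ha0 hpq hC hβ hb (by positivity) hyC h.mul_sub_le
    (by rw [← hξ]; nlinarith)).trans ?_
  have hw : (0 : ℝ) ≤ stratumCard k n p q a := Nat.cast_nonneg _
  have hr := heavyRatio_nonneg hC β
  rw [← hξ, hy]
  set z := (1 + B * C) / C * ξ with hz
  -- The relative losses add up: 2ξ from the squared side factor and z from the light factor.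
  have hs' : 2 * ξ + z ≤ s := by rw [hz]; linarith
  have h1 : (1 - 2 * ξ) * (1 - z) ≤ (1 - ξ) ^ 2 * (1 - z) := by
    apply mul_le_mul_of_nonneg_right _ (by linarith)
    have := sq_nonneg ξ
    linarith
  have h2 : 0 ≤ ξ * z := by positivity
  gcongr
  · linarith
  · linarith

end

/-! ### The critical ratio; growth and decay of strata around the peak -/

section
variable {B C : ℝ}

theorem criticalB_pos (C : ℝ) : 0 < criticalB C := by
  unfold criticalB; positivity

theorem sq_criticalB_sub_one (hC : 0 < C) : (criticalB C - 1) ^ 2 = 1 + 1 / C := by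
  unfold criticalB
  rw [add_sub_cancel_left, Real.sq_sqrt (by positivity)]

/-- This is the origin of the critical value: (B_c - 1)² = 1 + 1/C means C (B_c² - 2 B_c) = 1, which
is (B_c C + 1)² = B_c² C (C + 1). -/
theorem heavyRatio_criticalB (hC : 0 < C) : heavyRatio C (criticalB C * C) = 1 := by
  have h := sq_criticalB_sub_one hC
  have hb := criticalB_pos C
  have h2 : (criticalB C * C + 1) ^ 2 = (criticalB C * C) ^ 2 * (1 + 1 / C) := by
    have : C * (criticalB C - 1) ^ 2 = C + 1 := by rw [h]; field_simp
    have e : (criticalB C * C) ^ 2 * (1 + 1 / C) = criticalB C ^ 2 * C * (C + 1) := by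
      field_simp
    rw [e, ← this]
    have : C * (criticalB C ^ 2 - 2 * criticalB C) = 1 := by nlinarith
    linear_combination (-C * (criticalB C) ^ 2 - 1) * this
  unfold heavyRatio
  rw [div_pow, div_mul_eq_mul_div, ← h2, div_self (by positivity)]

theorem heavyRatio_strictMono (hC : 0 < C) {β β' : ℝ} (h0 : 0 ≤ β) (h : β < β') :
    heavyRatio C β < heavyRatio C β' := by
  unfold heavyRatio
  have : β / (β + 1) < β' / (β' + 1) := by
    rw [div_lt_div_iff₀ (by linarith) (by linarith)]; linarith
  have h1 : 0 ≤ β / (β + 1) := by positivity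
  gcongr

theorem heavyRatio_lt_one (hB : 0 < B) (hC : 0 < C) (h : B < criticalB C) :
    heavyRatio C (B * C) < 1 := by
  rw [← heavyRatio_criticalB hC]
  exact heavyRatio_strictMono hC (by positivity) (by nlinarith)

theorem heavyRatio_pos (hC : 0 < C) {β : ℝ} (hβ : 0 < β) : 0 < heavyRatio C β := by
  unfold heavyRatio; positivity

/-- The limit of the mean heavy entry in the subcritical case. -/
noncomputable def heavyMean (B C : ℝ) : ℝ := heavyRatio C (B * C) / (1 - heavyRatio C (B * C))

theorem heavyMean_pos (hB : 0 < B) (hC : 0 < C) (h : B < criticalB C) : 0 < heavyMean B C := by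
  have h1 := heavyRatio_lt_one hB hC h
  have h2 : 0 < heavyRatio C (B * C) := heavyRatio_pos hC (by positivity)
  exact div_pos h2 (by linarith)

/-- Both denominators vanish at B_c: (BC + 1)² - B² C (C + 1) = C (B_c - B)(B + B_c - 2). -/
theorem heavyMean_eq (hB : 0 < B) (hC : 0 < C) (h : B < criticalB C) :
    heavyMean B C = B ^ 2 * (1 + C) / ((criticalB C - B) * (B + criticalB C - 2)) := by
  have h1 := heavyRatio_lt_one hB hC h
  have hsq := sq_criticalB_sub_one hC
  have e : (criticalB C - B) * (B + criticalB C - 2) = 1 + 1 / C - (B - 1) ^ 2 := by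
    rw [← hsq]; ring
  have hr : heavyRatio C (B * C) = B ^ 2 * (C * (C + 1)) / (B * C + 1) ^ 2 := by
    unfold heavyRatio; field_simp
  have h2 : B ^ 2 * (C * (C + 1)) < (B * C + 1) ^ 2 := by
    rw [hr, div_lt_one (by positivity)] at h1; exact h1
  have h3 : 0 < 1 + 1 / C - (B - 1) ^ 2 := by
    have e3 : C * (1 + 1 / C - (B - 1) ^ 2) = (B * C + 1) ^ 2 - B ^ 2 * (C * (C + 1)) := by
      field_simp; ring
    by_contra hcon
    push Not at hcon
    nlinarith
  have h4 : 0 < (B * C + 1) ^ 2 - B ^ 2 * (C * (C + 1)) := by linarith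
  have h5 : 1 - heavyRatio C (B * C)
      = ((B * C + 1) ^ 2 - B ^ 2 * (C * (C + 1))) / (B * C + 1) ^ 2 := by
    rw [hr]; field_simp
  rw [heavyMean, h5, hr, e, div_div_div_cancel_right₀ (by positivity), div_eq_div_iff h4.ne' h3.ne']
  field_simp
  ring

/-- In the subcritical case, strata decay once the mean heavy entry exceeds `heavyMean`. -/
theorem subcritical_decay (hB : 0 < B) (hC : 0 < C) (h : B < criticalB C) :
    ∃ c K : ℝ, 0 < c ∧ c ≤ 1 ∧ 0 < K ∧ ∀ k n p q : ℕ, LinearMargins B C k n p q → ∀ θ : ℝ, 0 < θ →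
      θ ≤ 1 → K * (k / n) ≤ θ → k * p ≤ n * q ∧ ∀ a < k * p, k * k * (heavyMean B C + θ) ≤ (a : ℝ) →
        (stratumCard k n p q (a + 1) : ℝ) ≤ (1 - c * θ) * stratumCard k n p q a := by
  have hκ1 := heavyRatio_lt_one hB hC h
  have hκ0 : 0 < heavyRatio C (B * C) := heavyRatio_pos hC (by positivity)
  have hα := heavyMean_pos hB hC h
  set κ := heavyRatio C (B * C) with hκ
  -- Equivalently (1 + 1/α) κ = 1: the limiting ratio is 1 at z = α.
  have hακ : heavyMean B C * (1 - κ) = κ := by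
    rw [heavyMean, ← hκ, div_mul_cancel₀]; linarith
  set α := heavyMean B C
  have hlt : (1 - κ) ^ 2 ≤ 1 := by nlinarith
  have hpos : 0 < (1 - κ) ^ 2 := by have : 0 < 1 - κ := by linarith
                                    positivity
  have hne : 1 - κ ≠ 0 := by linarith
  set K₁ := 2 + (1 + B * C) / C with hK₁
  have hK₁0 : 0 < K₁ := by positivity
  refine ⟨(1 - κ) ^ 2 / 2, 2 * K₁ / (1 - κ) ^ 2, by positivity, by linarith, by positivity, ?_⟩
  intro k n p q hm θ hθ0 hθ1 hθ
  have hk : (1 : ℝ) ≤ k := by exact_mod_cast hm.k_pos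
  have hn : (0 : ℝ) < n := by exact_mod_cast hm.n_pos
  set s := (1 - κ) ^ 2 / 2 * θ with hs
  have hs2 : s ≤ 1 / 2 := by nlinarith
  have hsξ : K₁ * (k / n) ≤ s := by
    have : 2 * K₁ / (1 - κ) ^ 2 * (k / n) * ((1 - κ) ^ 2 / 2) ≤ θ * ((1 - κ) ^ 2 / 2) := by gcongr
    have e : 2 * K₁ / (1 - κ) ^ 2 * ((k : ℝ) / n) * ((1 - κ) ^ 2 / 2) = K₁ * (k / n) := by
      field_simp
    rw [e] at this
    linarith
  have hyC : (1 + B * C) * (k / n : ℝ) ≤ C := by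
    have e : (1 + B * C) * (k / n : ℝ) = C * ((1 + B * C) / C * (k / n)) := by field_simp
    have : (1 + B * C) / C * (k / n : ℝ) ≤ K₁ * (k / n) := by
      rw [hK₁]; gcongr; linarith
    rw [e]
    nlinarith
  refine ⟨hm.mul_le_mul hyC, fun a ha hax => ?_⟩
  have hax0 : 0 < (k : ℝ) * k * (α + θ) := by positivity
  have ha0 : 0 < a := by
    have : (0 : ℝ) < a := lt_of_lt_of_le hax0 hax
    exact_mod_cast this
  refine (hm.stratumCard_succ_le hB hC hs2 hsξ ha ha0 (β := B * C) (by positivity) ?_).trans ?_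
  · have := hm.p_le
    have : (0 : ℝ) ≤ a := Nat.cast_nonneg _
    nlinarith
  · have hw : (0 : ℝ) ≤ stratumCard k n p q a := Nat.cast_nonneg _
    gcongr
    rw [← hκ, div_le_iff₀ (by linarith)]
    have h1 : (k : ℝ) * k / a ≤ 1 / (α + θ) := by
      rw [div_le_div_iff₀ (by exact_mod_cast ha0) (by positivity)]; linarith
    -- At z = α + θ the limiting ratio is below 1 - 2s. As 1 - 2s ≤ (1-s)², one factor 1 - s can be
    -- given up to the errors of order k/n.
    have h2 : (1 + 1 / (α + θ)) * κ ≤ 1 - (1 - κ) ^ 2 * θ := by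
      have e : (1 + 1 / (α + θ)) * κ = (α + θ + 1) * κ / (α + θ) := by field_simp
      rw [e, div_le_iff₀ (by positivity)]
      have e2 : (1 - (1 - κ) ^ 2 * θ) * (α + θ) - (α + θ + 1) * κ = θ * (1 - κ) ^ 2 * (1 - θ) := by
        have hα' : α = κ + α * κ := by linarith
        linear_combination (1 - (1 - κ) * θ) * hακ
      have : 0 ≤ θ * (1 - κ) ^ 2 * (1 - θ) := mul_nonneg (by positivity) (by linarith)
      linarith
    calc (1 + k * k / a) * κ ≤ (1 + 1 / (α + θ)) * κ := by gcongr
      _ ≤ 1 - (1 - κ) ^ 2 * θ := h2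
      _ ≤ (1 - s) * (1 - s) := by
        have : (1 - κ) ^ 2 * θ = 2 * s := by rw [hs]; ring
        rw [this]
        have := sq_nonneg s
        linarith

/-- Needed for lower bounds, because a nonempty heavy block makes the mean side entry slightly
smaller than BC. -/
theorem heavyRatio_mul_le (hC : 0 < C) {β y : ℝ} (hβ : 0 < β) (hy0 : 0 ≤ y) (hy1 : y ≤ 1) :
    heavyRatio C β * (1 - 2 * y) ≤ heavyRatio C (β * (1 - y)) := by
  unfold heavyRatio
  have hβy : 0 ≤ β * (1 - y) := mul_nonneg hβ.le (by linarith)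
  have hr : β / (β + 1) * (1 - y) ≤ β * (1 - y) / (β * (1 - y) + 1) := by
    rw [div_mul_eq_mul_div]
    apply div_le_div_of_nonneg_left hβy (by linarith)
    have : 0 ≤ β * y := by positivity
    linarith
  set r := β / (β + 1)
  have hr0 : 0 ≤ r := by positivity
  have hr1 : 0 ≤ r * (1 - y) := mul_nonneg hr0 (by linarith)
  have h1 : r ^ 2 * (1 - 2 * y) ≤ (r * (1 - y)) ^ 2 := by
    have e : (r * (1 - y)) ^ 2 = r ^ 2 * (1 - 2 * y) + (r * y) ^ 2 := by ring
    rw [e]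
    have := sq_nonneg (r * y)
    linarith
  have hC' : 0 ≤ 1 + 1 / C := by positivity
  calc r ^ 2 * (1 + 1 / C) * (1 - 2 * y) = r ^ 2 * (1 - 2 * y) * (1 + 1 / C) := by ring
    _ ≤ (r * (1 - y)) ^ 2 * (1 + 1 / C) := by gcongr
    _ ≤ _ := by gcongr

/-- The gain below the fixed point α of (1 + 1/z) κ = 1, mirroring the loss above it in
`subcritical_decay`. -/
theorem one_add_le_mul_of_lt_fixedPoint {α κ θ : ℝ} (hκ1 : κ < 1)
    (hακ : α * (1 - κ) = κ) (hθ0 : 0 < θ) (hαθ : 0 < α - θ) :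
    1 + (1 - κ) ^ 2 * θ ≤ (1 + 1 / (α - θ)) * κ := by
  have e : (1 + 1 / (α - θ)) * κ = (α - θ + 1) * κ / (α - θ) := by field_simp
  rw [e, le_div_iff₀ hαθ]
  have e2 : (α - θ + 1) * κ - (1 + (1 - κ) ^ 2 * θ) * (α - θ)
      = θ * (1 - κ) * (1 - κ) * (1 + θ) := by
    linear_combination (-1 - (1 - κ) * θ) * hακ
  have h0 : 0 < 1 - κ := by linarith
  have : 0 ≤ θ * (1 - κ) * (1 - κ) * (1 + θ) := by positivity
  linarith

/-- Error budget: half of a gain σ survives three relative losses of σ/12. -/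
theorem one_add_half_le {σ : ℝ} (h0 : 0 ≤ σ) (h1 : σ ≤ 1) :
    1 + σ / 2 ≤ (1 + σ) * ((1 - σ / 12) * (1 - σ / 12) * (1 - σ / 12)) := by
  have h2 : 1 - σ / 4 ≤ (1 - σ / 12) * (1 - σ / 12) * (1 - σ / 12) := by
    have h3 : σ ^ 3 ≤ σ ^ 2 := pow_le_pow_of_le_one h0 h1 (by norm_num)
    have h4 := sq_nonneg σ
    linarith
  nlinarith

theorem le_one_sub_mul_of_one_add_mul_le {σ x y : ℝ} (h0 : 0 ≤ σ) (h1 : σ ≤ 1) (hx : 0 ≤ x)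
    (h : (1 + σ / 2) * x ≤ y) : x ≤ (1 - σ / 4) * y := by
  have h2 : 1 ≤ (1 - σ / 4) * (1 + σ / 2) := by nlinarith
  calc x ≤ ((1 - σ / 4) * (1 + σ / 2)) * x := le_mul_of_one_le_left hx h2
    _ = (1 - σ / 4) * ((1 + σ / 2) * x) := by ring
    _ ≤ _ := mul_le_mul_of_nonneg_left h (by linarith)

/-- In the subcritical case, strata grow while the mean heavy entry is below `heavyMean`. -/
theorem subcritical_growth (hB : 0 < B) (hC : 0 < C) (h : B < criticalB C) :
    ∃ c K : ℝ, 0 < c ∧ c ≤ 1 ∧ 0 < K ∧ ∀ k n p q : ℕ, LinearMargins B C k n p q → ∀ θ : ℝ, 0 < θ →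
      θ ≤ 1 → K * (k / n) ≤ θ → K * (1 / (k * k)) ≤ θ → k * p ≤ n * q ∧
      (k : ℝ) * k * (heavyMean B C - θ) ≤ k * p ∧
      ∀ a < k * p, (a : ℝ) + 1 ≤ k * k * (heavyMean B C - θ) →
        (stratumCard k n p q a : ℝ) ≤ (1 - c * θ) * stratumCard k n p q (a + 1) := by
  have hκ1 := heavyRatio_lt_one hB hC h
  have hκ0 : 0 < heavyRatio C (B * C) := heavyRatio_pos hC (by positivity)
  have hα := heavyMean_pos hB hC h
  set κ := heavyRatio C (B * C) with hκ
  have hακ : heavyMean B C * (1 - κ) = κ := by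
    rw [heavyMean, ← hκ, div_mul_cancel₀]; linarith
  set α := heavyMean B C
  have h1κ : 0 < 1 - κ := by linarith
  have hlt : (1 - κ) ^ 2 ≤ 1 := pow_le_one₀ h1κ.le (by linarith)
  have hpos : 0 < (1 - κ) ^ 2 := by positivity
  have hBC : 0 < B * C := by positivity
  -- A heavy block of sum at most k²α and the rounding error k together take at most k²(1 + α) = kn
  -- · BC · K₂ξ from the side block.
  set K₂ := (1 + α) / (B * C) with hK₂
  have hK₂0 : 0 < K₂ := by positivity
  -- The first term makes each of 1/k², 1/n² and 2K₂ξ at most σ/12; the second gives k p ≤ n q.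
  set K := 12 * (1 + 2 * K₂) / (1 - κ) ^ 2 + (1 + B * C) / C with hK
  refine ⟨(1 - κ) ^ 2 / 4, K, by positivity, by linarith, by positivity, ?_⟩
  intro k n p q hm θ hθ0 hθ1 hθ hθk
  have hk : (1 : ℝ) ≤ k := by exact_mod_cast hm.k_pos
  have hn : (1 : ℝ) ≤ n := by exact_mod_cast hm.n_pos
  set ξ : ℝ := k / n with hξ
  have hξ0 : 0 < ξ := by positivity
  set σ := (1 - κ) ^ 2 * θ with hσ
  have hσ0 : 0 < σ := by positivity
  have hσ1 : σ ≤ 1 := mul_le_one₀ hlt hθ0.le hθ1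
  have hKge : 12 * (1 + 2 * K₂) / (1 - κ) ^ 2 ≤ K := by
    have : 0 < (1 + B * C) / C := by positivity
    linarith
  have small : ∀ e : ℝ, 0 ≤ e → K * e ≤ θ → (1 + 2 * K₂) * e ≤ σ / 12 := by
    intro e he hKe
    have h1 : 12 * (1 + 2 * K₂) / (1 - κ) ^ 2 * e ≤ θ :=
      le_trans (mul_le_mul_of_nonneg_right hKge he) hKe
    rw [div_mul_eq_mul_div, div_le_iff₀ hpos] at h1
    linarith
  have hyC : (1 + B * C) * ξ ≤ C := by
    have : (1 + B * C) / C * ξ ≤ K * ξ := by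
      refine mul_le_mul_of_nonneg_right ?_ hξ0.le
      have : 0 < 12 * (1 + 2 * K₂) / (1 - κ) ^ 2 := by positivity
      linarith
    have h1 : (1 + B * C) / C * ξ ≤ 1 := by linarith
    rwa [div_mul_eq_mul_div, div_le_one hC] at h1
  have hξs := small ξ hξ0.le hθ
  have hks := small (1 / (k * k)) (by positivity) hθk
  have hn2 : 1 / ((n : ℝ) * n) ≤ ξ := by
    refine le_trans ?_ hm.one_div_le
    exact one_div_le_one_div_of_le (by positivity) (le_mul_of_one_le_left (by positivity) hn)
  have hK₂ξ0 : 0 < K₂ * ξ := by positivity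
  have e1 : 1 / ((k : ℝ) * k) ≤ σ / 12 := by
    have : 0 ≤ 2 * K₂ * (1 / ((k : ℝ) * k)) := by positivity
    linarith
  have e2 : 1 / ((n : ℝ) * n) ≤ σ / 12 := by linarith
  have e3 : 2 * (K₂ * ξ) ≤ σ / 12 := by linarith
  have hξK : (1 + α) * ξ = B * C * (K₂ * ξ) := by rw [hK₂]; field_simp
  have hnξ : (n : ℝ) * ξ = k := by rw [hξ]; field_simp
  have hkk : (k : ℝ) ≤ k * k := le_mul_of_one_le_left (by positivity) hk
  have hpb : (k : ℝ) * n * (B * C * (1 - K₂ * ξ)) ≤ k * p - k * k * α := by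
    have e : (k : ℝ) * n * (B * C * (1 - K₂ * ξ)) = k * n * (B * C) - k * k * (1 + α) := by
      have : (k : ℝ) * n * (B * C * (1 - K₂ * ξ))
        = k * n * (B * C) - k * n * (B * C * (K₂ * ξ)) := by ring
      rw [this, ← hξK]
      linear_combination (-(k : ℝ)) * (1 + α) * hnξ
    rw [e]
    have := mul_le_mul_of_nonneg_left hm.le_p (by positivity : (0 : ℝ) ≤ k)
    linarith
  have hpos2 : 0 < B * C * (1 - K₂ * ξ) := mul_pos hBC (by linarith)
  have hkkθ : 0 ≤ (k : ℝ) * k * θ := by positivity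
  refine ⟨hm.mul_le_mul hyC, ?_, fun a ha hax => ?_⟩
  · have h1 : 0 ≤ (k : ℝ) * n * (B * C * (1 - K₂ * ξ)) := by positivity
    linarith
  have haR : (0 : ℝ) ≤ a := Nat.cast_nonneg _
  -- Otherwise the condition on `a` could not hold.
  have hαθ : 0 < α - θ := by
    by_contra hcon
    push Not at hcon
    have : (k : ℝ) * k * (α - θ) ≤ 0 := mul_nonpos_of_nonneg_of_nonpos (by positivity) hcon
    linarith
  have key := le_stratumCard_succ (β := B * C * (1 - K₂ * ξ)) hm.k_pos hm.n_pos ha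
    (hm.mul_le_mul hyC) hC hpos2.le (by linarith) hm.q_le
  have hw : (0 : ℝ) ≤ stratumCard k n p q a := Nat.cast_nonneg _
  have h1 : 1 + 1 / (α - θ) ≤ 1 + k * k / ((a : ℝ) + 1) := by
    gcongr 1 + ?_
    rw [div_le_div_iff₀ hαθ (by positivity)]; linarith
  have h2 := one_add_le_mul_of_lt_fixedPoint hκ1 hακ hθ0 hαθ
  rw [← hσ] at h2
  have h3 : κ * (1 - 2 * (K₂ * ξ)) ≤ heavyRatio C (B * C * (1 - K₂ * ξ)) :=
    heavyRatio_mul_le hC hBC hK₂ξ0.le (by linarith)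
  have p1 : 0 ≤ 1 - σ / 12 := by linarith
  have p5 : 0 ≤ 1 / (α - θ) := by positivity
  have m1 : (1 + 1 / (α - θ)) * (1 - σ / 12)
      ≤ max (1 : ℝ) ((1 + k * k / ((a : ℝ) + 1)) * (1 - 1 / (k * k))) :=
    le_trans (mul_le_mul h1 (by linarith) p1 (by linarith)) (le_max_right _ _)
  have hk3 : κ * (1 - σ / 12) ≤ heavyRatio C (B * C * (1 - K₂ * ξ)) :=
    le_trans (mul_le_mul_of_nonneg_left (by linarith) hκ0.le) h3
  have p3 : 0 ≤ (1 + 1 / (α - θ)) * (1 - σ / 12) := mul_nonneg (by linarith) p1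
  have p4 : 0 ≤ κ * (1 - σ / 12) := mul_nonneg hκ0.le p1
  have key2 : (1 + σ / 2) * stratumCard k n p q a ≤ (stratumCard k n p q (a + 1) : ℝ) := by
    refine le_trans (mul_le_mul_of_nonneg_right ?_ hw) key
    calc 1 + σ / 2 ≤ (1 + σ) * ((1 - σ / 12) * (1 - σ / 12) * (1 - σ / 12)) :=
          one_add_half_le hσ0.le hσ1
      _ ≤ ((1 + 1 / (α - θ)) * κ) * ((1 - σ / 12) * (1 - σ / 12) * (1 - σ / 12)) :=
          mul_le_mul_of_nonneg_right h2 (mul_nonneg (mul_nonneg p1 p1) p1)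
      _ = ((1 + 1 / (α - θ)) * (1 - σ / 12)) * (κ * (1 - σ / 12)) * (1 - σ / 12) := by ring
      _ ≤ _ := mul_le_mul (mul_le_mul m1 hk3 p4 (p3.trans m1)) (by linarith) p1
            (mul_nonneg (p3.trans m1) (heavyRatio_nonneg hC _))
  have e5 : (1 - κ) ^ 2 / 4 * θ = σ / 4 := by rw [hσ]; ring
  rw [e5]
  exact le_one_sub_mul_of_one_add_mul_le hσ0.le hσ1 hw key2

/-- With b = B_c C, passing from b to b + θ multiplies β/(β+1) by exactly 1 + θ/(b(b+θ+1)), and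
`heavyRatio` is 1 at b. -/
theorem heavyRatio_add_ge (hC : 0 < C) {θ : ℝ} (hθ0 : 0 ≤ θ) (hθ1 : θ ≤ 1) :
    1 + 1 / ((criticalB C * C + 1) * (criticalB C * C + 2)) * θ
      ≤ heavyRatio C (criticalB C * C + θ) := by
  have h1 := heavyRatio_criticalB hC
  have hb := criticalB_pos C
  have hb' : 0 < criticalB C * C := by positivity
  set b := criticalB C * C
  unfold heavyRatio at h1 ⊢
  set c := 1 / ((b + 1) * (b + 2)) with hc
  have hc0 : 0 < c := by positivity
  have h2 : b / (b + 1) * (1 + c * θ) ≤ (b + θ) / (b + θ + 1) := by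
    have h3 : b * (1 + c * θ) * (b + θ + 1) ≤ (b + θ) * (b + 1) := by
      have h4 : c * (b + 1) * (b + 2) = 1 := by rw [hc]; field_simp
      have h5 : b * c * (b + θ + 1) ≤ 1 := by
        calc b * c * (b + θ + 1) ≤ (b + 1) * c * (b + 2) :=
            mul_le_mul (mul_le_mul_of_nonneg_right (by linarith) hc0.le) (by linarith)
              (by positivity) (by positivity)
          _ = 1 := by linarith
      have h6 := mul_le_mul_of_nonneg_right h5 hθ0
      linarith
    rw [div_mul_eq_mul_div, div_le_div_iff₀ (by positivity) (by positivity)]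
    exact h3
  have hcθ : 0 ≤ c * θ := by positivity
  calc 1 + c * θ ≤ (1 + c * θ) ^ 2 := by nlinarith
    _ = (b / (b + 1) * (1 + c * θ)) ^ 2 * (1 + 1 / C) := by
        rw [mul_pow]; linear_combination (-(1 + c * θ) ^ 2) * h1
    _ ≤ _ := by gcongr

/-- Here β/(β+1) is multiplied by exactly 1 - θ/(b(b-θ+1)). -/
theorem heavyRatio_sub_le (hC : 0 < C) {θ : ℝ} (hθ0 : 0 ≤ θ) (hθ1 : θ ≤ criticalB C * C) :
    heavyRatio C (criticalB C * C - θ) ≤ 1 - 1 / (criticalB C * C + 1) ^ 2 * θ := by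
  have h1 := heavyRatio_criticalB hC
  have hb := criticalB_pos C
  have hb' : 0 < criticalB C * C := by positivity
  set b := criticalB C * C
  unfold heavyRatio at h1 ⊢
  set c := 1 / (b + 1) ^ 2 with hc
  have hc0 : 0 < c := by positivity
  have h4 : c * (b + 1) * (b + 1) = 1 := by rw [hc]; field_simp
  have h7 : c * θ ≤ 1 := by
    calc c * θ ≤ c * (b + 1) := by gcongr; linarith
      _ ≤ c * (b + 1) * (b + 1) := le_mul_of_one_le_right (by positivity) (by linarith)
      _ = 1 := h4
  have h2 : (b - θ) / (b - θ + 1) ≤ b / (b + 1) * (1 - c * θ) := by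
    rw [div_mul_eq_mul_div, div_le_div_iff₀ (by linarith) (by positivity)]
    have h5 : b * c * (b - θ + 1) ≤ 1 := by
      calc b * c * (b - θ + 1) ≤ (b + 1) * c * (b + 1) := by gcongr <;> linarith
        _ = 1 := by linarith
    have h6 := mul_le_mul_of_nonneg_right h5 hθ0
    linarith
  have h3 : 0 ≤ (b - θ) / (b - θ + 1) := div_nonneg (by linarith) (by linarith)
  have hcθ : 0 ≤ c * θ := by positivity
  calc ((b - θ) / (b - θ + 1)) ^ 2 * (1 + 1 / C)
      ≤ (b / (b + 1) * (1 - c * θ)) ^ 2 * (1 + 1 / C) := by gcongr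
    _ = (1 - c * θ) ^ 2 := by
        rw [mul_pow]; linear_combination (1 - c * θ) ^ 2 * h1
    _ ≤ 1 - c * θ := by nlinarith

/-- In the supercritical case, strata grow while the mean side entry is above `criticalB C * C`. -/
theorem supercritical_growth (hB : 0 < B) (hC : 0 < C) (h : criticalB C < B) :
    ∃ c K θ₀ : ℝ, 0 < c ∧ c ≤ 1 ∧ 0 < K ∧ 0 < θ₀ ∧ ∀ k n p q : ℕ, LinearMargins B C k n p q →
      ∀ θ : ℝ, 0 < θ → θ ≤ θ₀ → K * (k / n) ≤ θ → k * p ≤ n * q ∧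
      0 ≤ (k : ℝ) * p - k * n * (criticalB C * C + θ) ∧
      ∀ a < k * p, (a : ℝ) + 1 ≤ k * p - k * n * (criticalB C * C + θ) →
        (stratumCard k n p q a : ℝ) ≤ (1 - c * θ) * stratumCard k n p q (a + 1) := by
  have hb := criticalB_pos C
  have hb' : 0 < criticalB C * C := by positivity
  set c₁ := 1 / ((criticalB C * C + 1) * (criticalB C * C + 2)) with hc₁
  have hc₁0 : 0 < c₁ := by positivity
  have hc₁1 : c₁ ≤ 1 := by
    rw [hc₁, div_le_one (by positivity)]
    nlinarith
  -- Half the gap between BC and B_c C. With θ and 1/n at most μ the threshold for `a` is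
  -- nonnegative.
  set μ := (B - criticalB C) * C / 2 with hμ
  have hμ0 : 0 < μ := by
    have : 0 < B - criticalB C := by linarith
    positivity
  set K := 12 / c₁ + (1 + B * C) / C + 1 / μ with hK
  have g1 : 0 < 12 / c₁ := by positivity
  have g2 : 0 < (1 + B * C) / C := by positivity
  have g3 : 0 < 1 / μ := by positivity
  refine ⟨c₁ / 4, K, min 1 μ, by positivity, by linarith, by positivity, by positivity, ?_⟩
  intro k n p q hm θ hθ0 hθ1 hθ
  have hθμ : θ ≤ μ := hθ1.trans (min_le_right _ _)
  have hθ1 : θ ≤ 1 := hθ1.trans (min_le_left _ _)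
  have hk : (1 : ℝ) ≤ k := by exact_mod_cast hm.k_pos
  have hn : (1 : ℝ) ≤ n := by exact_mod_cast hm.n_pos
  have hξ1 := hm.one_div_le
  set ξ : ℝ := k / n with hξ
  have hξ0 : 0 < ξ := by positivity
  set σ := c₁ * θ with hσ
  have hσ0 : 0 < σ := by positivity
  have hσ1 : σ ≤ 1 := mul_le_one₀ hc₁1 hθ0.le hθ1
  have gs : ∀ e : ℝ, e ≤ K → e * ξ ≤ θ := fun e he =>
    (mul_le_mul_of_nonneg_right he hξ0.le).trans hθ
  have hξσ : ξ ≤ σ / 12 := by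
    have := gs (12 / c₁) (by linarith)
    rw [div_mul_eq_mul_div, div_le_iff₀ hc₁0] at this
    linarith
  have hξμ : ξ ≤ μ := by
    have := gs (1 / μ) (by linarith)
    rw [div_mul_eq_mul_div, div_le_iff₀ hμ0] at this
    have : θ * μ ≤ 1 * μ := by gcongr
    linarith
  have hyC : (1 + B * C) * ξ ≤ C := by
    have := gs ((1 + B * C) / C) (by linarith)
    rw [div_mul_eq_mul_div, div_le_iff₀ hC] at this
    have : θ * C ≤ 1 * C := by gcongr
    linarith
  have hpq := hm.mul_le_mul hyC
  refine ⟨hpq, ?_, fun a ha hax => ?_⟩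
  · have h1 : (k : ℝ) * (B * C * n - 1) ≤ k * p :=
      mul_le_mul_of_nonneg_left hm.le_p (by positivity)
    have h2 : (k : ℝ) * n * (1 / n) = k := by field_simp
    have h3 : (k : ℝ) * n * (1 / n + θ) ≤ k * n * (2 * μ) := by
      apply mul_le_mul_of_nonneg_left _ (by positivity)
      linarith
    rw [hμ] at h3
    linarith
  have hw : (0 : ℝ) ≤ stratumCard k n p q a := Nat.cast_nonneg _
  have key := le_stratumCard_succ (β := criticalB C * C + θ) hm.k_pos hm.n_pos ha
    hpq hC (by positivity) (by linarith) hm.q_le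
  have hr := heavyRatio_add_ge hC hθ0.le hθ1
  have hn2 : 1 / ((n : ℝ) * n) ≤ σ / 12 := by
    have : 1 / ((n : ℝ) * n) ≤ 1 / n :=
      one_div_le_one_div_of_le (by positivity) (le_mul_of_one_le_left (by positivity) hn)
    linarith
  have p1 : 0 ≤ 1 - σ / 12 := by linarith
  have key2 : (1 + σ / 2) * stratumCard k n p q a ≤ (stratumCard k n p q (a + 1) : ℝ) := by
    refine le_trans (mul_le_mul_of_nonneg_right ?_ hw) key
    calc 1 + σ / 2 ≤ 1 * (1 + σ) * (1 - σ / 12) := by nlinarith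
      _ ≤ _ := mul_le_mul (mul_le_mul (le_max_left _ _) hr (by linarith) (by positivity))
            (by linarith) p1 (mul_nonneg (by positivity) (heavyRatio_nonneg hC _))
  have e5 : c₁ / 4 * θ = σ / 4 := by rw [hσ]; ring
  rw [e5]
  exact le_one_sub_mul_of_one_add_mul_le hσ0.le hσ1 hw key2

/-- In the supercritical case, strata decay once the mean side entry is below `criticalB C * C`. -/
theorem supercritical_decay (hB : 0 < B) (hC : 0 < C) (h : criticalB C < B) :
    ∃ c K θ₀ : ℝ, 0 < c ∧ c ≤ 1 ∧ 0 < K ∧ 0 < θ₀ ∧ ∀ k n p q : ℕ, LinearMargins B C k n p q →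
      ∀ θ : ℝ, 0 < θ → θ ≤ θ₀ → K * (k / n) ≤ θ → k * p ≤ n * q ∧
      0 ≤ (k : ℝ) * p - k * n * (criticalB C * C - θ) ∧
      ∀ a < k * p, (k : ℝ) * p - k * n * (criticalB C * C - θ) ≤ a →
        (stratumCard k n p q (a + 1) : ℝ) ≤ (1 - c * θ) * stratumCard k n p q a := by
  have hb := criticalB_pos C
  have hb' : 0 < criticalB C * C := by positivity
  set b := criticalB C * C with hbdef
  set c₂ := 1 / (b + 1) ^ 2 with hc₂
  have hc₂0 : 0 < c₂ := by positivity
  have hc₂1 : c₂ ≤ 1 := by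
    rw [hc₂, div_le_one (by positivity)]
    nlinarith
  set μ := (B - criticalB C) * C / 2 with hμ
  have hμ0 : 0 < μ := by
    have : 0 < B - criticalB C := by linarith
    positivity
  set K₁ := 2 + (1 + B * C) / C with hK₁
  have hK₁0 : 0 < K₁ := by positivity
  set K := 8 * K₁ / c₂ + 8 / (c₂ * μ) + (1 + B * C) / C + 1 / μ with hK
  have g0 : 0 < 8 * K₁ / c₂ := by positivity
  have g1 : 0 < 8 / (c₂ * μ) := by positivity
  have g2 : 0 < (1 + B * C) / C := by positivity
  have g3 : 0 < 1 / μ := by positivity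
  refine ⟨c₂ / 4, K, min 1 (b / 2), by positivity, by linarith, by positivity, by positivity, ?_⟩
  intro k n p q hm θ hθ0 hθ1 hθ
  have hθb : θ ≤ b / 2 := hθ1.trans (min_le_right _ _)
  have hθ1 : θ ≤ 1 := hθ1.trans (min_le_left _ _)
  have hk : (1 : ℝ) ≤ k := by exact_mod_cast hm.k_pos
  have hn : (1 : ℝ) ≤ n := by exact_mod_cast hm.n_pos
  have hξ1 := hm.one_div_le
  set ξ : ℝ := k / n with hξ
  have hξ0 : 0 < ξ := by positivity
  set σ := c₂ * θ with hσ
  have hσ0 : 0 < σ := by positivity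
  have hσ1 : σ ≤ 1 := mul_le_one₀ hc₂1 hθ0.le hθ1
  have gs : ∀ e : ℝ, e ≤ K → e * ξ ≤ θ := fun e he =>
    (mul_le_mul_of_nonneg_right he hξ0.le).trans hθ
  have hξσ : K₁ * ξ ≤ σ / 8 := by
    have := gs (8 * K₁ / c₂) (by linarith)
    rw [div_mul_eq_mul_div, div_le_iff₀ hc₂0] at this
    linarith
  have hξμσ : ξ / μ ≤ σ / 8 := by
    have := gs (8 / (c₂ * μ)) (by linarith)
    rw [div_mul_eq_mul_div, div_le_iff₀ (by positivity)] at this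
    rw [div_le_iff₀ hμ0, hσ]
    linarith
  have hξμ : ξ ≤ μ := by
    have := gs (1 / μ) (by linarith)
    rw [div_mul_eq_mul_div, div_le_iff₀ hμ0] at this
    have : θ * μ ≤ 1 * μ := by gcongr
    linarith
  have hyC : (1 + B * C) * ξ ≤ C := by
    have := gs ((1 + B * C) / C) (by linarith)
    rw [div_mul_eq_mul_div, div_le_iff₀ hC] at this
    have : θ * C ≤ 1 * C := by gcongr
    linarith
  have hpq := hm.mul_le_mul hyC
  have hkn : (0 : ℝ) < k * n := by positivity
  -- Beyond the threshold the heavy block sum is of order kn, so k²/a is of order k/n and the heavy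
  -- factor is nearly 1.
  have hxμ : (k : ℝ) * n * μ ≤ k * p - k * n * (b - θ) := by
    have h1 : (k : ℝ) * (B * C * n - 1) ≤ k * p :=
      mul_le_mul_of_nonneg_left hm.le_p (by positivity)
    have h2 : (k : ℝ) * n * (1 / n) = k := by field_simp
    have h3 : (k : ℝ) * n * (1 / n) ≤ k * n * μ :=
      mul_le_mul_of_nonneg_left (by linarith) (by positivity)
    have h4 : 0 ≤ (k : ℝ) * n * θ := by positivity
    have h5 : (k : ℝ) * n * μ * 2 = k * n * (B * C) - k * n * b := by rw [hμ, hbdef]; ring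
    linarith
  have hknμ : 0 < (k : ℝ) * n * μ := by positivity
  refine ⟨hpq, by linarith, fun a ha hax => ?_⟩
  have haR : (k : ℝ) * n * μ ≤ a := hxμ.trans hax
  have ha0 : 0 < a := by
    have : (0 : ℝ) < a := by linarith
    exact_mod_cast this
  refine (hm.stratumCard_succ_le hB hC (by linarith) hξσ ha ha0 (β := b - θ) (by linarith)
    (by linarith)).trans ?_
  have hw : (0 : ℝ) ≤ stratumCard k n p q a := Nat.cast_nonneg _
  refine mul_le_mul_of_nonneg_right ?_ hw
  rw [div_le_iff₀ (by linarith)]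
  have hr := heavyRatio_sub_le hC hθ0.le (by linarith : θ ≤ criticalB C * C)
  have h1 : (k : ℝ) * k / a ≤ σ / 8 := by
    refine le_trans ?_ hξμσ
    rw [hξ, div_div, div_le_div_iff₀ (by linarith) (by positivity)]
    have := mul_le_mul_of_nonneg_left haR (by positivity : (0 : ℝ) ≤ k)
    linarith
  have e5 : c₂ / 4 * θ = σ / 4 := by rw [hσ]; ring
  have h0 : (0 : ℝ) ≤ k * k / a := by positivity
  rw [e5]
  calc (1 + k * k / a) * heavyRatio C (b - θ) ≤ (1 + σ / 8) * (1 - σ) :=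
        mul_le_mul (by linarith) hr (heavyRatio_nonneg hC _) (by linarith)
    _ ≤ (1 - σ / 4) * (1 - σ / 8) := by
        have := sq_nonneg σ
        linarith

end

/-! ### From integrals over random tables to finite averages -/

/-- A table indexed by heavy and light indices, as a table indexed by numbers. -/
noncomputable def toBlockTable {n : ℕ} {δ : ℝ}
    (A : Fin (numHeavy n δ) ⊕ Fin n → Fin (numHeavy n δ) ⊕ Fin n → ℕ) : BlockTable n δ :=
  fun i j => A (finSumFinEquiv.symm i) (finSumFinEquiv.symm j)

theorem toBlockTable_injective {n : ℕ} {δ : ℝ} :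
    Function.Injective (toBlockTable (n := n) (δ := δ)) := by
  intro A A' h
  funext i j
  have := congrFun (congrFun h (finSumFinEquiv i)) (finSumFinEquiv j)
  simpa [toBlockTable] using this

theorem blockMargin_finSumFinEquiv (n : ℕ) (δ B C : ℝ) (i : Fin (numHeavy n δ) ⊕ Fin n) :
    blockMargin n δ B C (finSumFinEquiv i)
      = blockVec (Fin (numHeavy n δ)) (Fin n) ⌊B * C * n⌋₊ ⌊C * n⌋₊ i := by
  rcases i with i | i <;> simp [blockMargin, blockVec]

theorem coe_image_toBlockTable (n : ℕ) (δ B C : ℝ) :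
    toBlockTable '' (blockTabs (Fin (numHeavy n δ)) (Fin n) ⌊B * C * n⌋₊ ⌊C * n⌋₊ : Set _)
      = blockTables n δ B C := by
  ext X
  constructor
  · rintro ⟨A, hA, rfl⟩
    rw [Finset.mem_coe, blockTabs, mem_tables] at hA
    constructor
    · intro i
      obtain ⟨i, rfl⟩ := finSumFinEquiv.surjective i
      rw [blockMargin_finSumFinEquiv, ← hA.1 i]
      simp only [toBlockTable, Equiv.symm_apply_apply]
      exact Equiv.sum_comp finSumFinEquiv.symm (fun j => A i j)
    · intro j
      obtain ⟨j, rfl⟩ := finSumFinEquiv.surjective j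
      rw [blockMargin_finSumFinEquiv, ← hA.2 j]
      simp only [toBlockTable, Equiv.symm_apply_apply]
      exact Equiv.sum_comp finSumFinEquiv.symm (fun i => A i j)
  · rintro ⟨h1, h2⟩
    refine ⟨fun i j => X (finSumFinEquiv i) (finSumFinEquiv j), ?_, ?_⟩
    · rw [Finset.mem_coe, blockTabs, mem_tables]
      constructor
      · intro i
        rw [← blockMargin_finSumFinEquiv, ← h1]
        exact Equiv.sum_comp finSumFinEquiv (fun j => X (finSumFinEquiv i) j)
      · intro j
        rw [← blockMargin_finSumFinEquiv, ← h2]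
        exact Equiv.sum_comp finSumFinEquiv (fun i => X i (finSumFinEquiv j))
    · funext i j
      simp [toBlockTable]

theorem integral_uniformOn_finset {Ω : Type*} [MeasurableSpace Ω] [MeasurableSingletonClass Ω]
    (s : Finset Ω) (f : Ω → ℝ) :
    ∫ x, f x ∂uniformOn (s : Set Ω) = (∑ x ∈ s, f x) / s.card := by
  rw [uniformOn, ProbabilityTheory.cond, integral_smul_measure, setIntegral_finset]
  · simp [Measure.real, Measure.count_apply_finset, div_eq_inv_mul]
  · rw [← (s : Set Ω).biUnion_of_singleton]
    simp [integrableOn_finset_iUnion]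

theorem integral_uniformTable (n : ℕ) (δ B C : ℝ) (f : BlockTable n δ → ℝ) :
    ∫ X, f X ∂uniformTable n δ B C
      = tabAvg (U := Fin (numHeavy n δ)) (V := Fin n) ⌊B * C * n⌋₊ ⌊C * n⌋₊
        fun A => f (toBlockTable A) := by
  classical
  have : MeasurableSingletonClass (BlockTable n δ) := ⟨fun _ => trivial⟩
  rw [uniformTable, ← coe_image_toBlockTable, ← Finset.coe_image, integral_uniformOn_finset,
    Finset.sum_image toBlockTable_injective.injOn,
    Finset.card_image_of_injective _ toBlockTable_injective, tabAvg]

section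
variable {n : ℕ} {δ : ℝ} (A : Fin (numHeavy n δ) ⊕ Fin n → Fin (numHeavy n δ) ⊕ Fin n → ℕ)

theorem finSumFinEquiv_symm_of_lt {k n : ℕ} (hk : 0 < k) (h : 1 - 1 < k + n) :
    (finSumFinEquiv.symm ⟨1 - 1, h⟩ : Fin k ⊕ Fin n) = .inl ⟨0, hk⟩ := by
  rw [Equiv.symm_apply_eq]; ext; simp

/-- Counted from 0, the index is `n`; it is light exactly because there are at most `n` heavy
indices. -/
theorem finSumFinEquiv_symm_light {k n : ℕ} (hk : 0 < k) (hkn : k ≤ n)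
    (h : n + 1 - 1 < k + n) :
    (finSumFinEquiv.symm ⟨n + 1 - 1, h⟩ : Fin k ⊕ Fin n) = .inr ⟨n - k, by omega⟩ := by
  rw [Equiv.symm_apply_eq]; ext; simp; omega

theorem entry_one_one (hk : 0 < numHeavy n δ) :
    (toBlockTable A).entry 1 1 = (A (.inl ⟨0, hk⟩) (.inl ⟨0, hk⟩) : ℝ) := by
  rw [BlockTable.entry, dif_pos (by omega), toBlockTable, finSumFinEquiv_symm_of_lt hk]

theorem entry_one_light (hk : 0 < numHeavy n δ) (hkn : numHeavy n δ ≤ n) :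
    (toBlockTable A).entry 1 (n + 1)
      = (A (.inl ⟨0, hk⟩) (.inr ⟨n - numHeavy n δ, by omega⟩) : ℝ) := by
  rw [BlockTable.entry, dif_pos (by omega), toBlockTable, finSumFinEquiv_symm_of_lt hk,
    finSumFinEquiv_symm_light hk hkn]

theorem entry_light_light (hk : 0 < numHeavy n δ) (hkn : numHeavy n δ ≤ n) :
    (toBlockTable A).entry (n + 1) (n + 1)
      = (A (.inr ⟨n - numHeavy n δ, by omega⟩) (.inr ⟨n - numHeavy n δ, by omega⟩) : ℝ) := by
  rw [BlockTable.entry, dif_pos (by omega), toBlockTable, finSumFinEquiv_symm_light hk hkn]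

end

theorem numHeavy_le_rpow (n : ℕ) (δ : ℝ) : (numHeavy n δ : ℝ) ≤ (n : ℝ) ^ δ :=
  Nat.floor_le (by positivity)

theorem rpow_sub_one_lt_numHeavy (n : ℕ) (δ : ℝ) : (n : ℝ) ^ δ - 1 < numHeavy n δ :=
  Nat.sub_one_lt_floor _

theorem numHeavy_pos {n : ℕ} {δ : ℝ} (hn : 0 < n) (hδ : 0 ≤ δ) : 0 < numHeavy n δ :=
  Nat.floor_pos.2 (Real.one_le_rpow (by exact_mod_cast hn) hδ)

theorem rpow_le_two_mul_numHeavy {n : ℕ} {δ : ℝ} (hn : 0 < n) (hδ : 0 ≤ δ) :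
    (n : ℝ) ^ δ ≤ 2 * numHeavy n δ := by
  have h1 := rpow_sub_one_lt_numHeavy n δ
  have h2 : (1 : ℝ) ≤ numHeavy n δ := by exact_mod_cast numHeavy_pos hn hδ
  linarith

theorem numHeavy_le {n : ℕ} {δ : ℝ} (hn : 0 < n) (hδ : δ ≤ 1) : numHeavy n δ ≤ n := by
  have h1 := numHeavy_le_rpow n δ
  have h2 : (n : ℝ) ^ δ ≤ (n : ℝ) ^ (1 : ℝ) :=
    Real.rpow_le_rpow_of_exponent_le (by exact_mod_cast hn) hδ
  rw [Real.rpow_one] at h2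
  exact_mod_cast h1.trans h2

theorem numHeavy_div_le {n : ℕ} {δ : ℝ} (hn : 0 < n) :
    (numHeavy n δ : ℝ) / n ≤ (n : ℝ) ^ (δ - 1) := by
  have hn' : (0 : ℝ) < n := by exact_mod_cast hn
  rw [Real.rpow_sub_one hn'.ne']
  gcongr
  exact numHeavy_le_rpow n δ

theorem linearMargins_numHeavy {B C : ℝ} (hB : 0 < B) (hC : 0 < C) {n : ℕ} {δ : ℝ} (hn : 0 < n)
    (hδ : 0 ≤ δ) : LinearMargins B C (numHeavy n δ) n ⌊B * C * n⌋₊ ⌊C * n⌋₊ :=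
  ⟨numHeavy_pos hn hδ, hn, Nat.floor_le (by positivity), (Nat.sub_one_lt_floor _).le,
    Nat.floor_le (by positivity), (Nat.sub_one_lt_floor _).le⟩

section
variable {B C : ℝ} {n : ℕ} {δ : ℝ}

/-- The mean of a heavy row. -/
theorem integral_heavy_row (hn : 0 < n) (hδ0 : 0 ≤ δ) (hδ1 : δ ≤ 1) :
    numHeavy n δ * (∫ X, X.entry 1 1 ∂uniformTable n δ B C)
      + n * (∫ X, X.entry 1 (n + 1) ∂uniformTable n δ B C) = ⌊B * C * n⌋₊ := by
  have hk := numHeavy_pos hn hδ0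
  have hkn := numHeavy_le hn hδ1
  rw [integral_uniformTable, integral_uniformTable]
  simp only [entry_one_one _ hk, entry_one_light _ hk hkn]
  have := tabAvg_heavy_row (U := Fin (numHeavy n δ)) (V := Fin n) ⌊B * C * n⌋₊ ⌊C * n⌋₊
    ⟨0, hk⟩ ⟨0, hk⟩ ⟨n - numHeavy n δ, by omega⟩
  simpa using this

/-- The mean of a light column. -/
theorem integral_light_column (hn : 0 < n) (hδ0 : 0 ≤ δ) (hδ1 : δ ≤ 1) :
    numHeavy n δ * (∫ X, X.entry 1 (n + 1) ∂uniformTable n δ B C)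
      + n * (∫ X, X.entry (n + 1) (n + 1) ∂uniformTable n δ B C) = ⌊C * n⌋₊ := by
  have hk := numHeavy_pos hn hδ0
  have hkn := numHeavy_le hn hδ1
  rw [integral_uniformTable, integral_uniformTable]
  simp only [entry_light_light _ hk hkn, entry_one_light _ hk hkn]
  have := tabAvg_light_column (U := Fin (numHeavy n δ)) (V := Fin n) ⌊B * C * n⌋₊ ⌊C * n⌋₊
    ⟨0, hk⟩ ⟨n - numHeavy n δ, by omega⟩ ⟨n - numHeavy n δ, by omega⟩
  simpa using this

theorem integral_entry_nonneg (i j : ℕ) : 0 ≤ ∫ X, X.entry i j ∂uniformTable n δ B C := by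
  refine integral_nonneg fun X => ?_
  simp only [BlockTable.entry, Pi.zero_apply]
  split_ifs <;> positivity

theorem tabAvg_heavySum_eq (hn : 0 < n) (hδ0 : 0 ≤ δ) :
    tabAvg (U := Fin (numHeavy n δ)) (V := Fin n) ⌊B * C * n⌋₊ ⌊C * n⌋₊
        (fun A => (heavySum A : ℝ))
      = numHeavy n δ * numHeavy n δ * ∫ X, X.entry 1 1 ∂uniformTable n δ B C := by
  have hk := numHeavy_pos hn hδ0
  rw [integral_uniformTable]
  simp only [entry_one_one _ hk]
  have := tabAvg_sum_heavy (U := Fin (numHeavy n δ)) (V := Fin n) ⌊B * C * n⌋₊ ⌊C * n⌋₊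
    (fun m => (m : ℝ)) ⟨0, hk⟩ ⟨0, hk⟩
  rw [Fintype.card_fin] at this
  rw [← this]
  refine tabAvg_congr fun A _ => ?_
  rw [heavySum]; push_cast; rfl

theorem max_sub_le_natCast_sub (m : ℕ) {x : ℝ} (hx : 0 ≤ x) :
    max ((m : ℝ) - x) 0 ≤ ((m - ⌊x⌋₊ : ℕ) : ℝ) := by
  refine max_le ?_ (Nat.cast_nonneg _)
  have h1 := Nat.floor_le hx
  have h2 : (m : ℝ) ≤ ((m - ⌊x⌋₊ : ℕ) : ℝ) + ⌊x⌋₊ := by exact_mod_cast (by omega : m ≤ m - ⌊x⌋₊ + ⌊x⌋₊)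
  linarith

theorem integral_heavy_excess_le (hn : 0 < n) (hδ0 : 0 ≤ δ) {x : ℝ} (hx : 0 ≤ x) :
    numHeavy n δ * numHeavy n δ * ∫ X, max (X.entry 1 1 - x) 0 ∂uniformTable n δ B C
      ≤ tabAvg (U := Fin (numHeavy n δ)) (V := Fin n) ⌊B * C * n⌋₊ ⌊C * n⌋₊
        (fun A => (heavyExcess ⌊x⌋₊ A : ℝ)) := by
  have hk := numHeavy_pos hn hδ0
  rw [integral_uniformTable]
  simp only [entry_one_one _ hk]
  have := tabAvg_sum_heavy (U := Fin (numHeavy n δ)) (V := Fin n) ⌊B * C * n⌋₊ ⌊C * n⌋₊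
    (fun m => max ((m : ℝ) - x) 0) ⟨0, hk⟩ ⟨0, hk⟩
  rw [Fintype.card_fin] at this
  rw [← this]
  refine tabAvg_mono fun A _ => ?_
  rw [heavyExcess]; push_cast
  exact Finset.sum_le_sum fun i _ => by exact_mod_cast max_sub_le_natCast_sub _ hx

theorem integral_side_excess_le (hn : 0 < n) (hδ0 : 0 ≤ δ) (hδ1 : δ ≤ 1) {x : ℝ} (hx : 0 ≤ x) :
    numHeavy n δ * n * ∫ X, max (X.entry 1 (n + 1) - x) 0 ∂uniformTable n δ B C
      ≤ tabAvg (U := Fin (numHeavy n δ)) (V := Fin n) ⌊B * C * n⌋₊ ⌊C * n⌋₊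
        (fun A => (sideExcess ⌊x⌋₊ A : ℝ)) := by
  have hk := numHeavy_pos hn hδ0
  have hkn := numHeavy_le hn hδ1
  rw [integral_uniformTable]
  simp only [entry_one_light _ hk hkn]
  have := tabAvg_sum_side (U := Fin (numHeavy n δ)) (V := Fin n) ⌊B * C * n⌋₊ ⌊C * n⌋₊
    (fun m => max ((m : ℝ) - x) 0) ⟨0, hk⟩ ⟨n - numHeavy n δ, by omega⟩
  rw [Fintype.card_fin, Fintype.card_fin] at this
  rw [← this]
  refine tabAvg_mono fun A _ => ?_
  rw [sideExcess]; push_cast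
  exact Finset.sum_le_sum fun i _ => by exact_mod_cast max_sub_le_natCast_sub _ hx

theorem integral_max_nonneg (i j : ℕ) (x : ℝ) :
    0 ≤ ∫ X, max (X.entry i j - x) 0 ∂uniformTable n δ B C :=
  integral_nonneg fun _ => le_max_right _ _

/-- Truncated means reduce to full means and excesses by min(X, x) = X - (X - x)⁺. -/
theorem integral_min_entry (i j : ℕ) (x : ℝ) :
    ∫ X, min (X.entry i j) x ∂uniformTable n δ B C
      = (∫ X, X.entry i j ∂uniformTable n δ B C)
        - ∫ X, max (X.entry i j - x) 0 ∂uniformTable n δ B C := by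
  rw [integral_uniformTable, integral_uniformTable, integral_uniformTable, ← tabAvg_sub]
  refine tabAvg_congr fun A _ => ?_
  rcases le_total ((toBlockTable A).entry i j) x with h | h
  · rw [min_eq_left h, max_eq_right (by linarith)]; ring
  · rw [min_eq_right h, max_eq_left (by linarith)]; ring

end

/-! ### Negligibility of the error terms -/

theorem tendsto_natCast_rpow_of_neg {a : ℝ} (ha : a < 0) :
    Tendsto (fun n : ℕ => (n : ℝ) ^ a) atTop (𝓝 0) := by
  have := (tendsto_rpow_neg_atTop (neg_pos.2 ha)).comp tendsto_natCast_atTop_atTop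
  simpa using! this

theorem eventually_mul_rpow_le {a : ℝ} (ha : a < 0) (K : ℝ) {e : ℝ} (he : 0 < e) :
    ∀ᶠ n : ℕ in atTop, K * (n : ℝ) ^ a ≤ e := by
  have h := (tendsto_natCast_rpow_of_neg ha).const_mul K
  rw [mul_zero] at h
  exact h.eventually_le_const he

/-- Factors of order `n ^ O(n)` are negligible against `exp (-c n ^ (1 + ε))`. -/
theorem eventually_pow_mul_exp_le {c ε : ℝ} (hc : 0 < c) (hε : 0 < ε) :
    ∀ᶠ n : ℕ in atTop, ∀ s : ℝ, c * (n : ℝ) ^ (1 + ε) ≤ s →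
      (n : ℝ) ^ 9 * ((n : ℝ) ^ 3) ^ (4 * n) * Real.exp (1 - s) ≤ 1 := by
  -- For n ≥ 3 one has 1 + (9 + 12 n) log n ≤ 22 n log n, with room to spare.
  have h1 := (isLittleO_log_rpow_atTop hε).def (c := c / 22) (by positivity)
  filter_upwards [tendsto_natCast_atTop_atTop.eventually h1, eventually_ge_atTop 3] with n hn hn3
  intro s hs
  have hn' : (3 : ℝ) ≤ n := by exact_mod_cast hn3
  have hlog : 1 ≤ Real.log n := by
    rw [Real.le_log_iff_exp_le (by linarith)]
    have := Real.exp_one_lt_d9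
    linarith
  rw [Real.norm_of_nonneg (by linarith), Real.norm_of_nonneg (by positivity)] at hn
  have e : (n : ℝ) ^ 9 * ((n : ℝ) ^ 3) ^ (4 * n) = Real.exp ((9 + 12 * n) * Real.log n) := by
    rw [← pow_mul, ← pow_add, ← Real.rpow_natCast, Real.rpow_def_of_pos (by linarith)]
    congr 1
    push_cast
    ring
  rw [e, ← Real.exp_add, Real.exp_le_one_iff]
  have h2 : (n : ℝ) ^ (1 + ε) = n * (n : ℝ) ^ ε := by
    rw [Real.rpow_add (by linarith), Real.rpow_one]
  have h3 : n * Real.log n * 22 ≤ s := by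
    calc n * Real.log n * 22 ≤ n * (c / 22 * (n : ℝ) ^ ε) * 22 := by gcongr
      _ = c * (n : ℝ) ^ (1 + ε) := by rw [h2]; ring
      _ ≤ s := hs
  have h4 : 3 * Real.log n ≤ n * Real.log n := by gcongr
  linarith

section
variable {B C δ : ℝ}

/-- The total sums are O(n²), hence eventually below n³, and the exponent 2(k + n) is at most 4n. -/
theorem eventually_margin_bounds (hB : 0 < B) (hC : 0 < C) (hδ0 : 0 ≤ δ) (hδ1 : δ ≤ 1) :
    ∀ᶠ n : ℕ in atTop,
      marginCount (numHeavy n δ) n ⌊B * C * n⌋₊ ⌊C * n⌋₊ ≤ ((n : ℝ) ^ 3) ^ (4 * n) ∧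
      ∀ m : ℕ, m ≤ n * n → (numHeavy n δ : ℝ) * ⌊B * C * n⌋₊ + m + 1 ≤ (n : ℝ) ^ 3 := by
  filter_upwards [eventually_ge_atTop ⌈B * C + C + 2⌉₊, eventually_ge_atTop 1] with n hn hn1
  have hn' : B * C + C + 2 ≤ n := (Nat.le_ceil _).trans (by exact_mod_cast hn)
  have hn1' : (1 : ℝ) ≤ n := by exact_mod_cast hn1
  have hkn : (numHeavy n δ : ℝ) ≤ n := by exact_mod_cast numHeavy_le hn1 hδ1
  have hm := linearMargins_numHeavy hB hC hn1 hδ0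
  have h1 : (numHeavy n δ : ℝ) * ⌊B * C * n⌋₊ ≤ n * (B * C * n) := by
    gcongr; exact hm.p_le
  have h2 : (n : ℝ) * ⌊C * n⌋₊ ≤ n * (C * n) := by gcongr; exact hm.q_le
  have h3 : (n : ℝ) * n * (B * C + C + 2) ≤ n * n * n := by gcongr
  have h4 : (1 : ℝ) ≤ n * n := by nlinarith
  have h5 : 0 < C * (n * n) := by positivity
  constructor
  · unfold marginCount
    have hbase : ((numHeavy n δ * ⌊B * C * n⌋₊ + n * ⌊C * n⌋₊ + 1 : ℕ) : ℝ) ≤ (n : ℝ) ^ 3 := by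
      push_cast
      linarith
    refine (pow_le_pow_left₀ (Nat.cast_nonneg _) hbase _).trans ?_
    refine pow_le_pow_right₀ (one_le_pow₀ hn1') ?_
    have := numHeavy_le hn1 hδ1
    omega
  · intro m hmn
    have : (m : ℝ) ≤ n * n := by exact_mod_cast hmn
    linarith

/-- A tail exponent of order n^{1+ε} outweighs the n^{O(n)} margins; this threshold dictates the
width of all windows below. -/
theorem eventually_tail_error_le (hB : 0 < B) (hC : 0 < C) (hδ0 : 0 ≤ δ) (hδ1 : δ ≤ 1)
    {c ε : ℝ} (hc : 0 < c) (hε : 0 < ε) :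
    ∀ᶠ n : ℕ in atTop, ∀ s : ℝ, c * (n : ℝ) ^ (1 + ε) ≤ s →
      (numHeavy n δ : ℝ) * ⌊B * C * n⌋₊ * (marginCount (numHeavy n δ) n ⌊B * C * n⌋₊ ⌊C * n⌋₊
        * ((numHeavy n δ * ⌊B * C * n⌋₊ + 1) * Real.exp (1 - s))) ≤ 1 := by
  filter_upwards [eventually_margin_bounds hB hC hδ0 hδ1, eventually_pow_mul_exp_le hc hε,
    eventually_ge_atTop 1] with n hb hg hn1
  intro s hs
  have hn1' : (1 : ℝ) ≤ n := by exact_mod_cast hn1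
  have h0 := hb.2 0 (Nat.zero_le _)
  have hkp : (0 : ℝ) ≤ numHeavy n δ * ⌊B * C * n⌋₊ := by positivity
  push_cast at h0
  have hmc := marginCount_nonneg (numHeavy n δ) n ⌊B * C * n⌋₊ ⌊C * n⌋₊
  calc _ ≤ (n : ℝ) ^ 3 * (((n : ℝ) ^ 3) ^ (4 * n) * ((n : ℝ) ^ 3 * Real.exp (1 - s))) := by
        gcongr
        · linarith
        · exact hb.1
        · linarith
    _ = (n : ℝ) ^ 6 * ((n : ℝ) ^ 3) ^ (4 * n) * Real.exp (1 - s) := by ring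
    _ ≤ (n : ℝ) ^ 9 * ((n : ℝ) ^ 3) ^ (4 * n) * Real.exp (1 - s) := by
        gcongr
        norm_num
    _ ≤ 1 := hg s hs

/-- A geometric variable exceeds n^α with probability far below n⁻², so the exponential factor of
`excessBound` stays bounded for blocks of at most n² entries. -/
theorem eventually_sq_mul_pow_floor_le {K α : ℝ} (hK : 0 < K) (hα : 0 < α) :
    ∀ᶠ n : ℕ in atTop,
      (n : ℝ) * n * (2 * (1 + K) * (K / (1 + K)) ^ ⌊(n : ℝ) ^ α⌋₊) ≤ 1 := by
  set q := K / (1 + K) with hq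
  have hq0 : 0 < q := by positivity
  have hq1 : q < 1 := by rw [hq, div_lt_one (by positivity)]; linarith
  have hl : 0 < -Real.log q := neg_pos.2 (Real.log_neg hq0 hq1)
  have h1 := (isLittleO_exp_neg_mul_rpow_atTop hl (-(2 / α))).def
    (c := q / (2 * (1 + K))) (by positivity)
  have h2 : Tendsto (fun n : ℕ => (n : ℝ) ^ α) atTop atTop :=
    (tendsto_rpow_atTop hα).comp tendsto_natCast_atTop_atTop
  filter_upwards [h2.eventually h1, eventually_ge_atTop 1] with n hn hn1
  have hn1' : (1 : ℝ) ≤ n := by exact_mod_cast hn1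
  rw [Real.norm_of_nonneg (Real.exp_pos _).le, Real.norm_of_nonneg (by positivity),
    ← Real.rpow_mul (by linarith)] at hn
  have e : α * -(2 / α) = -2 := by field_simp
  rw [e] at hn
  have h3 : q ^ ⌊(n : ℝ) ^ α⌋₊ * q ≤ Real.exp (-(-Real.log q) * (n : ℝ) ^ α) := by
    rw [← pow_succ, ← Real.rpow_natCast, Real.rpow_def_of_pos hq0]
    apply Real.exp_le_exp.2
    have := Nat.lt_floor_add_one ((n : ℝ) ^ α)
    push_cast
    nlinarith
  have h4 : (n : ℝ) * n * (n : ℝ) ^ (-2 : ℝ) = 1 := by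
    rw [Real.rpow_neg (by linarith), show (2 : ℝ) = ((2 : ℕ) : ℝ) by norm_num, Real.rpow_natCast]
    field_simp
  have h5 := h3.trans hn
  have h6 : q ^ ⌊(n : ℝ) ^ α⌋₊ ≤ 1 / (2 * (1 + K)) * (n : ℝ) ^ (-2 : ℝ) := by
    have e2 : q / (2 * (1 + K)) * (n : ℝ) ^ (-2 : ℝ) = 1 / (2 * (1 + K)) * (n : ℝ) ^ (-2 : ℝ) * q := by
      ring
    rw [e2] at h5
    exact le_of_mul_le_mul_right h5 hq0
  calc (n : ℝ) * n * (2 * (1 + K) * q ^ ⌊(n : ℝ) ^ α⌋₊)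
      ≤ n * n * (2 * (1 + K) * (1 / (2 * (1 + K)) * (n : ℝ) ^ (-2 : ℝ))) := by gcongr
    _ = n * n * (n : ℝ) ^ (-2 : ℝ) := by field_simp
    _ ≤ 1 := h4.le

theorem eventually_excess_error_le (hB : 0 < B) (hC : 0 < C) (hδ0 : 0 ≤ δ) (hδ1 : δ ≤ 1)
    {K α ε : ℝ} (hK : 0 < K) (hα : 0 < α) (hε : 0 < ε) :
    ∀ᶠ n : ℕ in atTop, ∀ m : ℕ, m ≤ n * n →
      (numHeavy n δ : ℝ) * ⌊B * C * n⌋₊ * (marginCount (numHeavy n δ) n ⌊B * C * n⌋₊ ⌊C * n⌋₊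
        * (excessBound K ⌊(n : ℝ) ^ α⌋₊ m (numHeavy n δ * ⌊B * C * n⌋₊)
          * (1 + 1 / (2 * K)) ^ (-(n : ℝ) ^ (1 + ε)))) ≤ 1 := by
  set x := 1 + 1 / (2 * K) with hx
  have hx1 : 1 < x := by
    have : 0 < 1 / (2 * K) := by positivity
    linarith
  have hlx := Real.log_pos hx1
  filter_upwards [eventually_margin_bounds hB hC hδ0 hδ1, eventually_pow_mul_exp_le hlx hε,
    eventually_sq_mul_pow_floor_le hK hα, eventually_ge_atTop 1] with n hb hg hq hn1
  intro m hmn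
  have hn1' : (1 : ℝ) ≤ n := by exact_mod_cast hn1
  have h0 := hb.2 0 (Nat.zero_le _)
  have h1 := hb.2 m hmn
  have hkp : (0 : ℝ) ≤ numHeavy n δ * ⌊B * C * n⌋₊ := by positivity
  push_cast at h0
  have hmc := marginCount_nonneg (numHeavy n δ) n ⌊B * C * n⌋₊ ⌊C * n⌋₊
  have hexp : (m : ℝ) * (2 * (1 + K) * (K / (1 + K)) ^ ⌊(n : ℝ) ^ α⌋₊) ≤ 1 := by
    refine le_trans ?_ hq
    gcongr
    exact_mod_cast hmn
  have e : x ^ (-(n : ℝ) ^ (1 + ε)) = Real.exp (-(Real.log x * (n : ℝ) ^ (1 + ε))) := by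
    rw [Real.rpow_def_of_pos (by linarith)]; ring_nf
  unfold excessBound
  rw [e]
  push_cast
  calc _ ≤ (n : ℝ) ^ 3 * (((n : ℝ) ^ 3) ^ (4 * n) * ((((n : ℝ) ^ 3) ^ 2 * Real.exp 1)
          * Real.exp (-(Real.log x * (n : ℝ) ^ (1 + ε))))) := by
        gcongr
        · linarith
        · exact hb.1
    _ = (n : ℝ) ^ 9 * ((n : ℝ) ^ 3) ^ (4 * n)
          * Real.exp (1 - Real.log x * (n : ℝ) ^ (1 + ε)) := by
        rw [sub_eq_add_neg, Real.exp_add]; ring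
    _ ≤ 1 := hg _ le_rfl

/-- The total excess over `n ^ α` of the entries in the side block is at most `n ^ (1 + ε)`. -/
theorem eventually_side_excess_le (hB : 0 < B) (hC : 0 < C) (hδ0 : 0 ≤ δ) (hδ1 : δ < 1)
    {α ε : ℝ} (hα : 0 < α) (hε : 0 < ε) :
    ∀ᶠ n : ℕ in atTop, numHeavy n δ * n
      * (∫ X, max (X.entry 1 (n + 1) - (n : ℝ) ^ α) 0 ∂uniformTable n δ B C)
      ≤ (n : ℝ) ^ (1 + ε) + 1 := by
  have hBC : 0 < B * C := by positivity
  filter_upwards [eventually_excess_error_le hB hC hδ0 hδ1.le hBC hα hε, eventually_ge_atTop 1,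
    eventually_mul_rpow_le (by linarith : δ - 1 < 0) (1 + B * C) hC] with n he hn1 hξ
  have hm := linearMargins_numHeavy hB hC hn1 hδ0
  have hpq := hm.mul_le_mul ((mul_le_mul_of_nonneg_left (numHeavy_div_le hn1) (by positivity)).trans
    hξ)
  refine (integral_side_excess_le hn1 hδ0 hδ1.le (by positivity)).trans ?_
  have := tabAvg_sideExcess_le (U := Fin (numHeavy n δ)) (V := Fin n)
    (p := ⌊B * C * n⌋₊) (q := ⌊C * n⌋₊) (by simpa using hpq) (by simpa using hm.k_pos)
    (by rw [Fintype.card_fin]; omega) hBC (by simpa using hm.p_le) ⌊(n : ℝ) ^ α⌋₊ (t := (n : ℝ) ^ (1 + ε))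
    (by positivity)
  refine this.trans ?_
  simp only [Fintype.card_fin]
  have := he (numHeavy n δ * n) (Nat.mul_le_mul_right _ (numHeavy_le hn1 hδ1.le))
  linarith

/-- The sum of the heavy block is at most of order `k ^ 2 + n ^ (1 + ε)` in the subcritical case. -/
theorem subcritical_heavy_le (hB : 0 < B) (hC : 0 < C) (h : B < criticalB C) (hδ0 : 0 ≤ δ)
    (hδ1 : δ < 1) {ε : ℝ} (hε : 0 < ε) :
    ∃ K : ℝ, 0 < K ∧ ∀ᶠ n : ℕ in atTop,
      numHeavy n δ * numHeavy n δ * (∫ X, X.entry 1 1 ∂uniformTable n δ B C)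
        ≤ K * (numHeavy n δ * numHeavy n δ) + 2 * (n : ℝ) ^ (1 + ε) := by
  obtain ⟨c, K, hc0, hc1, hK0, H⟩ := subcritical_decay hB hC h
  have hα := heavyMean_pos hB hC h
  refine ⟨heavyMean B C + 1, by positivity, ?_⟩
  filter_upwards [eventually_tail_error_le hB hC hδ0 hδ1.le hc0 hε, eventually_ge_atTop 1,
    eventually_mul_rpow_le (by linarith : δ - 1 < 0) K one_pos] with n he hn1 hξ
  have hn1' : (1 : ℝ) ≤ n := by exact_mod_cast hn1
  have hm := linearMargins_numHeavy hB hC hn1 hδ0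
  -- For an order of magnitude θ = 1 suffices, and the window n^{1+ε} may exceed k²; hence no lower
  -- bound on δ beyond 0 is needed.
  obtain ⟨hpq, hdec⟩ := H _ _ _ _ hm 1 one_pos le_rfl
    ((mul_le_mul_of_nonneg_left (numHeavy_div_le hn1) hK0.le).trans hξ)
  rw [← tabAvg_heavySum_eq hn1 hδ0]
  rw [mul_one] at hdec
  have := tabAvg_heavySum_le (U := Fin (numHeavy n δ)) (V := Fin n)
    (p := ⌊B * C * n⌋₊) (q := ⌊C * n⌋₊) (by simpa using hpq) hc0.le hc1
    (t := (n : ℝ) ^ (1 + ε)) (by positivity)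
    (x := numHeavy n δ * numHeavy n δ * (heavyMean B C + 1)) (by positivity)
    (by simpa using hdec)
  simp only [Fintype.card_fin] at this
  have h2 := he _ le_rfl
  have h3 : 1 ≤ (n : ℝ) ^ (1 + ε) := Real.one_le_rpow hn1' (by linarith)
  linarith

end

/-! ### Mean entries near the peak -/

section
variable {B C δ : ℝ}

/-- In the supercritical case the mean side entry is close to `criticalB C * C`. -/
theorem supercritical_side (hB : 0 < B) (hC : 0 < C) (h : criticalB C < B) (hδ0 : 0 < δ)
    (hδ1 : δ < 1) {ε : ℝ} (hε : 0 < ε) :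
    ∃ K : ℝ, 0 < K ∧ ∀ᶠ n : ℕ in atTop,
      |(∫ X, X.entry 1 (n + 1) ∂uniformTable n δ B C) - criticalB C * C|
        ≤ K * ((n : ℝ) ^ (δ - 1) + (n : ℝ) ^ (-(δ / 2) + ε)) := by
  obtain ⟨c₁, K₁, θ₁, hc₁0, hc₁1, hK₁0, hθ₁0, H₁⟩ := supercritical_decay hB hC h
  obtain ⟨c₂, K₂, θ₂, hc₂0, hc₂1, hK₂0, hθ₂0, H₂⟩ := supercritical_growth hB hC h
  -- The cap δ/4 keeps -δ/2 + ε' negative, so θ tends to 0.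
  set ε' := min ε (δ / 4) with hε'
  have hε'0 : 0 < ε' := by positivity
  have hε'1 : ε' ≤ δ / 4 := min_le_right _ _
  have hε'2 : ε' ≤ ε := min_le_left _ _
  set θ₀ := min 1 (min θ₁ θ₂) with hθ₀
  have hθ₀0 : 0 < θ₀ := by positivity
  refine ⟨2 * (K₁ + K₂) + 3, by positivity, ?_⟩
  filter_upwards [eventually_tail_error_le hB hC hδ0.le hδ1.le (half_pos hc₁0)
      (by positivity : 0 < 2 * ε'),
    eventually_tail_error_le hB hC hδ0.le hδ1.le (half_pos hc₂0) (by positivity : 0 < 2 * ε'),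
    eventually_ge_atTop 1,
    eventually_mul_rpow_le (by linarith : δ - 1 < 0) (K₁ + K₂) (half_pos hθ₀0),
    eventually_mul_rpow_le (by linarith : -(δ / 2) + ε' < 0) 1 (half_pos hθ₀0)]
    with n he₁ he₂ hn1 hs₁ hs₂
  have hn1' : (1 : ℝ) ≤ n := by exact_mod_cast hn1
  have hn0 : (0 : ℝ) < n := by linarith
  have hm := linearMargins_numHeavy hB hC hn1 hδ0.le
  have hrow := integral_heavy_row (B := B) (C := C) hn1 hδ0.le hδ1.le
  have hsum := tabAvg_heavySum_eq (B := B) (C := C) hn1 hδ0.le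
  have hk1 : (1 : ℝ) ≤ numHeavy n δ := by exact_mod_cast hm.k_pos
  have hkδ := rpow_le_two_mul_numHeavy hn1 hδ0.le
  have hξ := numHeavy_div_le (δ := δ) hn1
  set k := numHeavy n δ
  set p := ⌊B * C * n⌋₊
  set q := ⌊C * n⌋₊
  set y := (n : ℝ) ^ (-(δ / 2) + ε') with hy
  have hy0 : 0 < y := by positivity
  -- The first term dominates the k/n errors in the ratio. The second is chosen with n^δ n y² =
  -- n^{1+2ε'}, so that the tail beats the margin count.
  set θ := (K₁ + K₂) * (n : ℝ) ^ (δ - 1) + y with hθ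
  have hδn0 : 0 < (n : ℝ) ^ (δ - 1) := by positivity
  have hyθ : y ≤ θ := by
    have : 0 ≤ (K₁ + K₂) * (n : ℝ) ^ (δ - 1) := by positivity
    linarith
  have hθ0 : 0 < θ := by positivity
  have hθle : θ ≤ θ₀ := by linarith
  have hθ1 : θ ≤ 1 := hθle.trans (min_le_left _ _)
  have hKξ : (K₁ + K₂) * ((k : ℝ) / n) ≤ θ := by
    have : (K₁ + K₂) * ((k : ℝ) / n) ≤ (K₁ + K₂) * (n : ℝ) ^ (δ - 1) := by gcongr
    linarith
  have hξ0 : 0 ≤ (k : ℝ) / n := by positivity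
  have hKξ₁ : K₁ * ((k : ℝ) / n) ≤ θ := by
    have : 0 ≤ K₂ * ((k : ℝ) / n) := by positivity
    linarith
  have hKξ₂ : K₂ * ((k : ℝ) / n) ≤ θ := by
    have : 0 ≤ K₁ * ((k : ℝ) / n) := by positivity
    linarith
  obtain ⟨hpq, hx₁, hdec⟩ := H₁ _ _ _ _ hm θ hθ0
    (hθle.trans ((min_le_right _ _).trans (min_le_left _ _))) hKξ₁
  obtain ⟨-, hx₂, hgro⟩ := H₂ _ _ _ _ hm θ hθ0
    (hθle.trans ((min_le_right _ _).trans (min_le_right _ _))) hKξ₂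
  have hlarge : ∀ c : ℝ, 0 < c → c / 2 * (n : ℝ) ^ (1 + 2 * ε') ≤ c * θ * (k * n * θ) := by
    intro c hc
    have e : (n : ℝ) ^ (1 + 2 * ε') = (n : ℝ) ^ δ * n * (y * y) := by
      rw [hy, ← Real.rpow_add hn0, ← Real.rpow_add_one hn0.ne', ← Real.rpow_add hn0]
      congr 1; ring
    rw [e]
    calc c / 2 * ((n : ℝ) ^ δ * n * (y * y)) ≤ c / 2 * ((2 * k) * n * (θ * θ)) := by gcongr
      _ = c * θ * (k * n * θ) := by ring
  have hcθ : ∀ c : ℝ, 0 < c → c ≤ 1 → c * θ ≤ 1 := fun c hc hc1 => mul_le_one₀ hc1 hθ0.le hθ1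
  have up := tabAvg_heavySum_le (U := Fin k) (V := Fin n) (p := p) (q := q)
    (by simpa using hpq) (by positivity) (hcθ c₁ hc₁0 hc₁1) (t := k * n * θ) (by positivity)
    hx₁ (by simpa using hdec)
  have lo := le_tabAvg_heavySum (U := Fin k) (V := Fin n) (p := p) (q := q)
    (by simpa using hpq) (by positivity) (hcθ c₂ hc₂0 hc₂1) (t := k * n * θ) (by positivity)
    hx₂ (by
      have : 0 ≤ (k : ℝ) * n * (criticalB C * C + θ) := by
        have := criticalB_pos C
        positivity
      simp only [Fintype.card_fin]
      linarith) (by simpa using hgro)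
  simp only [Fintype.card_fin] at up lo
  rw [hsum] at up lo
  have e₁ := he₁ _ (hlarge c₁ hc₁0)
  have e₂ := he₂ _ (hlarge c₂ hc₂0)
  set hh := ∫ X, X.entry 1 1 ∂uniformTable n δ B C
  set hl := ∫ X, X.entry 1 (n + 1) ∂uniformTable n δ B C
  -- The heavy row identity turns bounds on the heavy block sum into bounds on the side mean.
  have hkrow : (k : ℝ) * k * hh = k * p - k * n * hl := by
    linear_combination (k : ℝ) * hrow
  have hkn : (0 : ℝ) < k * n := by positivity
  have habs : |hl - criticalB C * C| ≤ 2 * θ + 1 / n := by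
    have h1 : (k : ℝ) * n * (1 / n) = k := by field_simp
    rw [abs_le]
    constructor
    · refine le_of_mul_le_mul_left ?_ hkn
      linarith
    · refine le_of_mul_le_mul_left ?_ hkn
      linarith
  have hnδ : 1 / (n : ℝ) ≤ (n : ℝ) ^ (δ - 1) := by
    rw [one_div, ← Real.rpow_neg_one]
    exact Real.rpow_le_rpow_of_exponent_le hn1' (by linarith)
  have hyε : y ≤ (n : ℝ) ^ (-(δ / 2) + ε) :=
    Real.rpow_le_rpow_of_exponent_le hn1' (by linarith)
  have hlast : 0 ≤ (2 * (K₁ + K₂) + 1) * (n : ℝ) ^ (-(δ / 2) + ε) := by positivity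
  rw [hθ] at habs
  linarith

/-- In the subcritical case the mean heavy entry is close to `heavyMean B C`. -/
theorem subcritical_heavy (hB : 0 < B) (hC : 0 < C) (h : B < criticalB C) (hδ0 : 1 / 2 < δ)
    (hδ1 : δ < 1) {ε : ℝ} (hε : 0 < ε) :
    ∃ K : ℝ, 0 < K ∧ ∀ᶠ n : ℕ in atTop,
      |(∫ X, X.entry 1 1 ∂uniformTable n δ B C) - heavyMean B C|
        ≤ K * ((n : ℝ) ^ (δ - 1) + (n : ℝ) ^ (1 / 2 - δ + ε)) := by
  obtain ⟨c₁, K₁, hc₁0, hc₁1, hK₁0, H₁⟩ := subcritical_decay hB hC h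
  obtain ⟨c₂, K₂, hc₂0, hc₂1, hK₂0, H₂⟩ := subcritical_growth hB hC h
  have hα := heavyMean_pos hB hC h
  set ε' := min ε ((δ - 1 / 2) / 2) with hε'
  have hε'0 : 0 < ε' := lt_min hε (by linarith)
  have hε'1 : ε' ≤ (δ - 1 / 2) / 2 := min_le_right _ _
  have hε'2 : ε' ≤ ε := min_le_left _ _
  set θ₀ := min 1 (heavyMean B C) with hθ₀
  have hθ₀0 : 0 < θ₀ := by positivity
  set K := 4 * (K₁ + K₂) with hK
  refine ⟨2 * K + 6, by positivity, ?_⟩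
  filter_upwards [eventually_tail_error_le hB hC (by linarith) hδ1.le
      (by positivity : 0 < c₁ / 4) (by positivity : 0 < 2 * ε'),
    eventually_tail_error_le hB hC (by linarith) hδ1.le (by positivity : 0 < c₂ / 4)
      (by positivity : 0 < 2 * ε'),
    eventually_ge_atTop 1,
    eventually_mul_rpow_le (by linarith : δ - 1 < 0) K (half_pos hθ₀0),
    eventually_mul_rpow_le (by linarith : 1 / 2 - δ + ε' < 0) 1 (half_pos hθ₀0)]
    with n he₁ he₂ hn1 hs₁ hs₂
  have hδ : 0 ≤ δ := by linarith
  have hn1' : (1 : ℝ) ≤ n := by exact_mod_cast hn1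
  have hn0 : (0 : ℝ) < n := by linarith
  have hm := linearMargins_numHeavy hB hC hn1 hδ
  have hsum := tabAvg_heavySum_eq (B := B) (C := C) hn1 hδ
  have hk1 : (1 : ℝ) ≤ numHeavy n δ := by exact_mod_cast hm.k_pos
  have hkδ := rpow_le_two_mul_numHeavy hn1 hδ
  have hξ := numHeavy_div_le (δ := δ) hn1
  set k := numHeavy n δ
  set p := ⌊B * C * n⌋₊
  set q := ⌊C * n⌋₊
  set y := (n : ℝ) ^ (1 / 2 - δ + ε') with hy
  have hy0 : 0 < y := by positivity
  have hδn0 : 0 < (n : ℝ) ^ (δ - 1) := by positivity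
  -- Now the window has width k²θ, and n^{2δ} y² = n^{1+2ε'}; y tends to 0 only because δ > 1/2.
  set θ := K * (n : ℝ) ^ (δ - 1) + y with hθ
  have hK0 : 0 < K := by positivity
  have hyθ : y ≤ θ := by
    have : 0 ≤ K * (n : ℝ) ^ (δ - 1) := by positivity
    linarith
  have hθ0 : 0 < θ := by positivity
  have hθle : θ ≤ θ₀ := by linarith
  have hθ1 : θ ≤ 1 := hθle.trans (min_le_left _ _)
  have hθα : θ ≤ heavyMean B C := hθle.trans (min_le_right _ _)
  -- Since 3δ ≥ 1, the error 1/k² is covered by the term n^(δ-1); this explains the 4 in `K`.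
  have hk2 : 1 / ((k : ℝ) * k) ≤ 4 * (n : ℝ) ^ (δ - 1) := by
    have h1 : (n : ℝ) ^ (2 * δ) ≤ 4 * (k * k) := by
      have e : (n : ℝ) ^ (2 * δ) = (n : ℝ) ^ δ * (n : ℝ) ^ δ := by
        rw [← Real.rpow_add hn0]; congr 1; ring
      rw [e]
      calc (n : ℝ) ^ δ * (n : ℝ) ^ δ ≤ (2 * k) * (2 * k) := by gcongr
        _ = _ := by ring
    have h2 : 1 ≤ (n : ℝ) ^ (2 * δ) * (n : ℝ) ^ (δ - 1) := by
      rw [← Real.rpow_add hn0]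
      exact Real.one_le_rpow hn1' (by linarith)
    rw [div_le_iff₀ (by positivity)]
    have h3 := mul_le_mul_of_nonneg_right h1 hδn0.le
    linarith
  have hle : ∀ L : ℝ, 0 < L → L ≤ K₁ + K₂ → L * ((k : ℝ) / n) ≤ θ ∧ L * (1 / (k * k)) ≤ θ := by
    intro L hL hL'
    have h1 : L * (n : ℝ) ^ (δ - 1) ≤ (K₁ + K₂) * (n : ℝ) ^ (δ - 1) := by gcongr
    have h0 : 0 ≤ L * (n : ℝ) ^ (δ - 1) := by positivity
    constructor
    · have : L * ((k : ℝ) / n) ≤ L * (n : ℝ) ^ (δ - 1) := by gcongr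
      linarith
    · have : L * (1 / ((k : ℝ) * k)) ≤ L * (4 * (n : ℝ) ^ (δ - 1)) := by gcongr
      linarith
  obtain ⟨hpq, hdec⟩ := H₁ _ _ _ _ hm θ hθ0 hθ1 (hle K₁ hK₁0 (by linarith)).1
  obtain ⟨-, hx₂, hgro⟩ := H₂ _ _ _ _ hm θ hθ0 hθ1 (hle K₂ hK₂0 (by linarith)).1
    (hle K₂ hK₂0 (by linarith)).2
  have hlarge : ∀ c : ℝ, 0 < c → c / 4 * (n : ℝ) ^ (1 + 2 * ε') ≤ c * θ * (k * k * θ) := by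
    intro c hc
    have e : (n : ℝ) ^ (1 + 2 * ε') = (n : ℝ) ^ δ * (n : ℝ) ^ δ * (y * y) := by
      rw [hy, ← Real.rpow_add hn0, ← Real.rpow_add hn0, ← Real.rpow_add hn0]
      congr 1; ring
    rw [e]
    calc c / 4 * ((n : ℝ) ^ δ * (n : ℝ) ^ δ * (y * y))
        ≤ c / 4 * ((2 * k) * (2 * k) * (θ * θ)) := by gcongr
      _ = c * θ * (k * k * θ) := by ring
  have hcθ : ∀ c : ℝ, 0 < c → c ≤ 1 → c * θ ≤ 1 := fun c hc hc1 => mul_le_one₀ hc1 hθ0.le hθ1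
  have up := tabAvg_heavySum_le (U := Fin k) (V := Fin n) (p := p) (q := q)
    (by simpa using hpq) (by positivity) (hcθ c₁ hc₁0 hc₁1) (t := k * k * θ) (by positivity)
    (x := k * k * (heavyMean B C + θ)) (by positivity) (by simpa using hdec)
  have lo := le_tabAvg_heavySum (U := Fin k) (V := Fin n) (p := p) (q := q)
    (by simpa using hpq) (by positivity) (hcθ c₂ hc₂0 hc₂1) (t := k * k * θ) (by positivity)
    (x := k * k * (heavyMean B C - θ)) (mul_nonneg (by positivity) (by linarith))
    (by simpa using hx₂) (by simpa using hgro)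
  simp only [Fintype.card_fin] at up lo
  rw [hsum] at up lo
  have e₁ := he₁ _ (hlarge c₁ hc₁0)
  have e₂ := he₂ _ (hlarge c₂ hc₂0)
  set hh := ∫ X, X.entry 1 1 ∂uniformTable n δ B C
  have hkk : (0 : ℝ) < k * k := by positivity
  have habs : |hh - heavyMean B C| ≤ 2 * θ + 1 / (k * k) := by
    have h1 : (k : ℝ) * k * (1 / (k * k)) = 1 := by field_simp
    rw [abs_le]
    constructor
    · refine le_of_mul_le_mul_left ?_ hkk
      linarith
    · refine le_of_mul_le_mul_left ?_ hkk
      linarith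
  have hyε : y ≤ (n : ℝ) ^ (1 / 2 - δ + ε) :=
    Real.rpow_le_rpow_of_exponent_le hn1' (by linarith)
  have hlast : 0 ≤ (2 * K + 4) * (n : ℝ) ^ (1 / 2 - δ + ε) := by positivity
  rw [hθ] at habs
  linarith

/-- The total excess over `n ^ α` of the entries in the heavy block is at most of order
`n ^ (1 + ε)` in the subcritical case. -/
theorem eventually_heavy_excess_le (hB : 0 < B) (hC : 0 < C) (h : B < criticalB C)
    (hδ0 : 1 / 2 < δ) (hδ1 : δ < 1) {α ε : ℝ} (hα : 0 < α) (hε : 0 < ε) :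
    ∀ᶠ n : ℕ in atTop, numHeavy n δ * numHeavy n δ
      * (∫ X, max (X.entry 1 1 - (n : ℝ) ^ α) 0 ∂uniformTable n δ B C)
      ≤ (n : ℝ) ^ (1 + ε) + 2 := by
  obtain ⟨c, K, hc0, hc1, hK0, H⟩ := subcritical_decay hB hC h
  have hμ := heavyMean_pos hB hC h
  have hδ : 0 ≤ δ := by linarith
  have hL : 0 < heavyMean B C + 2 := by linarith
  filter_upwards [eventually_excess_error_le hB hC hδ hδ1.le hL hα hε, eventually_ge_atTop 1,
    eventually_mul_rpow_le (by linarith : δ - 1 < 0) K one_pos,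
    eventually_tail_error_le hB hC hδ hδ1.le (by positivity : 0 < c / 4)
      (by linarith : 0 < 2 * δ - 1)] with n he hn1 hξ het
  have hn1' : (1 : ℝ) ≤ n := by exact_mod_cast hn1
  have hn0 : (0 : ℝ) < n := by linarith
  have hm := linearMargins_numHeavy hB hC hn1 hδ
  obtain ⟨hpq, hdec⟩ := H _ _ _ _ hm 1 one_pos le_rfl
    ((mul_le_mul_of_nonneg_left (numHeavy_div_le hn1) hK0.le).trans hξ)
  rw [mul_one] at hdec
  refine (integral_heavy_excess_le hn1 hδ (by positivity)).trans ?_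
  have hkδ := rpow_le_two_mul_numHeavy hn1 hδ
  have hkn := numHeavy_le hn1 hδ1.le
  have hk0 := hm.k_pos
  set k := numHeavy n δ
  set p := ⌊B * C * n⌋₊
  set q := ⌊C * n⌋₊
  have tail := tabAvg_heavySum_upper_tail (U := Fin k) (V := Fin n) (p := p) (q := q)
    (by simpa using hpq) hc0.le hc1 (t := k * k) (by positivity)
    (x := k * k * (heavyMean B C + 1)) (by positivity) (by simpa using hdec)
  have main := tabAvg_heavyExcess_le (U := Fin k) (V := Fin n) (p := p) (q := q)
    (by simpa using hpq) (by simpa using hk0) hL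
    (z := k * k * (heavyMean B C + 1) + k * k) (by simp only [Fintype.card_fin]; linarith)
    ⌊(n : ℝ) ^ α⌋₊ (t := (n : ℝ) ^ (1 + ε)) (by positivity)
  simp only [Fintype.card_fin] at tail main
  -- The block sum exceeds k²(α + 2), with α = `heavyMean B C`, only with negligible probability:
  -- the tail exponent c k² is of order n^{2δ}, more than n^{1+ε} for some ε > 0.
  have hlarge : c / 4 * (n : ℝ) ^ (1 + (2 * δ - 1)) ≤ c * (k * k) := by
    have e : (n : ℝ) ^ (1 + (2 * δ - 1)) = (n : ℝ) ^ δ * (n : ℝ) ^ δ := by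
      rw [← Real.rpow_add hn0]; congr 1; ring
    rw [e]
    calc c / 4 * ((n : ℝ) ^ δ * (n : ℝ) ^ δ) ≤ c / 4 * ((2 * k) * (2 * k)) := by gcongr
      _ = c * (k * k) := by ring
  have h1 := het _ hlarge
  have h2 := he (k * k) (Nat.mul_le_mul hkn hkn)
  have h3 := (mul_le_mul_of_nonneg_left tail (by positivity : (0 : ℝ) ≤ k * p)).trans h1
  refine main.trans ?_
  linarith

end

/-! ### Assembling the asymptotic statements -/

theorem isBigO_of_eventually_abs_le {f g : ℕ → ℝ} (K : ℝ) (hg : ∀ n, 0 ≤ g n)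
    (h : ∀ᶠ n in atTop, |f n| ≤ K * g n) : f =O[atTop] g :=
  IsBigO.of_bound K (h.mono fun n hn => by
    rwa [Real.norm_eq_abs, Real.norm_of_nonneg (hg n)])

section
variable {B C δ : ℝ}

theorem le_rpow_of_side_sum_le {n : ℕ} (hn : 0 < n) (hδ : 0 ≤ δ) {x ε : ℝ} (hx : 0 ≤ x)
    (h : numHeavy n δ * n * x ≤ 3 * (n : ℝ) ^ (1 + ε)) : x ≤ 6 * (n : ℝ) ^ (-δ + ε) := by
  have hn0 : (0 : ℝ) < n := by exact_mod_cast hn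
  have h1 := rpow_le_two_mul_numHeavy hn hδ
  have h2 : (n : ℝ) ^ δ * n * x ≤ (2 * numHeavy n δ) * n * x := by gcongr
  have h3 : (n : ℝ) ^ (1 + ε) = (n : ℝ) ^ δ * n * (n : ℝ) ^ (-δ + ε) := by
    rw [← Real.rpow_add_one hn0.ne', ← Real.rpow_add hn0]; congr 1; ring
  rw [h3] at h
  have hpos : 0 < (n : ℝ) ^ δ * n := by positivity
  refine le_of_mul_le_mul_left ?_ hpos
  linarith

theorem le_rpow_of_heavy_sum_le {n : ℕ} (hn : 0 < n) (hδ : 0 ≤ δ) {x ε : ℝ} (hx : 0 ≤ x)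
    (h : numHeavy n δ * numHeavy n δ * x ≤ 3 * (n : ℝ) ^ (1 + ε)) :
    x ≤ 12 * (n : ℝ) ^ (1 - 2 * δ + ε) := by
  have hn0 : (0 : ℝ) < n := by exact_mod_cast hn
  have h1 := rpow_le_two_mul_numHeavy hn hδ
  have h2 : (n : ℝ) ^ δ * (n : ℝ) ^ δ * x ≤ (2 * numHeavy n δ) * (2 * numHeavy n δ) * x := by
    gcongr
  have h3 : (n : ℝ) ^ (1 + ε) = (n : ℝ) ^ δ * (n : ℝ) ^ δ * (n : ℝ) ^ (1 - 2 * δ + ε) := by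
    rw [← Real.rpow_add hn0, ← Real.rpow_add hn0]; congr 1; ring
  rw [h3] at h
  have hpos : 0 < (n : ℝ) ^ δ * (n : ℝ) ^ δ := by positivity
  refine le_of_mul_le_mul_left ?_ hpos
  linarith

theorem one_div_natCast_le_rpow {n : ℕ} (hn : 0 < n) {a : ℝ} (ha : -1 ≤ a) :
    1 / (n : ℝ) ≤ (n : ℝ) ^ a := by
  rw [one_div, ← Real.rpow_neg_one]
  exact Real.rpow_le_rpow_of_exponent_le (by exact_mod_cast hn) ha

theorem eventually_side_max_le (hB : 0 < B) (hC : 0 < C) (hδ0 : 0 ≤ δ) (hδ1 : δ < 1)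
    {α ε : ℝ} (hα : 0 < α) (hε : 0 < ε) :
    ∀ᶠ n : ℕ in atTop,
      ∫ X, max (X.entry 1 (n + 1) - (n : ℝ) ^ α) 0 ∂uniformTable n δ B C
        ≤ 6 * (n : ℝ) ^ (-δ + ε) := by
  filter_upwards [eventually_side_excess_le hB hC hδ0 hδ1 hα hε, eventually_ge_atTop 1]
    with n h hn1
  refine le_rpow_of_side_sum_le hn1 hδ0 (integral_max_nonneg _ _ _) (h.trans ?_)
  have : 1 ≤ (n : ℝ) ^ (1 + ε) := Real.one_le_rpow (by exact_mod_cast hn1) (by linarith)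
  linarith

theorem eventually_heavy_max_le (hB : 0 < B) (hC : 0 < C) (h : B < criticalB C)
    (hδ0 : 1 / 2 < δ) (hδ1 : δ < 1) {α ε : ℝ} (hα : 0 < α) (hε : 0 < ε) :
    ∀ᶠ n : ℕ in atTop, ∫ X, max (X.entry 1 1 - (n : ℝ) ^ α) 0 ∂uniformTable n δ B C
      ≤ 12 * (n : ℝ) ^ (1 - 2 * δ + ε) := by
  filter_upwards [eventually_heavy_excess_le hB hC h hδ0 hδ1 hα hε, eventually_ge_atTop 1]
    with n h hn1
  refine le_rpow_of_heavy_sum_le hn1 (by linarith) (integral_max_nonneg _ _ _) (h.trans ?_)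
  have : 1 ≤ (n : ℝ) ^ (1 + ε) := Real.one_le_rpow (by exact_mod_cast hn1) (by linarith)
  linarith

/-- The mean heavy entry in the subcritical case. -/
theorem subcritical_heavy_entry_le (hB : 0 < B) (hC : 0 < C) (h : B < criticalB C) (hδ0 : 0 ≤ δ)
    (hδ1 : δ < 1) {ε : ℝ} (hε : 0 < ε) :
    ∃ K : ℝ, 0 < K ∧ ∀ᶠ n : ℕ in atTop, ∫ X, X.entry 1 1 ∂uniformTable n δ B C
      ≤ K * (1 + (n : ℝ) ^ (1 - 2 * δ + ε)) := by
  obtain ⟨K, hK0, hK⟩ := subcritical_heavy_le hB hC h hδ0 hδ1 hε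
  refine ⟨K + 12, by positivity, ?_⟩
  filter_upwards [hK, eventually_ge_atTop 1] with n hn hn1
  have hpos : 0 < (n : ℝ) ^ (1 - 2 * δ + ε) := by
    have : (0 : ℝ) < n := by exact_mod_cast hn1
    positivity
  set hh := ∫ X, X.entry 1 1 ∂uniformTable n δ B C
  have hprod : 0 < K * (n : ℝ) ^ (1 - 2 * δ + ε) := by positivity
  rcases le_total hh K with hle | hle
  · linarith
  · have h1 : 0 < (n : ℝ) ^ (1 + ε) := by
      have : (0 : ℝ) < n := by exact_mod_cast hn1
      positivity
    have := le_rpow_of_heavy_sum_le (x := hh - K) (ε := ε) hn1 hδ0 (by linarith) (by linarith)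
    linarith

/-- The share of the heavy block in a heavy row, measured by `n ^ (δ - 1)` instead of `k / n`. -/
theorem abs_side_add_heavy_le (hB : 0 < B) (hC : 0 < C) {n : ℕ} (hn : 0 < n) (hδ0 : 0 ≤ δ)
    (hδ1 : δ ≤ 1) :
    |B * C - (n : ℝ) ^ (δ - 1) * (∫ X, X.entry 1 1 ∂uniformTable n δ B C)
      - ∫ X, X.entry 1 (n + 1) ∂uniformTable n δ B C|
      ≤ (n : ℝ) ^ (δ - 1) + 2 * (B * C) * (n : ℝ) ^ (-δ) := by
  have hn0 : (0 : ℝ) < n := by exact_mod_cast hn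
  have hm := linearMargins_numHeavy hB hC hn hδ0
  have hrow := integral_heavy_row (B := B) (C := C) hn hδ0 hδ1
  have hkδ := rpow_le_two_mul_numHeavy hn hδ0
  have hk2 := rpow_sub_one_lt_numHeavy n δ
  have hk3 := numHeavy_le_rpow n δ
  have hhn := integral_entry_nonneg (n := n) (δ := δ) (B := B) (C := C) 1 1
  have hln := integral_entry_nonneg (n := n) (δ := δ) (B := B) (C := C) 1 (n + 1)
  have hinv := one_div_natCast_le_rpow hn (by linarith : -1 ≤ δ - 1)
  have hp1 := hm.p_le
  have hp2 := hm.le_p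
  set k := numHeavy n δ
  set p := ⌊B * C * n⌋₊
  set hh := ∫ X, X.entry 1 1 ∂uniformTable n δ B C
  set hl := ∫ X, X.entry 1 (n + 1) ∂uniformTable n δ B C
  have e1 : (n : ℝ) ^ (δ - 1) * n = (n : ℝ) ^ δ := by
    rw [← Real.rpow_add_one hn0.ne']; congr 1; ring
  have e2 : (n : ℝ) ^ δ * (n : ℝ) ^ (-δ) = 1 := by
    rw [← Real.rpow_add hn0]; simp
  have hδpos : 0 < (n : ℝ) ^ (-δ) := by positivity
  -- Crude bound from the row sum, hh ≤ BCn/k. It suffices because n^δ and k differ by less than 1.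
  have hhle : hh ≤ 2 * (B * C) * (n : ℝ) ^ (-δ) * n := by
    have h1 : k * hh ≤ B * C * n := by
      have : 0 ≤ (n : ℝ) * hl := by positivity
      linarith
    have h2 : (n : ℝ) ^ δ * hh ≤ 2 * (B * C * n) := by
      calc (n : ℝ) ^ δ * hh ≤ 2 * k * hh := by gcongr
        _ ≤ 2 * (B * C * n) := by linarith
    calc hh = (n : ℝ) ^ δ * (n : ℝ) ^ (-δ) * hh := by rw [e2, one_mul]
      _ = (n : ℝ) ^ (-δ) * ((n : ℝ) ^ δ * hh) := by ring
      _ ≤ (n : ℝ) ^ (-δ) * (2 * (B * C * n)) := by gcongr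
      _ = _ := by ring
  have e3 : (B * C - (n : ℝ) ^ (δ - 1) * hh - hl) * n
      = (B * C * n - p) - ((n : ℝ) ^ δ - k) * hh := by
    rw [← e1]; linear_combination -hrow
  have h4 : ((n : ℝ) ^ δ - k) * hh ≤ 1 * hh := by gcongr; linarith
  have h5 : 0 ≤ ((n : ℝ) ^ δ - k) * hh := mul_nonneg (by linarith) hhn
  have h6 : 1 ≤ (n : ℝ) ^ (δ - 1) * n := by rwa [div_le_iff₀ hn0] at hinv
  have h7 : 0 ≤ 2 * (B * C) * (n : ℝ) ^ (-δ) * n := by positivity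
  have h8 : 0 ≤ (n : ℝ) ^ (δ - 1) * n := by positivity
  rw [abs_le]
  constructor
  · refine le_of_mul_le_mul_right ?_ hn0
    rw [e3]
    linarith
  · refine le_of_mul_le_mul_right ?_ hn0
    rw [e3]
    linarith

/-- No concentration is needed: the row identity bounds the side mean by BC, and in a light column
the k side entries shift the light mean by at most BC · k/n. -/
theorem isBigO_light_entry (hB : 0 < B) (hC : 0 < C) (hδ0 : 0 ≤ δ) (hδ1 : δ ≤ 1) {ε : ℝ}
    (hε : 0 < ε) :
    (fun n : ℕ => (∫ X, X.entry (n + 1) (n + 1) ∂uniformTable n δ B C) - C)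
      =O[atTop] fun n : ℕ => (n : ℝ) ^ (δ - 1 + ε) := by
  refine isBigO_of_eventually_abs_le (1 + B * C) (fun n => by positivity) ?_
  filter_upwards [eventually_ge_atTop 1] with n hn1
  have hn1' : (1 : ℝ) ≤ n := by exact_mod_cast hn1
  have hn0 : (0 : ℝ) < n := by linarith
  have hm := linearMargins_numHeavy hB hC hn1 hδ0
  have hrow := integral_heavy_row (B := B) (C := C) hn1 hδ0 hδ1
  have hcol := integral_light_column (B := B) (C := C) hn1 hδ0 hδ1
  have hhn := integral_entry_nonneg (n := n) (δ := δ) (B := B) (C := C) 1 1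
  have hln := integral_entry_nonneg (n := n) (δ := δ) (B := B) (C := C) 1 (n + 1)
  have hξ := numHeavy_div_le (δ := δ) hn1
  have hinv := one_div_natCast_le_rpow hn1 (by linarith : -1 ≤ δ - 1)
  have hmono : (n : ℝ) ^ (δ - 1) ≤ (n : ℝ) ^ (δ - 1 + ε) :=
    Real.rpow_le_rpow_of_exponent_le hn1' (by linarith)
  set hh := ∫ X, X.entry 1 1 ∂uniformTable n δ B C
  set hl := ∫ X, X.entry 1 (n + 1) ∂uniformTable n δ B C
  set ll := ∫ X, X.entry (n + 1) (n + 1) ∂uniformTable n δ B C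
  have hl_le : hl ≤ B * C := by
    have h1 : 0 ≤ (numHeavy n δ : ℝ) * hh := by positivity
    have h2 := hm.p_le
    refine le_of_mul_le_mul_left ?_ hn0
    linarith
  have e : ll - C = ((⌊C * n⌋₊ : ℝ) - C * n) / n - numHeavy n δ / n * hl := by
    field_simp
    linear_combination hcol
  have h1 : (-1 : ℝ) / n ≤ ((⌊C * n⌋₊ : ℝ) - C * n) / n := by
    gcongr; have := hm.le_q; linarith
  have h2 : ((⌊C * n⌋₊ : ℝ) - C * n) / n ≤ 0 := by
    have := hm.q_le
    exact div_nonpos_of_nonpos_of_nonneg (by linarith) hn0.le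
  have h3 : (numHeavy n δ : ℝ) / n * hl ≤ (n : ℝ) ^ (δ - 1) * (B * C) := by gcongr
  have h4 : 0 ≤ (numHeavy n δ : ℝ) / n * hl := by positivity
  have h5 : (-1 : ℝ) / n = -(1 / n) := by ring
  have h6 : (1 + B * C) * (n : ℝ) ^ (δ - 1) ≤ (1 + B * C) * (n : ℝ) ^ (δ - 1 + ε) := by gcongr
  have h7 : 0 ≤ (n : ℝ) ^ (δ - 1) := by positivity
  have h8 : 0 ≤ (1 + B * C) * (n : ℝ) ^ (δ - 1 + ε) := by positivity
  rw [e, abs_le]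
  constructor <;> linarith

theorem isBigO_heavy_entry_subcritical (hB : 0 < B) (hC : 0 < C) (h : B < criticalB C)
    (hδ0 : 0 < δ) (hδ1 : δ < 1) {ε : ℝ} (hε : 0 < ε) :
    (fun n : ℕ => (n : ℝ) ^ (δ - 1) * ∫ X, X.entry 1 1 ∂uniformTable n δ B C)
      =O[atTop] fun n : ℕ => (n : ℝ) ^ (δ - 1) + (n : ℝ) ^ (-δ + ε) := by
  obtain ⟨K, hK0, hK⟩ := subcritical_heavy_entry_le hB hC h hδ0.le hδ1 hε
  refine isBigO_of_eventually_abs_le K (fun n => by positivity) ?_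
  filter_upwards [hK, eventually_ge_atTop 1] with n hn hn1
  have hn0 : (0 : ℝ) < n := by exact_mod_cast hn1
  have hhn := integral_entry_nonneg (n := n) (δ := δ) (B := B) (C := C) 1 1
  have e : (n : ℝ) ^ (-δ + ε) = (n : ℝ) ^ (δ - 1) * (n : ℝ) ^ (1 - 2 * δ + ε) := by
    rw [← Real.rpow_add hn0]; congr 1; ring
  rw [abs_of_nonneg (by positivity), e]
  calc _ ≤ (n : ℝ) ^ (δ - 1) * (K * (1 + (n : ℝ) ^ (1 - 2 * δ + ε))) := by gcongr
    _ = _ := by ring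

/-- The row identity reduces the side mean to BC minus n^{δ-1} times the heavy mean, and that
product is small. -/
theorem isBigO_side_entry_subcritical (hB : 0 < B) (hC : 0 < C) (h : B < criticalB C)
    (hδ0 : 0 < δ) (hδ1 : δ < 1) {ε : ℝ} (hε : 0 < ε) :
    (fun n : ℕ => (∫ X, X.entry 1 (n + 1) ∂uniformTable n δ B C) - B * C)
      =O[atTop] fun n : ℕ => (n : ℝ) ^ (δ - 1) + (n : ℝ) ^ (-(δ / 2) + ε) := by
  obtain ⟨K, hK0, hK⟩ := subcritical_heavy_entry_le hB hC h hδ0.le hδ1 hε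
  refine isBigO_of_eventually_abs_le (K + 1 + 2 * (B * C)) (fun n => by positivity) ?_
  filter_upwards [hK, eventually_ge_atTop 1] with n hn hn1
  have hn1' : (1 : ℝ) ≤ n := by exact_mod_cast hn1
  have hn0 : (0 : ℝ) < n := by linarith
  have hhn := integral_entry_nonneg (n := n) (δ := δ) (B := B) (C := C) 1 1
  have habs := abs_side_add_heavy_le (δ := δ) hB hC hn1 hδ0.le hδ1.le
  have e : (n : ℝ) ^ (-δ + ε) = (n : ℝ) ^ (δ - 1) * (n : ℝ) ^ (1 - 2 * δ + ε) := by
    rw [← Real.rpow_add hn0]; congr 1; ring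
  have h1 : (n : ℝ) ^ (-δ + ε) ≤ (n : ℝ) ^ (-(δ / 2) + ε) :=
    Real.rpow_le_rpow_of_exponent_le hn1' (by linarith)
  have h2 : (n : ℝ) ^ (-δ) ≤ (n : ℝ) ^ (-(δ / 2) + ε) :=
    Real.rpow_le_rpow_of_exponent_le hn1' (by linarith)
  have h3 : (n : ℝ) ^ (δ - 1) * (∫ X, X.entry 1 1 ∂uniformTable n δ B C)
      ≤ K * ((n : ℝ) ^ (δ - 1) + (n : ℝ) ^ (-(δ / 2) + ε)) := by
    calc _ ≤ (n : ℝ) ^ (δ - 1) * (K * (1 + (n : ℝ) ^ (1 - 2 * δ + ε))) := by gcongr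
      _ = K * ((n : ℝ) ^ (δ - 1) + (n : ℝ) ^ (-δ + ε)) := by rw [e]; ring
      _ ≤ _ := by gcongr
  have h4 : 0 ≤ (n : ℝ) ^ (δ - 1) * ∫ X, X.entry 1 1 ∂uniformTable n δ B C := by positivity
  have h5 : 2 * (B * C) * (n : ℝ) ^ (-δ) ≤ 2 * (B * C) * (n : ℝ) ^ (-(δ / 2) + ε) := by gcongr
  have h6 : 0 ≤ 2 * (B * C) * (n : ℝ) ^ (δ - 1) := by positivity
  have h7 : 0 ≤ (n : ℝ) ^ (-(δ / 2) + ε) := by positivity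
  rw [abs_le] at habs ⊢
  constructor <;> linarith [habs.1, habs.2]

theorem isBigO_side_min_supercritical (hB : 0 < B) (hC : 0 < C) (h : criticalB C < B)
    (hδ0 : 0 < δ) (hδ1 : δ < 1) {α ε : ℝ} (hα : 0 < α) (hε : 0 < ε) :
    (fun n : ℕ => (∫ X, min (X.entry 1 (n + 1)) ((n : ℝ) ^ α) ∂uniformTable n δ B C)
        - criticalB C * C)
      =O[atTop] fun n : ℕ => (n : ℝ) ^ (δ - 1) + (n : ℝ) ^ (α - δ / 2 + ε) := by
  obtain ⟨K, hK0, hK⟩ := supercritical_side hB hC h hδ0 hδ1 hε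
  refine isBigO_of_eventually_abs_le (K + 6) (fun n => by positivity) ?_
  filter_upwards [hK, eventually_side_max_le hB hC hδ0.le hδ1 hα hε, eventually_ge_atTop 1]
    with n h1 h2 hn1
  have hn1' : (1 : ℝ) ≤ n := by exact_mod_cast hn1
  have h3 := integral_max_nonneg (n := n) (δ := δ) (B := B) (C := C) 1 (n + 1) ((n : ℝ) ^ α)
  rw [integral_min_entry]
  have p1 : (n : ℝ) ^ (-(δ / 2) + ε) ≤ (n : ℝ) ^ (α - δ / 2 + ε) :=
    Real.rpow_le_rpow_of_exponent_le hn1' (by linarith)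
  have p2 : (n : ℝ) ^ (-δ + ε) ≤ (n : ℝ) ^ (α - δ / 2 + ε) :=
    Real.rpow_le_rpow_of_exponent_le hn1' (by linarith)
  have p3 : K * (n : ℝ) ^ (-(δ / 2) + ε) ≤ K * (n : ℝ) ^ (α - δ / 2 + ε) := by gcongr
  have p4 : 0 ≤ (n : ℝ) ^ (δ - 1) := by positivity
  have p5 : 0 ≤ (n : ℝ) ^ (α - δ / 2 + ε) := by positivity
  rw [abs_le] at h1 ⊢
  constructor <;> linarith [h1.1, h1.2]

/-- For δ < 1 one has -δ/2 < 1/2 - δ, so the bound of `supercritical_side` is stronger. As that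
bound concerns the full mean, δ > 1/2 plays no role. -/
theorem isBigO_side_entry_supercritical (hB : 0 < B) (hC : 0 < C) (h : criticalB C < B)
    (hδ0 : 0 < δ) (hδ1 : δ < 1) {ε : ℝ} (hε : 0 < ε) :
    (fun n : ℕ => (∫ X, X.entry 1 (n + 1) ∂uniformTable n δ B C) - criticalB C * C)
      =O[atTop] fun n : ℕ => (n : ℝ) ^ (δ - 1) + (n : ℝ) ^ (1 / 2 - δ + ε) := by
  obtain ⟨K, hK0, hK⟩ := supercritical_side hB hC h hδ0 hδ1 hε
  refine isBigO_of_eventually_abs_le K (fun n => by positivity) ?_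
  filter_upwards [hK, eventually_ge_atTop 1] with n h1 hn1
  refine h1.trans (mul_le_mul_of_nonneg_left (add_le_add le_rfl ?_) hK0.le)
  exact Real.rpow_le_rpow_of_exponent_le (by exact_mod_cast hn1) (by linarith)

theorem isBigO_heavy_min_subcritical (hB : 0 < B) (hC : 0 < C) (h : B < criticalB C)
    (hδ0 : 1 / 2 < δ) (hδ1 : δ < 1) {α ε : ℝ} (hα : 0 < α) (hε : 0 < ε) :
    (fun n : ℕ => (∫ X, min (X.entry 1 1) ((n : ℝ) ^ α) ∂uniformTable n δ B C)
        - B ^ 2 * (1 + C) / ((criticalB C - B) * (B + criticalB C - 2)))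
      =O[atTop] fun n : ℕ => (n : ℝ) ^ (δ - 1) + (n : ℝ) ^ (α + 1 / 2 - δ + ε) := by
  rw [← heavyMean_eq hB hC h]
  obtain ⟨K, hK0, hK⟩ := subcritical_heavy hB hC h hδ0 hδ1 hε
  refine isBigO_of_eventually_abs_le (K + 12) (fun n => by positivity) ?_
  filter_upwards [hK, eventually_heavy_max_le hB hC h hδ0 hδ1 hα hε, eventually_ge_atTop 1]
    with n h1 h2 hn1
  have hn1' : (1 : ℝ) ≤ n := by exact_mod_cast hn1
  have h3 := integral_max_nonneg (n := n) (δ := δ) (B := B) (C := C) 1 1 ((n : ℝ) ^ α)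
  rw [integral_min_entry]
  have p1 : (n : ℝ) ^ (1 / 2 - δ + ε) ≤ (n : ℝ) ^ (α + 1 / 2 - δ + ε) :=
    Real.rpow_le_rpow_of_exponent_le hn1' (by linarith)
  have p2 : (n : ℝ) ^ (1 - 2 * δ + ε) ≤ (n : ℝ) ^ (α + 1 / 2 - δ + ε) :=
    Real.rpow_le_rpow_of_exponent_le hn1' (by linarith)
  have p3 : K * (n : ℝ) ^ (1 / 2 - δ + ε) ≤ K * (n : ℝ) ^ (α + 1 / 2 - δ + ε) := by gcongr
  have p4 : 0 ≤ (n : ℝ) ^ (δ - 1) := by positivity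
  have p5 : 0 ≤ (n : ℝ) ^ (α + 1 / 2 - δ + ε) := by positivity
  rw [abs_le] at h1 ⊢
  constructor <;> linarith [h1.1, h1.2]

theorem eventually_abs_heavy_deficit_le (hB : 0 < B) (hC : 0 < C) (h : criticalB C < B)
    (hδ0 : 0 < δ) (hδ1 : δ < 1) {ε : ℝ} (hε : 0 < ε) :
    ∃ K : ℝ, 0 < K ∧ ∀ᶠ n : ℕ in atTop, |C * (B - criticalB C)
        - (n : ℝ) ^ (δ - 1) * ∫ X, X.entry 1 1 ∂uniformTable n δ B C|
      ≤ K * ((n : ℝ) ^ (δ - 1) + (n : ℝ) ^ (-(δ / 2) + ε)) := by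
  obtain ⟨K, hK0, hK⟩ := supercritical_side hB hC h hδ0 hδ1 hε
  refine ⟨K + 1 + 2 * (B * C), by positivity, ?_⟩
  filter_upwards [hK, eventually_ge_atTop 1] with n h1 hn1
  have hn1' : (1 : ℝ) ≤ n := by exact_mod_cast hn1
  have habs := abs_side_add_heavy_le (δ := δ) hB hC hn1 hδ0.le hδ1.le
  have p2 : (n : ℝ) ^ (-δ) ≤ (n : ℝ) ^ (-(δ / 2) + ε) :=
    Real.rpow_le_rpow_of_exponent_le hn1' (by linarith)
  have p3 : 2 * (B * C) * (n : ℝ) ^ (-δ) ≤ 2 * (B * C) * (n : ℝ) ^ (-(δ / 2) + ε) := by gcongr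
  have p4 : 0 ≤ 2 * (B * C) * (n : ℝ) ^ (δ - 1) := by positivity
  have p5 : 0 ≤ (n : ℝ) ^ (-(δ / 2) + ε) := by positivity
  rw [abs_le] at h1 habs ⊢
  constructor <;> linarith [h1.1, h1.2, habs.1, habs.2]

/-- The excess term is itself O(n^{-δ+ε}), so subtracting it does not affect the estimate. -/
theorem isBigO_heavy_max_supercritical (hB : 0 < B) (hC : 0 < C) (h : criticalB C < B)
    (hδ0 : 0 < δ) (hδ1 : δ < 1) {α ε : ℝ} (hα : 0 < α) (hε : 0 < ε) :
    (fun n : ℕ => C * (B - criticalB C)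
        - (n : ℝ) ^ (δ - 1) * (∫ X, X.entry 1 1 ∂uniformTable n δ B C)
        - ∫ X, max (X.entry 1 (n + 1) - (n : ℝ) ^ α) 0 ∂uniformTable n δ B C)
      =O[atTop] fun n : ℕ => (n : ℝ) ^ (δ - 1) + (n : ℝ) ^ (α - δ / 2 + ε) := by
  obtain ⟨K, hK0, hK⟩ := eventually_abs_heavy_deficit_le hB hC h hδ0 hδ1 hε
  refine isBigO_of_eventually_abs_le (K + 6) (fun n => by positivity) ?_
  filter_upwards [hK, eventually_side_max_le hB hC hδ0.le hδ1 hα hε, eventually_ge_atTop 1]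
    with n h1 h2 hn1
  have hn1' : (1 : ℝ) ≤ n := by exact_mod_cast hn1
  have h3 := integral_max_nonneg (n := n) (δ := δ) (B := B) (C := C) 1 (n + 1) ((n : ℝ) ^ α)
  have p1 : (n : ℝ) ^ (-(δ / 2) + ε) ≤ (n : ℝ) ^ (α - δ / 2 + ε) :=
    Real.rpow_le_rpow_of_exponent_le hn1' (by linarith)
  have p2 : (n : ℝ) ^ (-δ + ε) ≤ (n : ℝ) ^ (α - δ / 2 + ε) :=
    Real.rpow_le_rpow_of_exponent_le hn1' (by linarith)
  have p3 : K * (n : ℝ) ^ (-(δ / 2) + ε) ≤ K * (n : ℝ) ^ (α - δ / 2 + ε) := by gcongr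
  have p4 : 0 ≤ (n : ℝ) ^ (δ - 1) := by positivity
  have p5 : 0 ≤ (n : ℝ) ^ (α - δ / 2 + ε) := by positivity
  rw [abs_le] at h1 ⊢
  constructor <;> linarith [h1.1, h1.2]

theorem isBigO_heavy_entry_supercritical (hB : 0 < B) (hC : 0 < C) (h : criticalB C < B)
    (hδ0 : 0 < δ) (hδ1 : δ < 1) {ε : ℝ} (hε : 0 < ε) :
    (fun n : ℕ => C * (B - criticalB C)
        - (n : ℝ) ^ (δ - 1) * ∫ X, X.entry 1 1 ∂uniformTable n δ B C)
      =O[atTop] fun n : ℕ => (n : ℝ) ^ (δ - 1) + (n : ℝ) ^ (1 / 2 - δ + ε) := by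
  obtain ⟨K, hK0, hK⟩ := eventually_abs_heavy_deficit_le hB hC h hδ0 hδ1 hε
  refine isBigO_of_eventually_abs_le K (fun n => by positivity) ?_
  filter_upwards [hK, eventually_ge_atTop 1] with n h1 hn1
  refine h1.trans (mul_le_mul_of_nonneg_left (add_le_add le_rfl ?_) hK0.le)
  exact Real.rpow_le_rpow_of_exponent_le (by exact_mod_cast hn1) (by linarith)

end

theorem theorem2 (B C : ℝ) (hB : 0 < B) (hC : 0 < C) :
    -- (i) bottom right
    (∀ δ : ℝ, 0 ≤ δ → δ ≤ 1 → ∀ ε : ℝ, 0 < ε →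
      (fun n : ℕ => (∫ X, X.entry (n + 1) (n + 1) ∂uniformTable n δ B C) - C)
        =O[atTop] fun n : ℕ => (n : ℝ) ^ (δ - 1 + ε)) ∧
    -- (ii) sides
    (∀ α ε : ℝ, 0 < α → 0 < ε →
      (B < criticalB C → ∀ δ : ℝ, 0 < δ → δ < 1 →
        (fun n : ℕ => (∫ X, X.entry 1 (n + 1) ∂uniformTable n δ B C) - B * C)
          =O[atTop] fun n : ℕ => (n : ℝ) ^ (δ - 1) + (n : ℝ) ^ (-(δ / 2) + ε)) ∧
      (criticalB C < B → ∀ δ : ℝ, 0 < δ → δ < 1 →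
        (fun n : ℕ => (∫ X, min (X.entry 1 (n + 1)) ((n : ℝ) ^ α) ∂uniformTable n δ B C)
            - criticalB C * C)
          =O[atTop] fun n : ℕ => (n : ℝ) ^ (δ - 1) + (n : ℝ) ^ (α - δ / 2 + ε)) ∧
      (criticalB C < B → ∀ δ : ℝ, 1 / 2 < δ → δ < 1 →
        (fun n : ℕ => (∫ X, X.entry 1 (n + 1) ∂uniformTable n δ B C) - criticalB C * C)
          =O[atTop] fun n : ℕ => (n : ℝ) ^ (δ - 1) + (n : ℝ) ^ (1 / 2 - δ + ε))) ∧
    -- (iii) top left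
    (∀ α ε : ℝ, 0 < α → 0 < ε →
      (B < criticalB C → ∀ δ : ℝ, 0 < δ → δ < 1 →
        (fun n : ℕ => (n : ℝ) ^ (δ - 1) * ∫ X, X.entry 1 1 ∂uniformTable n δ B C)
          =O[atTop] fun n : ℕ => (n : ℝ) ^ (δ - 1) + (n : ℝ) ^ (-δ + ε)) ∧
      (B < criticalB C → ∀ δ : ℝ, 1 / 2 < δ → δ < 1 →
        (fun n : ℕ => (∫ X, min (X.entry 1 1) ((n : ℝ) ^ α) ∂uniformTable n δ B C)
            - B ^ 2 * (1 + C) / ((criticalB C - B) * (B + criticalB C - 2)))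
          =O[atTop] fun n : ℕ => (n : ℝ) ^ (δ - 1) + (n : ℝ) ^ (α + 1 / 2 - δ + ε)) ∧
      (criticalB C < B → ∀ δ : ℝ, 0 < δ → δ < 1 →
        (fun n : ℕ => C * (B - criticalB C)
            - (n : ℝ) ^ (δ - 1) * (∫ X, X.entry 1 1 ∂uniformTable n δ B C)
            - ∫ X, max (X.entry 1 (n + 1) - (n : ℝ) ^ α) 0 ∂uniformTable n δ B C)
          =O[atTop] fun n : ℕ => (n : ℝ) ^ (δ - 1) + (n : ℝ) ^ (α - δ / 2 + ε)) ∧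
      (criticalB C < B → ∀ δ : ℝ, 1 / 2 < δ → δ < 1 →
        (fun n : ℕ => C * (B - criticalB C)
            - (n : ℝ) ^ (δ - 1) * ∫ X, X.entry 1 1 ∂uniformTable n δ B C)
          =O[atTop] fun n : ℕ => (n : ℝ) ^ (δ - 1) + (n : ℝ) ^ (1 / 2 - δ + ε))) := by
  refine ⟨fun δ hδ0 hδ1 ε hε => isBigO_light_entry hB hC hδ0 hδ1 hε, fun α ε hα hε => ⟨?_, ?_, ?_⟩,
    fun α ε hα hε => ⟨?_, ?_, ?_, ?_⟩⟩
  · exact fun h δ hδ0 hδ1 => isBigO_side_entry_subcritical hB hC h hδ0 hδ1 hε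
  · exact fun h δ hδ0 hδ1 => isBigO_side_min_supercritical hB hC h hδ0 hδ1 hα hε
  · exact fun h δ hδ0 hδ1 =>
      isBigO_side_entry_supercritical hB hC h (one_half_pos.trans hδ0) hδ1 hε
  · exact fun h δ hδ0 hδ1 => isBigO_heavy_entry_subcritical hB hC h hδ0 hδ1 hε
  · exact fun h δ hδ0 hδ1 => isBigO_heavy_min_subcritical hB hC h hδ0 hδ1 hα hε
  · exact fun h δ hδ0 hδ1 => isBigO_heavy_max_supercritical hB hC h hδ0 hδ1 hα hε
  · exact fun h δ hδ0 hδ1 =>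
      isBigO_heavy_entry_supercritical hB hC h (one_half_pos.trans hδ0) hδ1 hε
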